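/- Let $\Phi$ be a field of characteristic $3$ and let $n\ge 1$ be an integer. **Notation.** Let $\mathcal O=\mathcal O(1;n)$ be the commutative divided power algebra over $\Phi$ with basis $x^{(i)}$, $0\le i<3^n$, and product $x^{(i)}x^{(j)}=\binom{i+j}{i}x^{(i+j)}$ (with $x^{(k)}=0$ for $k\ge 3^n$), and let $\partial$ be its derivation with $\partial x^{(0)}=0$, $\partial x^{(i)}=x^{(i-1)}$. Let $W=W(1;n)=\mathcal O\,\partial$ be the Lie algebra with $[f\partial,g\partial]=(f\,\partial(g)-g\,\partial(f))\partial$, and let $\mathcal O_{(\mathrm{div})}$ be the $W$-module with underlying space $\mathcal O$ and action $f\partial\cdot g=\partial(fg)$. *Frank algebra.* Let $U$ be a $2$-dimensional $\Phi$-vector space with a non-degenerate skew-symmetric form $\lambda$ and put $\phi(u,u')(u'')=\lambda(u,u'')u'+\lambda(u',u'')u$, so that $\phi(u,u')\in\mathfrak{sl}(U)$. The Frank Lie algebra is $$\mathcal F(n)=U\otimes\mathcal O_{(\mathrm{div})}\ \oplus\ \mathfrak{sl}(U)\otimes\mathcal O\ \oplus\ W ,$$ where $W$ is a subalgebra, $[a\otimes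 f,b\otimes g]=[a,b]\otimes fg$ on $\mathfrak{sl}(U)\otimes\mathcal O$, $[h\partial,a\otimes f]=a\otimes h\,\partial(f)$, $[h\partial,u\otimes f]=u\otimes\partial(hf)$, $[a\otimes f,u\otimes g]=a(u)\otimes fg$, and $$[u\otimes f,v\otimes g]=\phi(u,v)\otimes\bigl(f\,\partial(g)-g\,\partial(f)\bigr)+\lambda(u,v)\,fg\,\partial .$$ *Semisimplification.* $\mathrm{Rep}(\alpha_3)$ is the $\Phi$-linear symmetric tensor category of finite-dimensional $\Phi$-vector spaces $V$ with an endomorphism $d$ satisfying $d^3=0$; morphisms commute with $d$, on tensor products $d$ acts as $d\otimes 1+1\otimes d$, and the braiding is the flip. A morphism $f:X\to Y$ is negligible if $\mathrm{Tr}(fu)=0$ for all $u:Y\to X$. The semisimplification $\overline{\mathrm{Rep}(\alpha_3)}$ is the quotient of $\mathrm{Rep}(\alpha_3)$ by the negligible morphisms, with the induced symmetric tensor structure. A (not necessarily associative) algebra in a tensor category is an object $A$ with a morphism $A\otimes A\to A$; tensor functors map algebras to algebras. Let $\mathrm{sVec}$ be the symmetric tensor category of finite-dimensional super vector spaces (braiding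 with the usual sign rule). *Contact superalgebra.* Let $\mathcal O(1,1;n)=\mathcal O\oplus\mathcal O\theta$ with $\theta$ odd, $\theta^2=0$, let $W(1,1;n)$ be the Lie superalgebra of its superderivations $a\partial+b\,\partial_\theta$ with the supercommutator, and let $K(1,1;n)$ be the Lie subsuperalgebra of $W(1,1;n)$ generated by the elements $$D_K(f)=\theta\,\partial(f)\,\partial_\theta+2f\partial,\qquad D_K(g\theta)=g\,\partial_\theta+g\theta\,\partial\qquad(f,g\in\mathcal O).$$ Let $W(1;n)\oplus\mathcal O_{(\mathrm{div})}$ be the superalgebra with even part $W(1;n)$, odd part the $W(1;n)$-module $\mathcal O_{(\mathrm{div})}$, and $[x,y]=-xy\,\partial$ for odd $x,y$. **Proposition.** Let $e\in\mathfrak{sl}(U)$ be nilpotent and non-zero. Then $d=\mathrm{ad}(e\otimes 1)$ is a derivation of $\mathcal F(n)$ with $d^3=0$, so that $(\mathcal F(n),d)$ with its Lie bracket is an algebra in $\mathrm{Rep}(\alpha_3)$. There is a $\Phi$-linear symmetric tensor equivalence $E:\overline{\mathrm{Rep}(\alpha_3)}\to\mathrm{sVec}$, depending only on $\Phi$, such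 that for all $n\ge 1$ and all $U,\lambda,e$ as above the composite of the semisimplification functor $\mathrm{Rep}(\alpha_3)\to\overline{\mathrm{Rep}(\alpha_3)}$ with $E$ maps the algebra $(\mathcal F(n),d)$ to a superalgebra isomorphic to the modular contact Lie superalgebra $K(1,1;n)$. Moreover $$K(1,1;n)\;\cong\;W(1;n)\oplus\mathcal O_{(\mathrm{div})}$$ as superalgebras. -/

import Mathlib

open CategoryTheory MonoidalCategory
open scoped TensorProduct

universe u

set_option linter.unusedSectionVars false

namespace FrankSemisimplification

noncomputable section

/-! ### The truncated divided power algebra -/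

/-- The underlying space of the divided power algebra `𝒪(1; n)`: coordinates with respect to the
basis `x⁽ⁱ⁾`, `0 ≤ i < 3 ^ n`. -/
def DP (Φ : Type u) (n : ℕ) : Type u := Fin (3 ^ n) → Φ

namespace DP

variable (Φ : Type u) [Field Φ] (n : ℕ)

instance : AddCommGroup (DP Φ n) := inferInstanceAs (AddCommGroup (Fin (3 ^ n) → Φ))
instance : Module Φ (DP Φ n) := inferInstanceAs (Module Φ (Fin (3 ^ n) → Φ))
instance : Module.Finite Φ (DP Φ n) := inferInstanceAs (Module.Finite Φ (Fin (3 ^ n) → Φ))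

/-- The basis of the elements `x⁽ⁱ⁾`. -/
def basis : Module.Basis (Fin (3 ^ n)) Φ (DP Φ n) := Pi.basisFun Φ (Fin (3 ^ n))

/-- The element `x⁽ᵏ⁾` for every natural number `k`; it is zero for `k ≥ 3 ^ n`. -/
def x (k : ℕ) : DP Φ n := if h : k < 3 ^ n then basis Φ n ⟨k, h⟩ else 0

/-- The bilinear product with `x⁽ⁱ⁾ x⁽ʲ⁾ = (i + j).choose i • x⁽ⁱ⁺ʲ⁾`. -/
def mulLin : DP Φ n →ₗ[Φ] DP Φ n →ₗ[Φ] DP Φ n :=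
  (basis Φ n).constr Φ fun i => (basis Φ n).constr Φ fun j =>
    (((i : ℕ) + j).choose i : Φ) • x Φ n (i + j)

/-- The derivation `∂` with `∂ x⁽⁰⁾ = 0` and `∂ x⁽ⁱ⁾ = x⁽ⁱ⁻¹⁾` for `1 ≤ i < 3 ^ n`. -/
def partialLin : DP Φ n →ₗ[Φ] DP Φ n :=
  (basis Φ n).constr Φ fun i => if (i : ℕ) = 0 then 0 else x Φ n (i - 1)

variable {Φ n}

instance : Mul (DP Φ n) := ⟨fun f g => mulLin Φ n f g⟩
instance : One (DP Φ n) := ⟨x Φ n 0⟩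

theorem mul_def (f g : DP Φ n) : f * g = mulLin Φ n f g := rfl
theorem one_def : (1 : DP Φ n) = x Φ n 0 := rfl

theorem x_of_le {k : ℕ} (h : 3 ^ n ≤ k) : x Φ n k = 0 := by
  simp [x, not_lt.mpr h]

theorem basis_eq (i : Fin (3 ^ n)) : basis Φ n i = x Φ n i := by
  simp [x]

theorem x_mul_x (i j : ℕ) : x Φ n i * x Φ n j = ((i + j).choose i : Φ) • x Φ n (i + j) := by
  by_cases hi : i < 3 ^ n
  · by_cases hj : j < 3 ^ n
    · rw [mul_def]
      have h1 := basis_eq (Φ := Φ) (n := n) ⟨i, hi⟩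
      have h2 := basis_eq (Φ := Φ) (n := n) ⟨j, hj⟩
      simp only at h1 h2
      rw [← h1, ← h2, mulLin, Module.Basis.constr_basis, Module.Basis.constr_basis]
    · rw [x_of_le (k := j) (by omega), x_of_le (k := i + j) (by omega), mul_def]
      simp
  · rw [x_of_le (k := i) (by omega), x_of_le (k := i + j) (by omega), mul_def]
    simp

theorem induction {p : DP Φ n → Prop} (f : DP Φ n) (hx : ∀ i, i < 3 ^ n → p (x Φ n i))
    (h0 : p 0) (hadd : ∀ a b, p a → p b → p (a + b)) (hsmul : ∀ (c : Φ) a, p a → p (c • a)) :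
    p f := by
  have hf : f ∈ Submodule.span Φ (Set.range (basis Φ n)) := by
    rw [(basis Φ n).span_eq]; trivial
  induction hf using Submodule.span_induction with
  | mem y hy =>
    obtain ⟨i, rfl⟩ := hy
    rw [basis_eq]; exact hx _ i.2
  | zero => exact h0
  | add a b _ _ ha hb => exact hadd a b ha hb
  | smul c a _ ha => exact hsmul c a ha

protected theorem add_mul (f g h : DP Φ n) : (f + g) * h = f * h + g * h := by simp [mul_def]
protected theorem mul_add (f g h : DP Φ n) : f * (g + h) = f * g + f * h := by simp [mul_def]
protected theorem smul_mul (c : Φ) (f g : DP Φ n) : (c • f) * g = c • (f * g) := by simp [mul_def]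
protected theorem mul_smul (c : Φ) (f g : DP Φ n) : f * (c • g) = c • (f * g) := by simp [mul_def]
protected theorem zero_mul (f : DP Φ n) : 0 * f = 0 := by simp [mul_def]
protected theorem mul_zero (f : DP Φ n) : f * 0 = 0 := by simp [mul_def]

protected theorem mul_comm (f g : DP Φ n) : f * g = g * f := by
  induction f using DP.induction with
  | hx i hi =>
    induction g using DP.induction with
    | hx j hj =>
      rw [x_mul_x, x_mul_x, add_comm j i, Nat.choose_symm_add]
    | h0 => rw [DP.mul_zero, DP.zero_mul]
    | hadd a b ha hb => rw [DP.mul_add, DP.add_mul, ha, hb]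
    | hsmul c a ha => rw [DP.mul_smul, DP.smul_mul, ha]
  | h0 => rw [DP.mul_zero, DP.zero_mul]
  | hadd a b ha hb => rw [DP.mul_add, DP.add_mul, ha, hb]
  | hsmul c a ha => rw [DP.mul_smul, DP.smul_mul, ha]

protected theorem mul_assoc (f g h : DP Φ n) : f * g * h = f * (g * h) := by
  induction f using DP.induction with
  | hx i hi =>
    induction g using DP.induction with
    | hx j hj =>
      induction h using DP.induction with
      | hx k hk =>
        rw [x_mul_x, x_mul_x, DP.smul_mul, DP.mul_smul, x_mul_x, x_mul_x, smul_smul, smul_smul,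
          add_assoc]
        congr 1
        have h := Nat.choose_mul (n := i + (j + k)) (k := i + j) (s := i) (by omega)
        have e1 : i + (j + k) - i = j + k := by omega
        have e2 : i + j - i = j := by omega
        rw [e1, e2] at h
        rw [← Nat.cast_mul, ← Nat.cast_mul, mul_comm ((i + j).choose i), h, mul_comm]
      | h0 => simp only [DP.mul_zero]
      | hadd a b ha hb => simp only [DP.mul_add, ha, hb]
      | hsmul c a ha => simp only [DP.mul_smul, ha]
    | h0 => simp only [DP.mul_zero, DP.zero_mul]
    | hadd a b ha hb => simp only [DP.mul_add, DP.add_mul, ha, hb]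
    | hsmul c a ha => simp only [DP.mul_smul, DP.smul_mul, ha]
  | h0 => simp only [DP.zero_mul]
  | hadd a b ha hb => simp only [DP.add_mul, ha, hb]
  | hsmul c a ha => simp only [DP.smul_mul, ha]

protected theorem one_mul (f : DP Φ n) : 1 * f = f := by
  induction f using DP.induction with
  | hx i hi => rw [one_def, x_mul_x]; simp
  | h0 => rw [DP.mul_zero]
  | hadd a b ha hb => rw [DP.mul_add, ha, hb]
  | hsmul c a ha => rw [DP.mul_smul, ha]

instance : CommRing (DP Φ n) :=
  { (inferInstance : AddCommGroup (DP Φ n)) with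
    mul := (· * ·)
    one := 1
    left_distrib := DP.mul_add
    right_distrib := DP.add_mul
    zero_mul := DP.zero_mul
    mul_zero := DP.mul_zero
    mul_assoc := DP.mul_assoc
    one_mul := DP.one_mul
    mul_one := fun f => by rw [DP.mul_comm, DP.one_mul]
    mul_comm := DP.mul_comm }

instance : Algebra Φ (DP Φ n) := Algebra.ofModule DP.smul_mul DP.mul_smul

theorem partialLin_x_zero : partialLin Φ n (x Φ n 0) = 0 := by
  have h := basis_eq (Φ := Φ) (n := n) ⟨0, by positivity⟩
  simp only at h
  rw [← h, partialLin, Module.Basis.constr_basis]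
  simp

theorem partialLin_x_succ {k : ℕ} (hk : k + 1 < 3 ^ n) :
    partialLin Φ n (x Φ n (k + 1)) = x Φ n k := by
  have h := basis_eq (Φ := Φ) (n := n) ⟨k + 1, hk⟩
  simp only at h
  rw [← h, partialLin, Module.Basis.constr_basis]
  simp

variable [CharP Φ 3]

theorem partialLin_mul (f g : DP Φ n) :
    partialLin Φ n (f * g) = f * partialLin Φ n g + g * partialLin Φ n f := by
  induction f using DP.induction with
  | hx i hi =>
    induction g using DP.induction with
    | hx j hj =>
      rw [x_mul_x, map_smul]
      rcases i with _ | i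
      · rw [partialLin_x_zero, mul_zero, add_zero, ← one_def, one_mul]
        simp
      rcases j with _ | j
      · rw [partialLin_x_zero, mul_zero, zero_add, ← one_def, one_mul]
        simp
      rw [partialLin_x_succ hi, partialLin_x_succ hj, x_mul_x, x_mul_x]
      have e1 : i + 1 + (j + 1) = (i + j + 1) + 1 := by omega
      have e2 : i + 1 + j = i + j + 1 := by omega
      have e3 : j + 1 + i = i + j + 1 := by omega
      have e4 : (j + 1 + i).choose (j + 1) = (i + j + 1).choose i := by
        rw [e3, ← Nat.choose_symm_of_eq_add]; omega
      rw [e4, e1, e2, e3, ← add_smul, ← Nat.cast_add]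
      have e5 : (i + j + 1).choose (i + 1) + (i + j + 1).choose i
          = (i + j + 1 + 1).choose (i + 1) := by
        rw [Nat.choose_succ_succ (i + j + 1) i, add_comm]
      rw [e5]
      rcases lt_trichotomy (i + j + 1 + 1) (3 ^ n) with h | h | h
      · rw [partialLin_x_succ h]
      · have h3 : ((i + j + 1 + 1).choose (i + 1) : Φ) = 0 := by
          rw [CharP.cast_eq_zero_iff Φ 3, h]
          exact Nat.prime_three.dvd_choose_pow (by omega) (by omega)
        rw [h3, zero_smul, zero_smul]
      · rw [x_of_le (k := i + j + 1 + 1) (by omega), x_of_le (k := i + j + 1) (by omega)]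
        simp
    | h0 => simp
    | hadd a b ha hb => rw [mul_add, map_add, map_add, ha, hb]; ring
    | hsmul c a ha => rw [DP.mul_smul, map_smul, map_smul, ha]; simp
  | h0 => simp
  | hadd a b ha hb => rw [add_mul, map_add, map_add, ha, hb]; ring
  | hsmul c a ha => rw [DP.smul_mul, map_smul, map_smul, ha]; simp

/-- `∂` as a derivation of the algebra `𝒪(1; n)`. -/
def partialD (Φ : Type u) [Field Φ] [CharP Φ 3] (n : ℕ) : Derivation Φ (DP Φ n) (DP Φ n) where
  toLinearMap := partialLin Φ n
  map_one_eq_zero' := partialLin_x_zero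
  leibniz' f g := by simp [partialLin_mul]

end DP


/-! ### The Lie algebra `W(1; n)` and the module `𝒪_(div)` -/

section Witt

variable (Φ : Type u) [Field Φ] [CharP Φ 3] (n : ℕ)

/-- The coefficient of `[f ∂, g ∂] = (f ∂(g) - g ∂(f)) ∂`.  The elements `f ∂` of `W(1; n)` are
represented by their coefficients `f` (for `1 ≤ n` one has `∂ x⁽¹⁾ = 1`, hence the map `f ↦ f ∂`
is injective). -/
def wittBr : DP Φ n →ₗ[Φ] DP Φ n →ₗ[Φ] DP Φ n :=
  (LinearMap.mul Φ (DP Φ n)).compl₂ (DP.partialD Φ n).toLinearMap -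
    ((LinearMap.mul Φ (DP Φ n)).compl₂ (DP.partialD Φ n).toLinearMap).flip

/-- The action `f ∂ · g = f ∂(g)` of `W(1; n)` on `𝒪(1; n)`. -/
def wittAct : DP Φ n →ₗ[Φ] DP Φ n →ₗ[Φ] DP Φ n :=
  (LinearMap.mul Φ (DP Φ n)).compl₂ (DP.partialD Φ n).toLinearMap

/-- The action `f ∂ · g = ∂(f g)` of `W(1; n)` on `𝒪_(div)`. -/
def divAct : DP Φ n →ₗ[Φ] DP Φ n →ₗ[Φ] DP Φ n :=
  (LinearMap.mul Φ (DP Φ n)).compr₂ (DP.partialD Φ n).toLinearMap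

variable {Φ n}

@[simp] theorem wittBr_apply (f g : DP Φ n) :
    wittBr Φ n f g = f * DP.partialD Φ n g - g * DP.partialD Φ n f := rfl

@[simp] theorem wittAct_apply (f g : DP Φ n) : wittAct Φ n f g = f * DP.partialD Φ n g := rfl

@[simp] theorem divAct_apply (f g : DP Φ n) : divAct Φ n f g = DP.partialD Φ n (f * g) := rfl

/-- `wittBr` is the commutator bracket of the derivations `f ∂`. -/
theorem lie_smul_partialD (f g : DP Φ n) :
    ⁅f • DP.partialD Φ n, g • DP.partialD Φ n⁆ = wittBr Φ n f g • DP.partialD Φ n := by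
  ext h
  simp [Derivation.commutator_apply]
  ring

end Witt

/-! ### The Frank Lie algebra -/

attribute [local instance] LieRing.ofAssociativeRing

/-- A two-dimensional vector space `U` with a non-degenerate skew-symmetric form. -/
structure SymplecticPlane (Φ U : Type u) [Field Φ] [AddCommGroup U] [Module Φ U] where
  form : U →ₗ[Φ] U →ₗ[Φ] Φ
  skew : ∀ u v, form u v = -form v u
  nondegenerate : ∀ u, (∀ v, form u v = 0) → u = 0
  finrank_eq : Module.finrank Φ U = 2

section sl

variable (Φ U : Type u) [Field Φ] [AddCommGroup U] [Module Φ U]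

/-- The Lie algebra `𝔰𝔩(U)` of endomorphisms of trace zero. -/
def sl : LieSubalgebra Φ (Module.End Φ U) where
  toSubmodule := LinearMap.ker (LinearMap.trace Φ U)
  lie_mem' {a b} _ _ := by
    change LinearMap.trace Φ U (a * b - b * a) = 0
    rw [map_sub, LinearMap.trace_mul_comm, sub_self]

variable (n : ℕ)

instance : AddCommGroup (sl Φ U) := inferInstance
instance : AddCommMonoid (sl Φ U) := inferInstance
instance : Module Φ (sl Φ U) := inferInstance
instance : AddCommGroup (sl Φ U ⊗[Φ] DP Φ n) := inferInstance
instance : AddCommMonoid (sl Φ U ⊗[Φ] DP Φ n) := inferInstance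
instance : Module Φ (sl Φ U ⊗[Φ] DP Φ n) := inferInstance
instance : AddCommGroup (U ⊗[Φ] DP Φ n) := inferInstance
instance : AddCommMonoid (U ⊗[Φ] DP Φ n) := inferInstance
instance : Module Φ (U ⊗[Φ] DP Φ n) := inferInstance

end sl

section Frank

variable {Φ U : Type u} [Field Φ] [CharP Φ 3] [AddCommGroup U] [Module Φ U]

namespace SymplecticPlane

theorem finite (S : SymplecticPlane Φ U) : Module.Finite Φ U :=
  Module.finite_of_finrank_eq_succ (n := 1) S.finrank_eq

variable (S : SymplecticPlane Φ U)

/-- `φ(u, u')(u'') = λ(u, u'') u' + λ(u', u'') u` as an endomorphism of `U`. -/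
def phiEnd : U →ₗ[Φ] U →ₗ[Φ] Module.End Φ U :=
  LinearMap.mk₂ Φ (fun u u' => (S.form u).smulRight u' + (S.form u').smulRight u)
    (fun a b c => by ext; simp [add_smul]; abel)
    (fun r a b => by ext; simp [mul_smul, smul_comm r])
    (fun a b c => by ext; simp [add_smul]; abel)
    (fun r a b => by ext; simp [mul_smul, smul_comm r])

theorem phiEnd_apply (u u' u'' : U) :
    S.phiEnd u u' u'' = S.form u u'' • u' + S.form u' u'' • u := rfl

/-- The map `φ : U × U → 𝔰𝔩(U)`. -/
def phi : U →ₗ[Φ] U →ₗ[Φ] sl Φ U :=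
  LinearMap.mk₂ Φ (fun u u' => ⟨S.phiEnd u u', by
      have := S.finite
      change LinearMap.trace Φ U ((S.form u).smulRight u' + (S.form u').smulRight u) = 0
      rw [map_add, LinearMap.trace_smulRight, LinearMap.trace_smulRight, S.skew u u',
        neg_add_cancel]⟩)
    (fun a b c => Subtype.ext (by simp))
    (fun r a b => Subtype.ext (by simp))
    (fun a b c => Subtype.ext (by simp))
    (fun r a b => Subtype.ext (by simp))

theorem phi_apply (u u' u'' : U) :
    (S.phi u u' : Module.End Φ U) u'' = S.form u u'' • u' + S.form u' u'' • u := rfl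

theorem form_self (u : U) : S.form u u = 0 := by
  have h : S.form u u + S.form u u = 0 := by
    nth_rewrite 1 [S.skew u u]; exact neg_add_cancel _
  have h3 : (3 : Φ) = 0 := CharP.cast_eq_zero Φ 3
  linear_combination (-1 : Φ) * h + S.form u u * h3

end SymplecticPlane

/-- The underlying space `U ⊗ 𝒪_(div) ⊕ 𝔰𝔩(U) ⊗ 𝒪 ⊕ W` of the Frank algebra `ℱ(n)`. -/
def Frank (_S : SymplecticPlane Φ U) (n : ℕ) : Type u :=
  (U ⊗[Φ] DP Φ n) × (sl Φ U ⊗[Φ] DP Φ n) × DP Φ n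

namespace Frank

section components

variable (n : ℕ)

/-- `[a ⊗ f, b ⊗ g] = [a, b] ⊗ f g` on `𝔰𝔩(U) ⊗ 𝒪`. -/
def slBr : (sl Φ U ⊗[Φ] DP Φ n) →ₗ[Φ] (sl Φ U ⊗[Φ] DP Φ n) →ₗ[Φ] (sl Φ U ⊗[Φ] DP Φ n) :=
  TensorProduct.map₂ (LieModule.toEnd Φ (sl Φ U) (sl Φ U)).toLinearMap (LinearMap.mul Φ (DP Φ n))

/-- `[a ⊗ f, u ⊗ g] = a(u) ⊗ f g` for `a ⊗ f ∈ 𝔰𝔩(U) ⊗ 𝒪` and `u ⊗ g ∈ U ⊗ 𝒪_(div)`. -/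
def slU : (sl Φ U ⊗[Φ] DP Φ n) →ₗ[Φ] (U ⊗[Φ] DP Φ n) →ₗ[Φ] (U ⊗[Φ] DP Φ n) :=
  TensorProduct.map₂ (sl Φ U).toSubmodule.subtype (LinearMap.mul Φ (DP Φ n))

/-- `[h ∂, a ⊗ f] = a ⊗ h ∂(f)` for `h ∂ ∈ W` and `a ⊗ f ∈ 𝔰𝔩(U) ⊗ 𝒪`. -/
def wSl : DP Φ n →ₗ[Φ] (sl Φ U ⊗[Φ] DP Φ n) →ₗ[Φ] (sl Φ U ⊗[Φ] DP Φ n) :=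
  LinearMap.lTensorHom (sl Φ U) ∘ₗ wittAct Φ n

/-- `[h ∂, u ⊗ f] = u ⊗ ∂(h f)` for `h ∂ ∈ W` and `u ⊗ f ∈ U ⊗ 𝒪_(div)`. -/
def wU : DP Φ n →ₗ[Φ] (U ⊗[Φ] DP Φ n) →ₗ[Φ] (U ⊗[Φ] DP Φ n) :=
  LinearMap.lTensorHom U ∘ₗ divAct Φ n

variable (S : SymplecticPlane Φ U)

/-- The component `φ(u, v) ⊗ (f ∂(g) - g ∂(f))` of `[u ⊗ f, v ⊗ g]`. -/
def uuSl : (U ⊗[Φ] DP Φ n) →ₗ[Φ] (U ⊗[Φ] DP Φ n) →ₗ[Φ] (sl Φ U ⊗[Φ] DP Φ n) :=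
  TensorProduct.map₂ S.phi (wittBr Φ n)

/-- The component `λ(u, v) f g ∂` of `[u ⊗ f, v ⊗ g]`. -/
def uuW : (U ⊗[Φ] DP Φ n) →ₗ[Φ] (U ⊗[Φ] DP Φ n) →ₗ[Φ] DP Φ n :=
  (TensorProduct.map₂ S.form (LinearMap.mul Φ (DP Φ n))).compr₂
    (TensorProduct.lid Φ (DP Φ n)).toLinearMap

variable {n}

@[simp] theorem slBr_tmul (a b : sl Φ U) (f g : DP Φ n) :
    slBr n (a ⊗ₜ[Φ] f) (b ⊗ₜ[Φ] g) = ⁅a, b⁆ ⊗ₜ (f * g) := rfl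
@[simp] theorem slU_tmul (a : sl Φ U) (u : U) (f g : DP Φ n) :
    slU n (a ⊗ₜ[Φ] f) (u ⊗ₜ[Φ] g) = (a : Module.End Φ U) u ⊗ₜ (f * g) := rfl
@[simp] theorem wSl_tmul (h : DP Φ n) (a : sl Φ U) (f : DP Φ n) :
    wSl n h (a ⊗ₜ[Φ] f) = a ⊗ₜ (h * DP.partialD Φ n f) := rfl
@[simp] theorem wU_tmul (h : DP Φ n) (u : U) (f : DP Φ n) :
    wU n h (u ⊗ₜ[Φ] f) = u ⊗ₜ (DP.partialD Φ n (h * f)) := rfl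
@[simp] theorem uuSl_tmul (u v : U) (f g : DP Φ n) :
    uuSl n S (u ⊗ₜ[Φ] f) (v ⊗ₜ[Φ] g) =
      S.phi u v ⊗ₜ (f * DP.partialD Φ n g - g * DP.partialD Φ n f) := rfl
@[simp] theorem uuW_tmul (u v : U) (f g : DP Φ n) :
    uuW n S (u ⊗ₜ[Φ] f) (v ⊗ₜ[Φ] g) = S.form u v • (f * g) := rfl

end components

variable (S : SymplecticPlane Φ U) (n : ℕ)

instance : AddCommGroup (Frank S n) :=
  inferInstanceAs (AddCommGroup ((U ⊗[Φ] DP Φ n) × (sl Φ U ⊗[Φ] DP Φ n) × DP Φ n))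
instance : Module Φ (Frank S n) :=
  inferInstanceAs (Module Φ ((U ⊗[Φ] DP Φ n) × (sl Φ U ⊗[Φ] DP Φ n) × DP Φ n))
instance : AddCommMonoid (Frank S n) := inferInstance
instance : Module.Finite Φ (Frank S n) :=
  have := S.finite
  inferInstanceAs (Module.Finite Φ ((U ⊗[Φ] DP Φ n) × (sl Φ U ⊗[Φ] DP Φ n) × DP Φ n))

/-- The inclusion of `U ⊗ 𝒪_(div)`. -/
def inU : U ⊗[Φ] DP Φ n →ₗ[Φ] Frank S n :=
  LinearMap.inl Φ (U ⊗[Φ] DP Φ n) ((sl Φ U ⊗[Φ] DP Φ n) × DP Φ n)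
/-- The inclusion of `𝔰𝔩(U) ⊗ 𝒪`. -/
def inSl : sl Φ U ⊗[Φ] DP Φ n →ₗ[Φ] Frank S n :=
  LinearMap.inr Φ (U ⊗[Φ] DP Φ n) ((sl Φ U ⊗[Φ] DP Φ n) × DP Φ n) ∘ₗ
    LinearMap.inl Φ (sl Φ U ⊗[Φ] DP Φ n) (DP Φ n)
/-- The inclusion of `W`. -/
def inW : DP Φ n →ₗ[Φ] Frank S n :=
  LinearMap.inr Φ (U ⊗[Φ] DP Φ n) ((sl Φ U ⊗[Φ] DP Φ n) × DP Φ n) ∘ₗ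
    LinearMap.inr Φ (sl Φ U ⊗[Φ] DP Φ n) (DP Φ n)

variable {S n}

/-- The bracket of the Frank algebra. -/
instance : Bracket (Frank S n) (Frank S n) where
  bracket X Y :=
    (slU n X.2.1 Y.1 - slU n Y.2.1 X.1 + (wU n X.2.2 Y.1 - wU n Y.2.2 X.1),
      uuSl n S X.1 Y.1 + slBr n X.2.1 Y.2.1 + (wSl n X.2.2 Y.2.1 - wSl n Y.2.2 X.2.1),
      uuW n S X.1 Y.1 + wittBr Φ n X.2.2 Y.2.2)

theorem lie_def (X Y : Frank S n) : ⁅X, Y⁆ =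
    ((slU n X.2.1 Y.1 - slU n Y.2.1 X.1 + (wU n X.2.2 Y.1 - wU n Y.2.2 X.1),
      uuSl n S X.1 Y.1 + slBr n X.2.1 Y.2.1 + (wSl n X.2.2 Y.2.1 - wSl n Y.2.2 X.2.1),
      uuW n S X.1 Y.1 + wittBr Φ n X.2.2 Y.2.2) : Frank S n) := rfl

@[ext] theorem ext {X Y : Frank S n} (h1 : X.1 = Y.1) (h2 : X.2.1 = Y.2.1) (h3 : X.2.2 = Y.2.2) :
    X = Y := Prod.ext h1 (Prod.ext h2 h3)

@[simp] theorem add_fst (X Y : Frank S n) : (X + Y).1 = X.1 + Y.1 := rfl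
@[simp] theorem add_snd_fst (X Y : Frank S n) : (X + Y).2.1 = X.2.1 + Y.2.1 := rfl
@[simp] theorem add_snd_snd (X Y : Frank S n) : (X + Y).2.2 = X.2.2 + Y.2.2 := rfl
@[simp] theorem neg_fst (X : Frank S n) : (-X).1 = -X.1 := rfl
@[simp] theorem neg_snd_fst (X : Frank S n) : (-X).2.1 = -X.2.1 := rfl
@[simp] theorem neg_snd_snd (X : Frank S n) : (-X).2.2 = -X.2.2 := rfl
@[simp] theorem zero_fst : (0 : Frank S n).1 = 0 := rfl
@[simp] theorem zero_snd_fst : (0 : Frank S n).2.1 = 0 := rfl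
@[simp] theorem zero_snd_snd : (0 : Frank S n).2.2 = 0 := rfl
@[simp] theorem smul_fst (c : Φ) (X : Frank S n) : (c • X).1 = c • X.1 := rfl
@[simp] theorem smul_snd_fst (c : Φ) (X : Frank S n) : (c • X).2.1 = c • X.2.1 := rfl
@[simp] theorem smul_snd_snd (c : Φ) (X : Frank S n) : (c • X).2.2 = c • X.2.2 := rfl
@[simp] theorem inU_fst (a : U ⊗[Φ] DP Φ n) : (inU S n a).1 = a := rfl
@[simp] theorem inU_snd_fst (a : U ⊗[Φ] DP Φ n) : (inU S n a).2.1 = 0 := rfl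
@[simp] theorem inU_snd_snd (a : U ⊗[Φ] DP Φ n) : (inU S n a).2.2 = 0 := rfl
@[simp] theorem inSl_fst (a : sl Φ U ⊗[Φ] DP Φ n) : (inSl S n a).1 = 0 := rfl
@[simp] theorem inSl_snd_fst (a : sl Φ U ⊗[Φ] DP Φ n) : (inSl S n a).2.1 = a := rfl
@[simp] theorem inSl_snd_snd (a : sl Φ U ⊗[Φ] DP Φ n) : (inSl S n a).2.2 = 0 := rfl
@[simp] theorem inW_fst (a : DP Φ n) : (inW S n a).1 = 0 := rfl
@[simp] theorem inW_snd_fst (a : DP Φ n) : (inW S n a).2.1 = 0 := rfl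
@[simp] theorem inW_snd_snd (a : DP Φ n) : (inW S n a).2.2 = a := rfl

@[simp] theorem lie_fst (X Y : Frank S n) : ⁅X, Y⁆.1 =
    slU n X.2.1 Y.1 - slU n Y.2.1 X.1 + (wU n X.2.2 Y.1 - wU n Y.2.2 X.1) := rfl
@[simp] theorem lie_snd_fst (X Y : Frank S n) : ⁅X, Y⁆.2.1 =
    uuSl n S X.1 Y.1 + slBr n X.2.1 Y.2.1 + (wSl n X.2.2 Y.2.1 - wSl n Y.2.2 X.2.1) := rfl
@[simp] theorem lie_snd_snd (X Y : Frank S n) : ⁅X, Y⁆.2.2 =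
    uuW n S X.1 Y.1 + wittBr Φ n X.2.2 Y.2.2 := rfl

protected theorem induction {p : Frank S n → Prop} (X : Frank S n)
    (hU : ∀ u f, p (inU S n (u ⊗ₜ f))) (hS : ∀ a f, p (inSl S n (a ⊗ₜ f)))
    (hW : ∀ f, p (inW S n f)) (h0 : p 0) (hadd : ∀ a b, p a → p b → p (a + b)) : p X := by
  have e : X = inU S n X.1 + (inSl S n X.2.1 + inW S n X.2.2) := by ext <;> simp
  rw [e]
  refine hadd _ _ ?_ (hadd _ _ ?_ (hW _))
  · generalize X.1 = t
    induction t using TensorProduct.induction_on with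
    | zero => simpa using h0
    | tmul u f => exact hU u f
    | add a b ha hb => rw [map_add]; exact hadd _ _ ha hb
  · generalize X.2.1 = t
    induction t using TensorProduct.induction_on with
    | zero => simpa using h0
    | tmul u f => exact hS u f
    | add a b ha hb => rw [map_add]; exact hadd _ _ ha hb

protected theorem add_lie (X Y Z : Frank S n) : ⁅X + Y, Z⁆ = ⁅X, Z⁆ + ⁅Y, Z⁆ := by
  ext <;> simp only [lie_fst, lie_snd_fst, lie_snd_snd, add_fst, add_snd_fst, add_snd_snd, map_add,
    LinearMap.add_apply] <;> abel

protected theorem lie_add (X Y Z : Frank S n) : ⁅X, Y + Z⁆ = ⁅X, Y⁆ + ⁅X, Z⁆ := by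
  ext <;> simp only [lie_fst, lie_snd_fst, lie_snd_snd, add_fst, add_snd_fst, add_snd_snd, map_add,
    LinearMap.add_apply] <;> abel

protected theorem lie_smul (c : Φ) (X Y : Frank S n) : ⁅X, c • Y⁆ = c • ⁅X, Y⁆ := by
  ext <;> simp only [lie_fst, lie_snd_fst, lie_snd_snd, smul_fst, smul_snd_fst, smul_snd_snd,
    map_smul, LinearMap.smul_apply, smul_add, smul_sub]

protected theorem zero_lie (X : Frank S n) : ⁅(0 : Frank S n), X⁆ = 0 := by
  ext <;> simp

protected theorem lie_zero (X : Frank S n) : ⁅X, (0 : Frank S n)⁆ = 0 := by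
  ext <;> simp

protected theorem phi_comm (u v : U) : S.phi u v = S.phi v u := by
  ext w; simp [S.phi_apply, add_comm]

protected theorem skew (X Y : Frank S n) : ⁅X, Y⁆ = -⁅Y, X⁆ := by
  induction X using Frank.induction with
  | hU u f =>
    induction Y using Frank.induction with
    | hU v g =>
      ext
      · simp
      · simp [Frank.phi_comm v u, ← TensorProduct.tmul_neg]
      · simp [S.skew v u, mul_comm g f]
    | hS v g => ext <;> simp
    | hW g => ext <;> simp
    | h0 => rw [Frank.lie_zero, Frank.zero_lie, neg_zero]
    | hadd a b ha hb => rw [Frank.lie_add, Frank.add_lie, ha, hb]; abel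
  | hS u f =>
    induction Y using Frank.induction with
    | hU v g => ext <;> simp
    | hS v g =>
      ext
      · simp
      · have h : ⁅u, v⁆ = -⁅v, u⁆ := (lie_skew u v).symm
        simp only [lie_snd_fst, inSl_fst, inSl_snd_fst, inSl_snd_snd, neg_snd_fst, map_zero,
          LinearMap.zero_apply, sub_zero, add_zero, zero_add, slBr_tmul]
        rw [h, TensorProduct.neg_tmul, mul_comm g f]
      · simp
    | hW g => ext <;> simp
    | h0 => rw [Frank.lie_zero, Frank.zero_lie, neg_zero]
    | hadd a b ha hb => rw [Frank.lie_add, Frank.add_lie, ha, hb]; abel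
  | hW f =>
    induction Y using Frank.induction with
    | hU v g => ext <;> simp
    | hS v g => ext <;> simp
    | hW g => ext <;> simp
    | h0 => rw [Frank.lie_zero, Frank.zero_lie, neg_zero]
    | hadd a b ha hb => rw [Frank.lie_add, Frank.add_lie, ha, hb]; abel
  | h0 => rw [Frank.lie_zero, Frank.zero_lie, neg_zero]
  | hadd a b ha hb => rw [Frank.lie_add, Frank.add_lie, ha, hb]; abel


/-- The Jacobi expression. -/
def jac (X Y Z : Frank S n) : Frank S n := ⁅X, ⁅Y, Z⁆⁆ + ⁅Y, ⁅Z, X⁆⁆ + ⁅Z, ⁅X, Y⁆⁆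

theorem jac_cyc (X Y Z : Frank S n) : jac X Y Z = jac Y Z X := by
  simp only [jac]; abel

protected theorem lie_neg (X Y : Frank S n) : ⁅X, -Y⁆ = -⁅X, Y⁆ := by
  have h := Frank.lie_smul (-1 : Φ) X Y
  simpa using h

theorem jac_swap (X Y Z : Frank S n) : jac X Y Z = -jac Y X Z := by
  simp only [jac]
  rw [Frank.skew X Z, Frank.skew Y X, Frank.skew Z Y]
  simp only [Frank.lie_neg]
  abel

theorem jac_add (X Y Z Z' : Frank S n) : jac X Y (Z + Z') = jac X Y Z + jac X Y Z' := by
  simp only [jac, Frank.lie_add, Frank.add_lie]; abel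

theorem jac_zero (X Y : Frank S n) : jac X Y 0 = 0 := by
  simp [jac, Frank.lie_zero, Frank.zero_lie]


theorem three_eq_zero : (3 : DP Φ n) = 0 := by
  have h : ((3 : ℕ) : DP Φ n) = 0 := by
    rw [← map_natCast (algebraMap Φ (DP Φ n)), CharP.cast_eq_zero, map_zero]
  exact_mod_cast h

theorem lie_UU (u v : U) (f g : DP Φ n) : ⁅inU S n (u ⊗ₜ f), inU S n (v ⊗ₜ g)⁆ =
    inSl S n (S.phi u v ⊗ₜ (f * DP.partialD Φ n g - g * DP.partialD Φ n f)) +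
      inW S n (S.form u v • (f * g)) := by
  ext <;> simp
theorem lie_SU (a : sl Φ U) (v : U) (f g : DP Φ n) : ⁅inSl S n (a ⊗ₜ f), inU S n (v ⊗ₜ g)⁆ =
    inU S n ((a : Module.End Φ U) v ⊗ₜ (f * g)) := by
  ext <;> simp
theorem lie_US (a : sl Φ U) (v : U) (f g : DP Φ n) : ⁅inU S n (v ⊗ₜ g), inSl S n (a ⊗ₜ f)⁆ =
    -inU S n ((a : Module.End Φ U) v ⊗ₜ (f * g)) := by
  ext <;> simp
theorem lie_WU (v : U) (f g : DP Φ n) : ⁅inW S n f, inU S n (v ⊗ₜ g)⁆ =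
    inU S n (v ⊗ₜ (DP.partialD Φ n (f * g))) := by
  ext <;> simp
theorem lie_UW (v : U) (f g : DP Φ n) : ⁅inU S n (v ⊗ₜ g), inW S n f⁆ =
    -inU S n (v ⊗ₜ (DP.partialD Φ n (f * g))) := by
  ext <;> simp
theorem lie_SS (a b : sl Φ U) (f g : DP Φ n) : ⁅inSl S n (a ⊗ₜ f), inSl S n (b ⊗ₜ g)⁆ =
    inSl S n (⁅a, b⁆ ⊗ₜ (f * g)) := by
  ext <;> simp
theorem lie_WS (a : sl Φ U) (f g : DP Φ n) : ⁅inW S n f, inSl S n (a ⊗ₜ g)⁆ =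
    inSl S n (a ⊗ₜ (f * DP.partialD Φ n g)) := by
  ext <;> simp
theorem lie_SW (a : sl Φ U) (f g : DP Φ n) : ⁅inSl S n (a ⊗ₜ g), inW S n f⁆ =
    -inSl S n (a ⊗ₜ (f * DP.partialD Φ n g)) := by
  ext <;> simp
theorem lie_WW (f g : DP Φ n) : ⁅inW S n f, inW S n g⁆ =
    inW S n (f * DP.partialD Φ n g - g * DP.partialD Φ n f) := by
  ext <;> simp [-map_sub]

theorem form_cyc (S : SymplecticPlane Φ U) (u v w : U) :
    S.form u v • w + S.form v w • u + S.form w u • v = 0 := by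
  have := S.finite
  have hd : ¬ LinearIndependent Φ ![u, v, w] := fun h => by
    have := h.fintype_card_le_finrank
    rw [S.finrank_eq] at this
    simp at this
  rw [Fintype.not_linearIndependent_iff] at hd
  obtain ⟨c, hc, i, hi⟩ := hd
  simp only [Fin.sum_univ_three, Matrix.cons_val_zero, Matrix.cons_val_one, Matrix.cons_val] at hc
  have key : ∀ (a b d : Φ) (u v w : U), a • u + b • v + d • w = 0 → d ≠ 0 →
      S.form u v • w + S.form v w • u + S.form w u • v = 0 := by
    intro a b d u v w h hd
    have h1 := congrArg (S.form u) h
    have h2 := congrArg (S.form v) h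
    simp only [map_add, map_smul, smul_eq_mul, map_zero, S.form_self] at h1 h2
    refine (smul_eq_zero.mp ?_ : d = 0 ∨ _).resolve_left hd
    rw [S.skew w u]
    rw [S.skew v u] at h2
    linear_combination (norm := module) (S.form u v) • h + h2 • u - h1 • v
  fin_cases i
  · have := key (c 1) (c 2) (c 0) v w u (by rw [← hc]; abel) hi
    rw [← this]; abel
  · have := key (c 2) (c 0) (c 1) w u v (by rw [← hc]; abel) hi
    rw [← this]; abel
  · exact key (c 0) (c 1) (c 2) u v w hc hi

theorem form_invariant (S : SymplecticPlane Φ U) (a : sl Φ U) (u v : U) :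
    S.form ((a : Module.End Φ U) u) v = -S.form u ((a : Module.End Φ U) v) := by
  have := S.finite
  let b : Module.Basis (Fin 2) Φ U := Module.finBasisOfFinrankEq Φ U S.finrank_eq
  obtain ⟨a, ha⟩ := a
  change LinearMap.trace Φ U a = 0 at ha
  rw [LinearMap.trace_eq_matrix_trace Φ b, Matrix.trace_fin_two, LinearMap.toMatrix_apply,
    LinearMap.toMatrix_apply] at ha
  have h0 := b.sum_repr (a (b 0))
  have h1 := b.sum_repr (a (b 1))
  rw [Fin.sum_univ_two] at h0 h1
  have hb : S.form ∘ₗ a = -(S.form.compl₂ a) := by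
    refine b.ext fun i => b.ext fun j => ?_
    fin_cases i <;> fin_cases j <;>
      simp only [Fin.zero_eta, Fin.mk_one, LinearMap.comp_apply, LinearMap.neg_apply,
        LinearMap.compl₂_apply] <;> (try rw [← h0]) <;> (try rw [← h1]) <;>
      simp only [map_add, map_smul, LinearMap.add_apply, LinearMap.smul_apply, S.form_self,
        smul_eq_mul, S.skew (b 1) (b 0)]
    · ring
    · linear_combination S.form (b 0) (b 1) * ha
    · linear_combination -S.form (b 0) (b 1) * ha
    · ring
  exact LinearMap.congr_fun (LinearMap.congr_fun hb u) v

theorem lie_phi (S : SymplecticPlane Φ U) (a : sl Φ U) (u v : U) :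
    ⁅a, S.phi u v⁆ = S.phi ((a : Module.End Φ U) u) v + S.phi u ((a : Module.End Φ U) v) := by
  ext w
  change (a : Module.End Φ U) ((S.phi u v : Module.End Φ U) w) -
      (S.phi u v : Module.End Φ U) ((a : Module.End Φ U) w) =
    (S.phi ((a : Module.End Φ U) u) v : Module.End Φ U) w +
      (S.phi u ((a : Module.End Φ U) v) : Module.End Φ U) w
  simp only [S.phi_apply, map_add, map_smul, form_invariant S a]
  module

theorem phi_sub (S : SymplecticPlane Φ U) (a : sl Φ U) (u v : U) :
    S.phi u ((a : Module.End Φ U) v) - S.phi ((a : Module.End Φ U) u) v = -(S.form u v • a) := by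
  ext w
  change (S.phi u ((a : Module.End Φ U) v) : Module.End Φ U) w -
      (S.phi ((a : Module.End Φ U) u) v : Module.End Φ U) w =
    -(S.form u v • (a : Module.End Φ U) w)
  simp only [S.phi_apply, form_invariant S a]
  have h1 := congrArg (a : Module.End Φ U) (form_cyc S u v w)
  simp only [map_add, map_smul, map_zero] at h1
  have h2 := form_cyc S u v ((a : Module.End Φ U) w)
  rw [S.skew w u] at h1
  rw [S.skew _ u] at h2
  have h3 : (3 : Φ) = 0 := CharP.cast_eq_zero Φ 3
  linear_combination (norm := module) (h3 • (S.form u v • (a : Module.End Φ U) w)) - h1 - h2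

theorem inU_tmul_eq_zero (u : U) {t : DP Φ n} (h : t = 0) : inU S n (u ⊗ₜ t) = 0 := by
  rw [h, TensorProduct.tmul_zero, map_zero]

theorem inSl_tmul_eq_zero (a : sl Φ U) {t : DP Φ n} (h : t = 0) : inSl S n (a ⊗ₜ t) = 0 := by
  rw [h, TensorProduct.tmul_zero, map_zero]

theorem jac_UUU (u v w : U) (f g h : DP Φ n) :
    jac (inU S n (u ⊗ₜ f)) (inU S n (v ⊗ₜ g)) (inU S n (w ⊗ₜ h)) = 0 := by
  simp only [jac, lie_UU, Frank.lie_add, lie_US, lie_UW, ← map_add, ← map_neg]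
  convert map_zero (inU S n) using 2
  set A := DP.partialD Φ n f * g * h with hA
  set B := f * DP.partialD Φ n g * h with hB
  set C := f * g * DP.partialD Φ n h with hC
  have e1 : (g * DP.partialD Φ n h - h * DP.partialD Φ n g) * f = C - B := by
    rw [hB, hC]; ring
  have e2 : (h * DP.partialD Φ n f - f * DP.partialD Φ n h) * g = A - C := by
    rw [hA, hC]; ring
  have e3 : (f * DP.partialD Φ n g - g * DP.partialD Φ n f) * h = B - A := by
    rw [hA, hB]; ring
  have d1 : DP.partialD Φ n (g * h * f) = A + B + C := by
    simp only [Derivation.leibniz, smul_eq_mul]; rw [hA, hB, hC]; ring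
  have d2 : DP.partialD Φ n (h * f * g) = A + B + C := by
    simp only [Derivation.leibniz, smul_eq_mul]; rw [hA, hB, hC]; ring
  have d3 : DP.partialD Φ n (f * g * h) = A + B + C := by
    simp only [Derivation.leibniz, smul_eq_mul]; rw [hA, hB, hC]; ring
  clear_value A B C
  simp only [smul_mul_assoc, Derivation.map_smul, e1, e2, e3, d1, d2, d3, S.phi_apply]
  rw [S.skew v u, S.skew u w, S.skew w v]
  have hs := form_cyc S u v w
  have h3 : (3 : Φ) = 0 := CharP.cast_eq_zero Φ 3
  have k1 : S.form u v • (w ⊗ₜ[Φ] A) + S.form v w • (u ⊗ₜ[Φ] A) + S.form w u • (v ⊗ₜ[Φ] A) = 0 := by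
    simpa [TensorProduct.add_tmul, TensorProduct.smul_tmul'] using congrArg (· ⊗ₜ[Φ] A) hs
  have k2 : S.form u v • (w ⊗ₜ[Φ] B) + S.form v w • (u ⊗ₜ[Φ] B) + S.form w u • (v ⊗ₜ[Φ] B) = 0 := by
    simpa [TensorProduct.add_tmul, TensorProduct.smul_tmul'] using congrArg (· ⊗ₜ[Φ] B) hs
  have k3 : S.form u v • (w ⊗ₜ[Φ] C) + S.form v w • (u ⊗ₜ[Φ] C) + S.form w u • (v ⊗ₜ[Φ] C) = 0 := by
    simpa [TensorProduct.add_tmul, TensorProduct.smul_tmul'] using congrArg (· ⊗ₜ[Φ] C) hs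
  simp only [TensorProduct.add_tmul, TensorProduct.tmul_add, TensorProduct.tmul_sub,
    TensorProduct.tmul_smul, ← TensorProduct.smul_tmul']
  linear_combination (norm := module) (-2 : Φ) • k1 + (-2 : Φ) • k2 + (-2 : Φ) • k3 +
    h3 • (S.form v w • (u ⊗ₜ[Φ] A) + S.form w u • (v ⊗ₜ[Φ] B) + S.form u v • (w ⊗ₜ[Φ] C))

theorem jac_UUS (u v : U) (a : sl Φ U) (f g h : DP Φ n) :
    jac (inU S n (u ⊗ₜ f)) (inU S n (v ⊗ₜ g)) (inSl S n (a ⊗ₜ h)) = 0 := by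
  set A := DP.partialD Φ n f * g * h with hA
  set B := f * DP.partialD Φ n g * h with hB
  set C := f * g * DP.partialD Φ n h with hC
  have e1 : f * DP.partialD Φ n (h * g) - h * g * DP.partialD Φ n f = C + B - A := by
    simp only [Derivation.leibniz, smul_eq_mul]; rw [hA, hB, hC]; ring
  have e2 : g * DP.partialD Φ n (h * f) - h * f * DP.partialD Φ n g = C + A - B := by
    simp only [Derivation.leibniz, smul_eq_mul]; rw [hA, hB, hC]; ring
  have e3 : h * (f * DP.partialD Φ n g - g * DP.partialD Φ n f) = B - A := by
    rw [hA, hB]; ring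
  have e4 : f * g * DP.partialD Φ n h = C := rfl
  clear_value A B C
  simp only [jac, lie_UU, lie_US, lie_SU, lie_SS, lie_SW, Frank.lie_add, Frank.lie_neg,
    smul_mul_assoc, e1, e2, e3, e4]
  rw [Frank.phi_comm v, lie_phi, S.skew v, form_invariant S a]
  have p := phi_sub S a u v
  have hw1 : f * (h * g) = f * g * h := by ring
  have hw2 : g * (h * f) = f * g * h := by ring
  rw [hw1, hw2]
  have q : S.phi u ((a : Module.End Φ U) v) =
      S.phi ((a : Module.End Φ U) u) v - S.form u v • a := by
    rw [← sub_eq_iff_eq_add'.mpr (sub_eq_iff_eq_add.mp p)] <;> abel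
  rw [q]
  simp only [TensorProduct.add_tmul, TensorProduct.sub_tmul, TensorProduct.tmul_add,
    TensorProduct.tmul_sub, TensorProduct.tmul_smul, ← TensorProduct.smul_tmul', map_add, map_sub,
    map_smul, neg_neg]
  module

theorem jac_UUW (u v : U) (f g h : DP Φ n) :
    jac (inU S n (u ⊗ₜ f)) (inU S n (v ⊗ₜ g)) (inW S n h) = 0 := by
  have h3 := three_eq_zero (Φ := Φ) (n := n)
  simp only [jac, lie_UU, lie_UW, lie_WU, lie_WS, lie_WW, Frank.lie_add, Frank.lie_neg]
  rw [Frank.phi_comm v, S.skew v]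
  have e1 : -(f * DP.partialD Φ n (DP.partialD Φ n (h * g)) -
        DP.partialD Φ n (h * g) * DP.partialD Φ n f) +
      (g * DP.partialD Φ n (DP.partialD Φ n (h * f)) -
        DP.partialD Φ n (h * f) * DP.partialD Φ n g) +
      h * DP.partialD Φ n (f * DP.partialD Φ n g - g * DP.partialD Φ n f) = 0 := by
    simp only [Derivation.leibniz, smul_eq_mul, map_sub, map_add]
    linear_combination (-(DP.partialD Φ n h) * (f * DP.partialD Φ n g - g * DP.partialD Φ n f)) * h3
  have e2 : -(f * DP.partialD Φ n (h * g)) - g * DP.partialD Φ n (h * f) +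
      (h * DP.partialD Φ n (f * g) - f * g * DP.partialD Φ n h) = 0 := by
    simp only [Derivation.leibniz, smul_eq_mul, map_sub, map_add]
    linear_combination (-(DP.partialD Φ n h) * (f * g)) * h3
  have k1 := congrArg (fun t => inSl S n (S.phi u v ⊗ₜ t)) e1
  have k2 := congrArg (fun t => S.form u v • inW S n t) e2
  simp only [TensorProduct.tmul_add, TensorProduct.tmul_neg, TensorProduct.tmul_zero, map_add,
    map_neg, map_sub, map_zero, smul_zero] at k1 k2
  simp only [map_smul, smul_mul_assoc, mul_smul_comm, map_sub, Derivation.map_smul]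
  linear_combination (norm := module) k1 + k2

theorem jac_USS (u : U) (a b : sl Φ U) (f g h : DP Φ n) :
    jac (inU S n (u ⊗ₜ f)) (inSl S n (a ⊗ₜ g)) (inSl S n (b ⊗ₜ h)) = 0 := by
  simp only [jac, lie_US, lie_SU, lie_SS, Frank.lie_neg]
  have e : ((⁅a, b⁆ : sl Φ U) : Module.End Φ U) u =
    (a : Module.End Φ U) ((b : Module.End Φ U) u) -
      (b : Module.End Φ U) ((a : Module.End Φ U) u) := rfl
  rw [e, show g * (h * f) = g * h * f by ring, show h * (g * f) = g * h * f by ring,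
    TensorProduct.sub_tmul, map_sub]
  abel

theorem jac_USW (u : U) (a : sl Φ U) (f g h : DP Φ n) :
    jac (inU S n (u ⊗ₜ f)) (inSl S n (a ⊗ₜ g)) (inW S n h) = 0 := by
  simp only [jac, lie_US, lie_SU, lie_WU, lie_UW, lie_SW, Frank.lie_neg, neg_neg, Derivation.leibniz,
    smul_eq_mul, ← map_neg, ← map_add, ← TensorProduct.tmul_neg, ← TensorProduct.tmul_add]
  refine inU_tmul_eq_zero _ ?_
  simp only [Derivation.leibniz, smul_eq_mul, map_sub, map_add, map_neg]
  ring

theorem jac_UWW (u : U) (f g h : DP Φ n) :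
    jac (inU S n (u ⊗ₜ f)) (inW S n g) (inW S n h) = 0 := by
  simp only [jac, lie_WU, lie_UW, lie_WW, Frank.lie_neg, neg_neg, Derivation.leibniz,
    smul_eq_mul, ← map_neg, ← map_add, ← TensorProduct.tmul_neg, ← TensorProduct.tmul_add]
  refine inU_tmul_eq_zero _ ?_
  simp only [Derivation.leibniz, smul_eq_mul, map_sub, map_add, map_neg]
  ring

theorem jac_SSS (a b c : sl Φ U) (f g h : DP Φ n) :
    jac (inSl S n (a ⊗ₜ f)) (inSl S n (b ⊗ₜ g)) (inSl S n (c ⊗ₜ h)) = 0 := by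
  simp only [jac, lie_SS]
  rw [show g * (h * f) = f * (g * h) by ring, show h * (f * g) = f * (g * h) by ring,
    ← map_add, ← map_add, ← TensorProduct.add_tmul, ← TensorProduct.add_tmul, lie_jacobi,
    TensorProduct.zero_tmul, map_zero]

theorem jac_SSW (a b : sl Φ U) (f g h : DP Φ n) :
    jac (inSl S n (a ⊗ₜ f)) (inSl S n (b ⊗ₜ g)) (inW S n h) = 0 := by
  have e : ⁅b, a⁆ = -⁅a, b⁆ := (lie_skew b a).symm
  simp only [jac, lie_SS, lie_WS, lie_SW, Frank.lie_neg]
  simp only [e, TensorProduct.neg_tmul, Derivation.leibniz,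
    smul_eq_mul, ← map_neg, ← map_add, ← TensorProduct.tmul_neg, ← TensorProduct.tmul_add]
  refine inSl_tmul_eq_zero _ ?_
  ring

theorem jac_SWW (a : sl Φ U) (f g h : DP Φ n) :
    jac (inSl S n (a ⊗ₜ f)) (inW S n g) (inW S n h) = 0 := by
  simp only [jac, lie_WS, lie_SW, lie_WW, Frank.lie_neg, Derivation.leibniz,
    smul_eq_mul, ← map_neg, ← map_add, ← TensorProduct.tmul_neg, ← TensorProduct.tmul_add]
  refine inSl_tmul_eq_zero _ ?_
  simp only [Derivation.leibniz, smul_eq_mul, map_sub, map_add, map_neg]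
  ring

theorem jac_WWW (f g h : DP Φ n) :
    jac (inW S n f) (inW S n g) (inW S n h) = 0 := by
  simp only [jac, lie_WW, ← map_add]
  convert map_zero (inW S n) using 2
  simp only [Derivation.leibniz, smul_eq_mul, map_sub]
  ring

theorem jac_eq_zero (X Y Z : Frank S n) : jac X Y Z = 0 := by
  have rot : ∀ {X Y Z : Frank S n}, jac X Y Z = 0 → jac Y Z X = 0 := fun h => by
    rw [← jac_cyc]; exact h
  have swp : ∀ {X Y Z : Frank S n}, jac X Y Z = 0 → jac Y X Z = 0 := fun h => by
    rw [jac_swap, h, neg_zero]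
  have addz : ∀ {X Y Z Z' : Frank S n}, jac X Y Z = 0 → jac X Y Z' = 0 → jac X Y (Z + Z') = 0 :=
    fun h h' => by rw [jac_add, h, h', add_zero]
  induction X using Frank.induction with
  | h0 => exact rot (rot (jac_zero _ _))
  | hadd a b ha hb => exact rot (rot (addz (rot ha) (rot hb)))
  | hU u f =>
    induction Y using Frank.induction with
    | h0 => exact rot (jac_zero _ _)
    | hadd a b ha hb => exact rot (addz (rot (rot ha)) (rot (rot hb)))
    | hU v g =>
      induction Z using Frank.induction with
      | h0 => exact jac_zero _ _
      | hadd a b ha hb => exact addz ha hb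
      | hU w h => exact jac_UUU _ _ _ _ _ _
      | hS w h => exact jac_UUS _ _ _ _ _ _
      | hW h => exact jac_UUW _ _ _ _ _
    | hS v g =>
      induction Z using Frank.induction with
      | h0 => exact jac_zero _ _
      | hadd a b ha hb => exact addz ha hb
      | hU w h => exact rot (jac_UUS _ _ _ _ _ _)
      | hS w h => exact jac_USS _ _ _ _ _ _
      | hW h => exact jac_USW _ _ _ _ _
    | hW g =>
      induction Z using Frank.induction with
      | h0 => exact jac_zero _ _
      | hadd a b ha hb => exact addz ha hb
      | hU w h => exact rot (jac_UUW _ _ _ _ _)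
      | hS w h => exact rot (swp (jac_USW _ _ _ _ _))
      | hW h => exact jac_UWW _ _ _ _
  | hS u f =>
    induction Y using Frank.induction with
    | h0 => exact rot (jac_zero _ _)
    | hadd a b ha hb => exact rot (addz (rot (rot ha)) (rot (rot hb)))
    | hU v g =>
      induction Z using Frank.induction with
      | h0 => exact jac_zero _ _
      | hadd a b ha hb => exact addz ha hb
      | hU w h => exact rot (rot (jac_UUS _ _ _ _ _ _))
      | hS w h => exact swp (jac_USS _ _ _ _ _ _)
      | hW h => exact swp (jac_USW _ _ _ _ _)
    | hS v g =>
      induction Z using Frank.induction with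
      | h0 => exact jac_zero _ _
      | hadd a b ha hb => exact addz ha hb
      | hU w h => exact rot (jac_USS _ _ _ _ _ _)
      | hS w h => exact jac_SSS _ _ _ _ _ _
      | hW h => exact jac_SSW _ _ _ _ _
    | hW g =>
      induction Z using Frank.induction with
      | h0 => exact jac_zero _ _
      | hadd a b ha hb => exact addz ha hb
      | hU w h => exact rot (jac_USW _ _ _ _ _)
      | hS w h => exact rot (jac_SSW _ _ _ _ _)
      | hW h => exact jac_SWW _ _ _ _
  | hW f =>
    induction Y using Frank.induction with
    | h0 => exact rot (jac_zero _ _)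
    | hadd a b ha hb => exact rot (addz (rot (rot ha)) (rot (rot hb)))
    | hU v g =>
      induction Z using Frank.induction with
      | h0 => exact jac_zero _ _
      | hadd a b ha hb => exact addz ha hb
      | hU w h => exact rot (rot (jac_UUW _ _ _ _ _))
      | hS w h => exact rot (rot (jac_USW _ _ _ _ _))
      | hW h => exact swp (jac_UWW _ _ _ _)
    | hS v g =>
      induction Z using Frank.induction with
      | h0 => exact jac_zero _ _
      | hadd a b ha hb => exact addz ha hb
      | hU w h => exact swp (rot (jac_USW _ _ _ _ _))
      | hS w h => exact rot (rot (jac_SSW _ _ _ _ _))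
      | hW h => exact swp (jac_SWW _ _ _ _)
    | hW g =>
      induction Z using Frank.induction with
      | h0 => exact jac_zero _ _
      | hadd a b ha hb => exact addz ha hb
      | hU w h => exact rot (jac_UWW _ _ _ _)
      | hS w h => exact rot (jac_SWW _ _ _ _)
      | hW h => exact jac_WWW _ _ _

instance : LieRing (Frank S n) where
  add_lie := Frank.add_lie
  lie_add := Frank.lie_add
  lie_self X := by
    have h : ⁅X, X⁆ + ⁅X, X⁆ = 0 := by
      nth_rewrite 1 [Frank.skew X X]; exact neg_add_cancel _
    have h3 : (3 : Φ) = 0 := CharP.cast_eq_zero Φ 3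
    linear_combination (norm := module) (-1 : Φ) • h + h3 • ⁅X, X⁆
  leibniz_lie X Y Z := by
    have h := jac_eq_zero X Y Z
    rw [jac, Frank.skew Z X, Frank.lie_neg, Frank.skew Z] at h
    have h' : ⁅X, ⁅Y, Z⁆⁆ - (⁅⁅X, Y⁆, Z⁆ + ⁅Y, ⁅X, Z⁆⁆) = 0 := by
      rw [← h]; abel
    exact sub_eq_zero.mp h'

instance : LieAlgebra Φ (Frank S n) where
  lie_smul := Frank.lie_smul

end Frank

end Frank


/-! ### The symmetric tensor category `Rep(α₃)` -/

section tensorD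

variable {Φ : Type u} [Field Φ] {V W X V' W' : Type u} [AddCommGroup V] [AddCommGroup W]
  [AddCommGroup X] [AddCommGroup V'] [AddCommGroup W'] [Module Φ V] [Module Φ W] [Module Φ X]
  [Module Φ V'] [Module Φ W']

/-- The operator `a ⊗ 1 + 1 ⊗ b` on `V ⊗ W`. -/
def tensorD (a : Module.End Φ V) (b : Module.End Φ W) : Module.End Φ (V ⊗[Φ] W) :=
  a.rTensor W + b.lTensor V

@[simp] theorem tensorD_tmul (a : Module.End Φ V) (b : Module.End Φ W) (v : V) (w : W) :
    tensorD a b (v ⊗ₜ w) = a v ⊗ₜ w + v ⊗ₜ b w := rfl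

theorem tensorD_map {a : Module.End Φ V} {b : Module.End Φ W} {a' : Module.End Φ V'}
    {b' : Module.End Φ W'} {f : V →ₗ[Φ] V'} {g : W →ₗ[Φ] W'} (hf : f ∘ₗ a = a' ∘ₗ f)
    (hg : g ∘ₗ b = b' ∘ₗ g) :
    TensorProduct.map f g ∘ₗ tensorD a b = tensorD a' b' ∘ₗ TensorProduct.map f g := by
  apply TensorProduct.ext'
  intro x y
  have h1 := LinearMap.congr_fun hf x
  have h2 := LinearMap.congr_fun hg y
  simp only [LinearMap.comp_apply] at h1 h2
  simp [h1, h2]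

theorem tensorD_assoc (a : Module.End Φ V) (b : Module.End Φ W) (c : Module.End Φ X) :
    (TensorProduct.assoc Φ V W X).toLinearMap ∘ₗ tensorD (tensorD a b) c =
      tensorD a (tensorD b c) ∘ₗ (TensorProduct.assoc Φ V W X).toLinearMap := by
  apply TensorProduct.ext_threefold
  intro x y z
  simp [TensorProduct.add_tmul, TensorProduct.tmul_add, add_assoc]

theorem tensorD_lid (b : Module.End Φ W) :
    (TensorProduct.lid Φ W).toLinearMap ∘ₗ tensorD 0 b =
      b ∘ₗ (TensorProduct.lid Φ W).toLinearMap := by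
  apply TensorProduct.ext'
  intro c x
  simp

theorem tensorD_rid (b : Module.End Φ W) :
    (TensorProduct.rid Φ W).toLinearMap ∘ₗ tensorD b 0 =
      b ∘ₗ (TensorProduct.rid Φ W).toLinearMap := by
  apply TensorProduct.ext'
  intro c x
  simp

theorem tensorD_comm (a : Module.End Φ V) (b : Module.End Φ W) :
    (TensorProduct.comm Φ V W).toLinearMap ∘ₗ tensorD a b =
      tensorD b a ∘ₗ (TensorProduct.comm Φ V W).toLinearMap := by
  apply TensorProduct.ext'
  intro x y
  simp [add_comm]

theorem tensorD_pow [CharP Φ 3] {a : Module.End Φ V} {b : Module.End Φ W} (ha : a ^ 3 = 0)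
    (hb : b ^ 3 = 0) : tensorD a b ^ 3 = 0 := by
  have hX : ∀ x, a (a (a x)) = 0 := fun x => LinearMap.congr_fun ha x
  have hY : ∀ y, b (b (b y)) = 0 := fun y => LinearMap.congr_fun hb y
  have h3 : (3 : Φ) = 0 := CharP.cast_eq_zero Φ 3
  apply TensorProduct.ext'
  intro x y
  simp only [pow_succ, pow_zero, one_mul, Module.End.mul_apply, tensorD_tmul, map_add, hX, hY,
    TensorProduct.zero_tmul, TensorProduct.tmul_zero, LinearMap.zero_apply]
  linear_combination (norm := module) h3 • (a (a x) ⊗ₜ[Φ] b y + a x ⊗ₜ[Φ] b (b y))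

end tensorD

/-- A finite-dimensional representation of `α₃`: a finite-dimensional vector space `V` with an
endomorphism `d` such that `d ^ 3 = 0`, where `k ∈ α₃(R)` (that is, `k ^ 3 = 0`) acts on `R ⊗ V` as
`1 + k d + k ^ 2 d ^ 2 / 2`. -/
structure RepAlpha (Φ : Type u) [Field Φ] where
  carrier : Type u
  [addCommGroup : AddCommGroup carrier]
  [module : Module Φ carrier]
  [finite : Module.Finite Φ carrier]
  d : Module.End Φ carrier
  d_pow : d ^ 3 = 0

namespace RepAlpha

variable {Φ : Type u} [Field Φ]

instance : CoeSort (RepAlpha Φ) (Type u) := ⟨carrier⟩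

attribute [instance] addCommGroup module finite

/-- Morphisms of representations: linear maps commuting with the operators `d`. -/
@[ext] structure Hom (X Y : RepAlpha Φ) where
  lin : X →ₗ[Φ] Y
  comm : lin ∘ₗ X.d = Y.d ∘ₗ lin

instance : Category (RepAlpha Φ) where
  Hom := Hom
  id X := ⟨LinearMap.id, rfl⟩
  comp f g := ⟨g.lin ∘ₗ f.lin, by
    rw [LinearMap.comp_assoc, f.comm, ← LinearMap.comp_assoc, g.comm, LinearMap.comp_assoc]⟩

@[ext] theorem hom_ext {X Y : RepAlpha Φ} {f g : X ⟶ Y} (h : f.lin = g.lin) : f = g := Hom.ext h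

@[simp] theorem id_lin (X : RepAlpha Φ) : Hom.lin (𝟙 X) = LinearMap.id := rfl
@[simp] theorem comp_lin {X Y Z : RepAlpha Φ} (f : X ⟶ Y) (g : Y ⟶ Z) :
    (f ≫ g).lin = g.lin ∘ₗ f.lin := rfl

section linear

variable {X Y : RepAlpha Φ}

instance : Zero (X ⟶ Y) := ⟨⟨0, by simp⟩⟩
instance : Add (X ⟶ Y) := ⟨fun f g => ⟨f.lin + g.lin, by
  rw [LinearMap.add_comp, LinearMap.comp_add, f.comm, g.comm]⟩⟩
instance : Neg (X ⟶ Y) := ⟨fun f => ⟨-f.lin, by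
  rw [LinearMap.neg_comp, LinearMap.comp_neg, f.comm]⟩⟩
instance : Sub (X ⟶ Y) := ⟨fun f g => ⟨f.lin - g.lin, by
  rw [LinearMap.sub_comp, LinearMap.comp_sub, f.comm, g.comm]⟩⟩
instance {R : Type*} [Monoid R] [DistribMulAction R Φ] [DistribMulAction R Y]
    [SMulCommClass Φ R Y] [LinearMap.CompatibleSMul Y Y R Φ] : SMul R (X ⟶ Y) :=
  ⟨fun c f => ⟨c • f.lin, by rw [LinearMap.smul_comp, LinearMap.comp_smul, f.comm]⟩⟩

instance : AddCommGroup (X ⟶ Y) :=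
  Function.Injective.addCommGroup (Hom.lin : (X ⟶ Y) → (X →ₗ[Φ] Y)) (fun _ _ h => Hom.ext h)
    rfl (fun _ _ => rfl) (fun _ => rfl) (fun _ _ => rfl) (fun _ _ => rfl) (fun _ _ => rfl)

@[simp] theorem zero_lin : Hom.lin (0 : X ⟶ Y) = 0 := rfl
@[simp] theorem add_lin (f g : X ⟶ Y) : (f + g).lin = f.lin + g.lin := rfl
@[simp] theorem sub_lin (f g : X ⟶ Y) : (f - g).lin = f.lin - g.lin := rfl
@[simp] theorem smul_lin (c : Φ) (f : X ⟶ Y) : (c • f).lin = c • f.lin := rfl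

/-- `Hom.lin` as an additive map. -/
def linHom : (X ⟶ Y) →+ (X →ₗ[Φ] Y) where
  toFun := Hom.lin
  map_zero' := rfl
  map_add' _ _ := rfl

instance : Module Φ (X ⟶ Y) :=
  Function.Injective.module Φ linHom (fun _ _ h => Hom.ext h) (fun _ _ => rfl)

end linear

instance : Preadditive (RepAlpha Φ) where
  add_comp _ _ _ f f' g := hom_ext (LinearMap.comp_add f.lin f'.lin g.lin)
  comp_add _ _ _ f g g' := hom_ext (LinearMap.add_comp f.lin g'.lin g.lin)

instance : Linear Φ (RepAlpha Φ) where
  smul_comp _ _ _ c f g := hom_ext (LinearMap.comp_smul g.lin c f.lin)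
  comp_smul _ _ _ f c g := hom_ext (LinearMap.smul_comp c g.lin f.lin)

/-- An isomorphism from a linear equivalence commuting with the operators. -/
@[simps] def isoMk {X Y : RepAlpha Φ} (f : X ≃ₗ[Φ] Y)
    (h : f.toLinearMap ∘ₗ X.d = Y.d ∘ₗ f.toLinearMap) : X ≅ Y where
  hom := ⟨f.toLinearMap, h⟩
  inv := ⟨f.symm.toLinearMap, by
    ext y
    obtain ⟨x, rfl⟩ := f.surjective y
    have := LinearMap.congr_fun h x
    simp only [LinearMap.comp_apply, LinearEquiv.coe_coe] at this ⊢
    rw [← this]; simp⟩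
  hom_inv_id := by ext; simp
  inv_hom_id := by ext; simp

section monoidal

variable [CharP Φ 3]

instance : MonoidalCategoryStruct (RepAlpha Φ) where
  tensorObj X Y := ⟨X ⊗[Φ] Y, tensorD X.d Y.d, tensorD_pow X.d_pow Y.d_pow⟩
  whiskerLeft X _ _ f := ⟨f.lin.lTensor X, tensorD_map (f := LinearMap.id) rfl f.comm⟩
  whiskerRight f Y := ⟨f.lin.rTensor Y, tensorD_map (g := LinearMap.id) f.comm rfl⟩
  tensorHom f g := ⟨TensorProduct.map f.lin g.lin, tensorD_map f.comm g.comm⟩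
  tensorUnit := ⟨Φ, 0, by simp⟩
  associator X Y Z := isoMk (TensorProduct.assoc Φ X Y Z) (tensorD_assoc X.d Y.d Z.d)
  leftUnitor X := isoMk (TensorProduct.lid Φ X) (tensorD_lid X.d)
  rightUnitor X := isoMk (TensorProduct.rid Φ X) (tensorD_rid X.d)

instance : MonoidalCategory (RepAlpha Φ) where
  tensorHom_def f g := hom_ext (TensorProduct.ext' fun _ _ => rfl)
  id_tensorHom_id X Y := hom_ext (TensorProduct.ext' fun _ _ => rfl)
  tensorHom_comp_tensorHom _ _ _ _ := hom_ext (TensorProduct.ext' fun _ _ => rfl)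
  whiskerLeft_id _ _ := hom_ext (TensorProduct.ext' fun _ _ => rfl)
  id_whiskerRight _ _ := hom_ext (TensorProduct.ext' fun _ _ => rfl)
  associator_naturality _ _ _ := hom_ext (TensorProduct.ext_threefold fun _ _ _ => rfl)
  leftUnitor_naturality f := hom_ext (TensorProduct.ext' fun c x => (f.lin.map_smul c x).symm)
  rightUnitor_naturality f := hom_ext (TensorProduct.ext' fun x c => (f.lin.map_smul c x).symm)
  pentagon _ _ _ _ := hom_ext (TensorProduct.ext_fourfold fun _ _ _ _ => rfl)
  triangle X Y := hom_ext (TensorProduct.ext_threefold fun x (c : Φ) y =>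
    (TensorProduct.smul_tmul c x y).symm)

/-- The braiding of `Rep(α₃)` is the flip `v ⊗ w ↦ w ⊗ v`. -/
instance : SymmetricCategory (RepAlpha Φ) where
  braiding X Y := isoMk (TensorProduct.comm Φ X Y) (tensorD_comm X.d Y.d)
  braiding_naturality_right _ _ _ _ := hom_ext (TensorProduct.ext' fun _ _ => rfl)
  braiding_naturality_left _ _ := hom_ext (TensorProduct.ext' fun _ _ => rfl)
  hexagon_forward _ _ _ := hom_ext (TensorProduct.ext_threefold fun _ _ _ => rfl)
  hexagon_reverse X Y Z := hom_ext (TensorProduct.ext (LinearMap.ext fun _ =>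
    TensorProduct.ext' fun _ _ => rfl))
  symmetry _ _ := hom_ext (TensorProduct.ext' fun _ _ => rfl)

end monoidal

end RepAlpha


/-! ### Partial traces -/

section partialTrace

variable {Φ : Type u} [Field Φ] {V W Z : Type u} [AddCommGroup V] [AddCommGroup W]
  [AddCommGroup Z] [Module Φ V] [Module Φ W] [Module Φ Z] {ι : Type*} [Fintype ι] [DecidableEq ι]
  (b : Module.Basis ι Φ Z)

/-- The slice `V ⊗ Z → V`, `v ⊗ z ↦ ζ(z) v`, for a linear form `ζ` on `Z`. -/
def slice (V : Type u) [AddCommGroup V] [Module Φ V] (ζ : Z →ₗ[Φ] Φ) : V ⊗[Φ] Z →ₗ[Φ] V :=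
  (TensorProduct.rid Φ V).toLinearMap ∘ₗ ζ.lTensor V

@[simp] theorem slice_tmul (ζ : Z →ₗ[Φ] Φ) (v : V) (z : Z) : slice V ζ (v ⊗ₜ z) = ζ z • v := by
  simp [slice]

/-- The partial trace over `Z` of a linear map `V ⊗ Z → W ⊗ Z`. -/
def partialTrace (u : V ⊗[Φ] Z →ₗ[Φ] W ⊗[Φ] Z) : V →ₗ[Φ] W :=
  ∑ i, slice W (b.coord i) ∘ₗ u ∘ₗ (TensorProduct.mk Φ V Z).flip (b i)

theorem partialTrace_apply (u : V ⊗[Φ] Z →ₗ[Φ] W ⊗[Φ] Z) (v : V) :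
    partialTrace b u v = ∑ i, slice W (b.coord i) (u (v ⊗ₜ b i)) := by
  simp [partialTrace]

theorem trace_partialTrace [Module.Finite Φ V] (u : V ⊗[Φ] Z →ₗ[Φ] V ⊗[Φ] Z) :
    LinearMap.trace Φ (V ⊗[Φ] Z) u = LinearMap.trace Φ V (partialTrace b u) := by
  classical
  let c := Module.finBasis Φ V
  have key : ∀ (t : V ⊗[Φ] Z) j i, (c.tensorProduct b).repr t (j, i) =
      c.repr (slice V (b.coord i) t) j := by
    intro t j i
    induction t using TensorProduct.induction_on with
    | zero => simp
    | tmul v z => simp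
    | add s t hs ht => simp [hs, ht]
  rw [LinearMap.trace_eq_matrix_trace Φ (c.tensorProduct b), LinearMap.trace_eq_matrix_trace Φ c,
    Matrix.trace, Matrix.trace, Fintype.sum_prod_type]
  refine Finset.sum_congr rfl fun j _ => ?_
  simp only [Matrix.diag_apply, LinearMap.toMatrix_apply, Module.Basis.tensorProduct_apply,
    partialTrace_apply, map_sum, Finsupp.coe_finsetSum, Finset.sum_apply]
  exact Finset.sum_congr rfl fun i _ => key _ _ _

theorem slice_rTensor (ζ : Z →ₗ[Φ] Φ) (f : V →ₗ[Φ] W) (t : V ⊗[Φ] Z) :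
    slice W ζ (f.rTensor Z t) = f (slice V ζ t) := by
  induction t using TensorProduct.induction_on with
  | zero => simp
  | tmul v z => simp
  | add s t hs ht => simp [hs, ht]

theorem slice_lTensor (ζ : Z →ₗ[Φ] Φ) (h : Z →ₗ[Φ] Z) (t : V ⊗[Φ] Z) :
    slice V ζ (h.lTensor V t) = slice V (ζ ∘ₗ h) t := by
  induction t using TensorProduct.induction_on with
  | zero => simp
  | tmul v z => simp
  | add s t hs ht => simp [hs, ht]

theorem slice_sum (c : ι → Φ) (ζ : ι → (Z →ₗ[Φ] Φ)) (t : V ⊗[Φ] Z) :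
    slice V (∑ k, c k • ζ k) t = ∑ k, c k • slice V (ζ k) t := by
  induction t using TensorProduct.induction_on with
  | zero => simp
  | tmul v z => simp [Finset.sum_smul, mul_smul]
  | add s t hs ht => simp [hs, ht, Finset.sum_add_distrib]

theorem partialTrace_rTensor_comp {X : Type u} [AddCommGroup X] [Module Φ X] (f : W →ₗ[Φ] X)
    (u : V ⊗[Φ] Z →ₗ[Φ] W ⊗[Φ] Z) :
    partialTrace b (f.rTensor Z ∘ₗ u) = f ∘ₗ partialTrace b u := by
  ext v
  simp [partialTrace_apply, slice_rTensor]

theorem partialTrace_comp_rTensor {X : Type u} [AddCommGroup X] [Module Φ X] (f : X →ₗ[Φ] V)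
    (u : V ⊗[Φ] Z →ₗ[Φ] W ⊗[Φ] Z) :
    partialTrace b (u ∘ₗ f.rTensor Z) = partialTrace b u ∘ₗ f := by
  ext v
  simp [partialTrace_apply]

theorem partialTrace_lTensor (h : Z →ₗ[Φ] Z) (u : V ⊗[Φ] Z →ₗ[Φ] W ⊗[Φ] Z) :
    partialTrace b (h.lTensor W ∘ₗ u) = partialTrace b (u ∘ₗ h.lTensor V) := by
  ext v
  have h1 : ∀ i, h (b i) = ∑ k, b.coord k (h (b i)) • b k := fun i => (b.sum_repr _).symm
  have h2 : ∀ i, b.coord i ∘ₗ h = ∑ k, b.coord i (h (b k)) • b.coord k := fun i => by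
    refine b.ext fun j => ?_
    simp [Finsupp.single_apply]
  simp only [partialTrace_apply, LinearMap.comp_apply, slice_lTensor, h2, slice_sum,
    LinearMap.lTensor_tmul]
  rw [Finset.sum_comm]
  refine Finset.sum_congr rfl fun i _ => ?_
  have key : u (v ⊗ₜ h (b i)) = ∑ k, b.coord k (h (b i)) • u (v ⊗ₜ b k) := by
    conv_lhs => rw [h1 i]
    simp only [TensorProduct.tmul_sum, TensorProduct.tmul_smul, map_sum, map_smul]
  rw [key]
  simp only [map_sum, map_smul]

end partialTrace

/-! ### The semisimplification of `Rep(α₃)` -/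

section Semisimplification

variable {Φ : Type u} [Field Φ]

/-- A morphism `f : X ⟶ Y` is negligible if `Tr(f u) = 0` for all `u : Y ⟶ X`. -/
def Negligible {X Y : RepAlpha Φ} (f : X ⟶ Y) : Prop :=
  ∀ u : Y ⟶ X, LinearMap.trace Φ Y (f.lin ∘ₗ u.lin) = 0

namespace Negligible

variable {X Y Z : RepAlpha Φ}

theorem zero : Negligible (0 : X ⟶ Y) := fun u => by simp

theorem add {f g : X ⟶ Y} (hf : Negligible f) (hg : Negligible g) : Negligible (f + g) :=
  fun u => by rw [RepAlpha.add_lin, LinearMap.add_comp, map_add, hf u, hg u, add_zero]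

theorem smul (c : Φ) {f : X ⟶ Y} (hf : Negligible f) : Negligible (c • f) :=
  fun u => by rw [RepAlpha.smul_lin, LinearMap.smul_comp, map_smul, hf u, smul_zero]

theorem neg {f : X ⟶ Y} (hf : Negligible f) : Negligible (-f) := by
  have := hf.smul (-1 : Φ)
  rwa [neg_one_smul] at this

theorem comp_right {f : X ⟶ Y} (hf : Negligible f) (g : Y ⟶ Z) : Negligible (f ≫ g) :=
  fun u => by
    have h := hf (g ≫ u)
    rw [RepAlpha.comp_lin] at h ⊢
    rw [LinearMap.comp_assoc, LinearMap.trace_comp_comm', LinearMap.comp_assoc]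
    exact h

theorem comp_left (g : X ⟶ Y) {f : Y ⟶ Z} (hf : Negligible f) : Negligible (g ≫ f) :=
  fun u => by
    have h := hf (u ≫ g)
    rw [RepAlpha.comp_lin] at h ⊢
    rw [LinearMap.comp_assoc]
    exact h

variable [CharP Φ 3]

theorem whiskerRight {f : X ⟶ Y} (hf : Negligible f) (Z : RepAlpha Φ) : Negligible (f ▷ Z) := by
  intro u
  let b := Module.finBasis Φ Z
  let ul : Y ⊗[Φ] Z →ₗ[Φ] X ⊗[Φ] Z := u.lin
  have hu : ul ∘ₗ (Y.d.rTensor Z + Z.d.lTensor Y) = (X.d.rTensor Z + Z.d.lTensor X) ∘ₗ ul := u.comm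
  let t : Y ⟶ X := ⟨partialTrace b ul, by
    have h := congrArg (partialTrace b) hu
    have hadd : ∀ v w : Y ⊗[Φ] Z →ₗ[Φ] X ⊗[Φ] Z,
        partialTrace b (v + w) = partialTrace b v + partialTrace b w := fun v w => by
      ext y; simp [partialTrace_apply, Finset.sum_add_distrib]
    rw [LinearMap.comp_add, LinearMap.add_comp, hadd, hadd, partialTrace_lTensor,
      partialTrace_comp_rTensor, partialTrace_rTensor_comp] at h
    exact add_right_cancel h⟩
  have h := hf t
  change LinearMap.trace Φ Y (f.lin ∘ₗ partialTrace b ul) = 0 at h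
  change LinearMap.trace Φ (Y ⊗[Φ] Z) (f.lin.rTensor Z ∘ₗ ul) = 0
  rw [trace_partialTrace b, partialTrace_rTensor_comp, h]

theorem whiskerLeft (Z : RepAlpha Φ) {f : X ⟶ Y} (hf : Negligible f) : Negligible (Z ◁ f) := by
  have e : Z ◁ f = (β_ Z X).hom ≫ f ▷ Z ≫ (β_ Y Z).hom := by
    rw [← BraidedCategory.braiding_naturality_right_assoc, SymmetricCategory.symmetry,
      Category.comp_id]
  rw [e]
  exact comp_left _ (comp_right (hf.whiskerRight Z) _)

end Negligible

variable (Φ)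

/-- Two parallel morphisms are identified if their difference is negligible. -/
def negligibleRel : HomRel (RepAlpha Φ) := fun _ _ f g => Negligible (f - g)

instance : Congruence (negligibleRel Φ) where
  equivalence :=
    { refl f := by
        change Negligible (f - f)
        rw [sub_self]; exact Negligible.zero
      symm {f g} h := by
        change Negligible (g - f)
        rw [← neg_sub]; exact Negligible.neg h
      trans {f g k} h h' := by
        change Negligible (f - k)
        rw [← sub_add_sub_cancel f g k]; exact Negligible.add h h' }
  comp_left {_ _ _} f {g g'} h := by
    change Negligible (f ≫ g - f ≫ g')
    rw [← Preadditive.comp_sub]; exact Negligible.comp_left f h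
  comp_right {_ _ _ f f'} g h := by
    change Negligible (f ≫ g - f' ≫ g)
    rw [← Preadditive.sub_comp]; exact Negligible.comp_right h g

/-- The semisimplification of `Rep(α₃)`: the quotient by the negligible morphisms. -/
abbrev Semisimplification : Type (u + 1) := CategoryTheory.Quotient (negligibleRel Φ)

/-- The quotient functor from `Rep(α₃)` to its semisimplification. -/
abbrev semisimplify : RepAlpha Φ ⥤ Semisimplification Φ :=
  CategoryTheory.Quotient.functor (negligibleRel Φ)

theorem negligibleRel_add ⦃X Y : RepAlpha Φ⦄ (f₁ f₂ g₁ g₂ : X ⟶ Y) (hf : negligibleRel Φ f₁ f₂)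
    (hg : negligibleRel Φ g₁ g₂) : negligibleRel Φ (f₁ + g₁) (f₂ + g₂) := by
  change Negligible (f₁ + g₁ - (f₂ + g₂))
  rw [add_sub_add_comm]
  exact Negligible.add hf hg

theorem negligibleRel_smul (c : Φ) ⦃X Y : RepAlpha Φ⦄ (f₁ f₂ : X ⟶ Y)
    (hf : negligibleRel Φ f₁ f₂) : negligibleRel Φ (c • f₁) (c • f₂) := by
  change Negligible (c • f₁ - c • f₂)
  rw [← smul_sub]
  exact Negligible.smul c hf

instance : Preadditive (Semisimplification Φ) :=
  CategoryTheory.Quotient.preadditive _ (negligibleRel_add Φ)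

instance : (semisimplify Φ).Additive :=
  CategoryTheory.Quotient.functor_additive _ (negligibleRel_add Φ)

instance : Linear Φ (Semisimplification Φ) :=
  CategoryTheory.Quotient.linear Φ _ (negligibleRel_smul Φ)

variable [CharP Φ 3]

namespace Semisimplification

variable {Φ}

/-- Left whiskering, induced from `Rep(α₃)`. -/
def whiskerL (X : RepAlpha Φ) {Y Z : RepAlpha Φ}
    (f : (semisimplify Φ).obj Y ⟶ (semisimplify Φ).obj Z) :
    (semisimplify Φ).obj (X ⊗ Y) ⟶ (semisimplify Φ).obj (X ⊗ Z) :=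
  Quot.lift (fun g : Y ⟶ Z => (semisimplify Φ).map (X ◁ g)) (fun g g' h => by
    rw [HomRel.compClosure_iff_self] at h
    refine CategoryTheory.Quotient.sound _ ?_
    change Negligible (X ◁ g - X ◁ g')
    have e : X ◁ g - X ◁ g' = X ◁ (g - g') :=
      RepAlpha.hom_ext (LinearMap.lTensor_sub g.lin g'.lin).symm
    rw [e]
    exact Negligible.whiskerLeft X h) f

/-- Right whiskering, induced from `Rep(α₃)`. -/
def whiskerR {Y Z : RepAlpha Φ} (f : (semisimplify Φ).obj Y ⟶ (semisimplify Φ).obj Z)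
    (X : RepAlpha Φ) :
    (semisimplify Φ).obj (Y ⊗ X) ⟶ (semisimplify Φ).obj (Z ⊗ X) :=
  Quot.lift (fun g : Y ⟶ Z => (semisimplify Φ).map (g ▷ X)) (fun g g' h => by
    rw [HomRel.compClosure_iff_self] at h
    refine CategoryTheory.Quotient.sound _ ?_
    change Negligible (g ▷ X - g' ▷ X)
    have e : g ▷ X - g' ▷ X = (g - g') ▷ X :=
      RepAlpha.hom_ext (LinearMap.rTensor_sub g.lin g'.lin).symm
    rw [e]
    exact Negligible.whiskerRight h X) f

end Semisimplification

open Semisimplification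

/-- The tensor product of the semisimplification is induced by the one of `Rep(α₃)`. -/
instance : MonoidalCategoryStruct (Semisimplification Φ) where
  tensorObj X Y := (semisimplify Φ).obj (X.as ⊗ Y.as)
  whiskerLeft X _ _ f := whiskerL X.as f
  whiskerRight f Y := whiskerR f Y.as
  tensorUnit := (semisimplify Φ).obj (𝟙_ (RepAlpha Φ))
  associator X Y Z := (semisimplify Φ).mapIso (α_ X.as Y.as Z.as)
  leftUnitor X := (semisimplify Φ).mapIso (λ_ X.as)
  rightUnitor X := (semisimplify Φ).mapIso (ρ_ X.as)
  tensorHom {_ Y₁ X₂ _} f g := whiskerR f X₂.as ≫ whiskerL Y₁.as g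


namespace Semisimplification

variable {Φ}

theorem map_whiskerLeft (X : RepAlpha Φ) {Y Z : RepAlpha Φ} (f : Y ⟶ Z) :
    (semisimplify Φ).map (X ◁ f) = (semisimplify Φ).obj X ◁ (semisimplify Φ).map f := rfl

theorem map_whiskerRight {Y Z : RepAlpha Φ} (f : Y ⟶ Z) (X : RepAlpha Φ) :
    (semisimplify Φ).map (f ▷ X) = (semisimplify Φ).map f ▷ (semisimplify Φ).obj X := rfl

theorem map_tensorHom {W X Y Z : RepAlpha Φ} (f : W ⟶ X) (g : Y ⟶ Z) :
    (semisimplify Φ).map (f ⊗ₘ g) = (semisimplify Φ).map f ⊗ₘ (semisimplify Φ).map g := by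
  rw [MonoidalCategory.tensorHom_def, Functor.map_comp]; rfl

/-- An equality of morphisms in `Rep(α₃)` gives one in the semisimplification. -/
theorem map_congr {X Y : RepAlpha Φ} {f g : X ⟶ Y} (h : f = g) :
    (semisimplify Φ).map f = (semisimplify Φ).map g := congrArg _ h

end Semisimplification

instance : MonoidalCategory (Semisimplification Φ) where
  tensorHom_def _ _ := rfl
  id_tensorHom_id X Y := map_congr (by simp : 𝟙 X.as ▷ Y.as ≫ X.as ◁ 𝟙 Y.as = 𝟙 _)
  tensorHom_comp_tensorHom := by
    rintro _ _ _ _ _ _ ⟨f₁⟩ ⟨f₂⟩ ⟨g₁⟩ ⟨g₂⟩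
    have h := map_congr (tensorHom_comp_tensorHom f₁ f₂ g₁ g₂)
    rw [Functor.map_comp, map_tensorHom, map_tensorHom, map_tensorHom] at h
    exact h
  whiskerLeft_id X Y := map_congr (MonoidalCategory.whiskerLeft_id X.as Y.as)
  id_whiskerRight X Y := map_congr (MonoidalCategory.id_whiskerRight X.as Y.as)
  associator_naturality := by
    rintro _ _ _ _ _ _ ⟨f₁⟩ ⟨f₂⟩ ⟨f₃⟩
    have h := map_congr (MonoidalCategory.associator_naturality f₁ f₂ f₃)
    rw [Functor.map_comp, Functor.map_comp, map_tensorHom, map_tensorHom, map_tensorHom,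
      map_tensorHom] at h
    exact h
  leftUnitor_naturality := by
    rintro _ _ ⟨f⟩
    exact map_congr (MonoidalCategory.leftUnitor_naturality f)
  rightUnitor_naturality := by
    rintro _ _ ⟨f⟩
    exact map_congr (MonoidalCategory.rightUnitor_naturality f)
  pentagon W X Y Z := map_congr (MonoidalCategory.pentagon W.as X.as Y.as Z.as)
  triangle X Y := map_congr (MonoidalCategory.triangle X.as Y.as)

instance : SymmetricCategory (Semisimplification Φ) where
  braiding X Y := (semisimplify Φ).mapIso (β_ X.as Y.as)
  braiding_naturality_right := by
    rintro X _ _ ⟨f⟩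
    exact map_congr (BraidedCategory.braiding_naturality_right X.as f)
  braiding_naturality_left := by
    rintro _ _ ⟨f⟩ Z
    exact map_congr (BraidedCategory.braiding_naturality_left f Z.as)
  hexagon_forward X Y Z := map_congr (BraidedCategory.hexagon_forward X.as Y.as Z.as)
  hexagon_reverse X Y Z := map_congr (BraidedCategory.hexagon_reverse X.as Y.as Z.as)
  symmetry X Y := map_congr (SymmetricCategory.symmetry X.as Y.as)

/-- The quotient functor is a (strict) symmetric tensor functor. -/
instance : (semisimplify Φ).Braided where
  ε := 𝟙 _
  μ _ _ := 𝟙 _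
  η := 𝟙 _
  δ _ _ := 𝟙 _
  μ_natural_left f X := by
    rw [Category.comp_id, Category.id_comp]; rfl
  μ_natural_right X f := by
    rw [Category.comp_id, Category.id_comp]; rfl
  associativity X Y Z := by
    rw [MonoidalCategory.id_whiskerRight, MonoidalCategory.whiskerLeft_id]
    erw [Category.id_comp, Category.id_comp]
  left_unitality X := by
    rw [MonoidalCategory.id_whiskerRight]
    erw [Category.id_comp, Category.id_comp]
    rfl
  right_unitality X := by
    rw [MonoidalCategory.whiskerLeft_id]
    erw [Category.id_comp, Category.id_comp]
    rfl
  δ_natural_left f X := by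
    rw [Category.comp_id, Category.id_comp]; rfl
  δ_natural_right X f := by
    rw [Category.comp_id, Category.id_comp]; rfl
  oplax_associativity X Y Z := by
    rw [MonoidalCategory.id_whiskerRight, MonoidalCategory.whiskerLeft_id]
    erw [Category.id_comp, Category.id_comp]
  oplax_left_unitality X := by
    rw [MonoidalCategory.id_whiskerRight]
    erw [Category.comp_id]
    rfl
  oplax_right_unitality X := by
    rw [MonoidalCategory.whiskerLeft_id]
    erw [Category.comp_id]
    rfl
  ε_η := Category.id_comp _
  η_ε := Category.id_comp _
  μ_δ _ _ := Category.id_comp _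
  δ_μ _ _ := Category.id_comp _
  braided X Y := by
    erw [Category.id_comp]

end Semisimplification


/-! ### The symmetric tensor category of super vector spaces -/

section tensorOdd

variable {Φ : Type u} [Field Φ] {V W X V' W' : Type u} [AddCommGroup V] [AddCommGroup W]
  [AddCommGroup X] [AddCommGroup V'] [AddCommGroup W'] [Module Φ V] [Module Φ W] [Module Φ X]
  [Module Φ V'] [Module Φ W']

/-- For projections `p`, `q` onto the odd parts of `V`, `W`: the projection
`p ⊗ (1 - q) + (1 - p) ⊗ q` onto the odd part `V₁ ⊗ W₀ ⊕ V₀ ⊗ W₁` of `V ⊗ W`. -/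
def tensorOdd (p : Module.End Φ V) (q : Module.End Φ W) : Module.End Φ (V ⊗[Φ] W) :=
  TensorProduct.map p (1 - q) + TensorProduct.map (1 - p) q

@[simp] theorem tensorOdd_tmul (p : Module.End Φ V) (q : Module.End Φ W) (v : V) (w : W) :
    tensorOdd p q (v ⊗ₜ w) = p v ⊗ₜ (w - q w) + (v - p v) ⊗ₜ q w := rfl

theorem tensorOdd_map {p : Module.End Φ V} {q : Module.End Φ W} {p' : Module.End Φ V'}
    {q' : Module.End Φ W'} {f : V →ₗ[Φ] V'} {g : W →ₗ[Φ] W'} (hf : f ∘ₗ p = p' ∘ₗ f)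
    (hg : g ∘ₗ q = q' ∘ₗ g) :
    TensorProduct.map f g ∘ₗ tensorOdd p q = tensorOdd p' q' ∘ₗ TensorProduct.map f g := by
  apply TensorProduct.ext'
  intro x y
  have h1 := LinearMap.congr_fun hf x
  have h2 := LinearMap.congr_fun hg y
  simp only [LinearMap.comp_apply] at h1 h2
  simp [h1, h2]

theorem tensorOdd_assoc (a : Module.End Φ V) (b : Module.End Φ W) (c : Module.End Φ X) :
    (TensorProduct.assoc Φ V W X).toLinearMap ∘ₗ tensorOdd (tensorOdd a b) c =
      tensorOdd a (tensorOdd b c) ∘ₗ (TensorProduct.assoc Φ V W X).toLinearMap := by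
  apply TensorProduct.ext_threefold
  intro x y z
  simp only [LinearMap.comp_apply, tensorOdd_tmul, LinearEquiv.coe_coe, TensorProduct.assoc_tmul,
    map_add, map_sub, TensorProduct.add_tmul, TensorProduct.sub_tmul, TensorProduct.tmul_add,
    TensorProduct.tmul_sub]
  abel

theorem tensorOdd_lid (b : Module.End Φ W) :
    (TensorProduct.lid Φ W).toLinearMap ∘ₗ tensorOdd 0 b =
      b ∘ₗ (TensorProduct.lid Φ W).toLinearMap := by
  apply TensorProduct.ext'
  intro c x
  simp

theorem tensorOdd_rid (b : Module.End Φ W) :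
    (TensorProduct.rid Φ W).toLinearMap ∘ₗ tensorOdd b 0 =
      b ∘ₗ (TensorProduct.rid Φ W).toLinearMap := by
  apply TensorProduct.ext'
  intro c x
  simp

theorem tensorOdd_idem {p : Module.End Φ V} {q : Module.End Φ W} (hp : p ∘ₗ p = p)
    (hq : q ∘ₗ q = q) : tensorOdd p q ∘ₗ tensorOdd p q = tensorOdd p q := by
  have h1 : ∀ x, p (p x) = p x := fun x => LinearMap.congr_fun hp x
  have h2 : ∀ x, q (q x) = q x := fun x => LinearMap.congr_fun hq x
  apply TensorProduct.ext'
  intro x y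
  simp [h1, h2]

/-- The flip with the sign rule: `v ⊗ w ↦ w ⊗ v` if `v` or `w` is even, and `v ⊗ w ↦ - w ⊗ v` if
both are odd. -/
def superFlip (p : Module.End Φ V) (q : Module.End Φ W) : V ⊗[Φ] W →ₗ[Φ] W ⊗[Φ] V :=
  (TensorProduct.comm Φ V W).toLinearMap ∘ₗ (LinearMap.id - (2 : Φ) • TensorProduct.map p q)

@[simp] theorem superFlip_tmul (p : Module.End Φ V) (q : Module.End Φ W) (v : V) (w : W) :
    superFlip p q (v ⊗ₜ w) = w ⊗ₜ v - (2 : Φ) • (q w ⊗ₜ[Φ] p v) := by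
  simp [superFlip]

theorem superFlip_superFlip {p : Module.End Φ V} {q : Module.End Φ W} (hp : p ∘ₗ p = p)
    (hq : q ∘ₗ q = q) : superFlip q p ∘ₗ superFlip p q = LinearMap.id := by
  have h1 : ∀ x, p (p x) = p x := fun x => LinearMap.congr_fun hp x
  have h2 : ∀ x, q (q x) = q x := fun x => LinearMap.congr_fun hq x
  apply TensorProduct.ext'
  intro x y
  simp only [LinearMap.comp_apply, superFlip_tmul, map_sub, map_smul, h1, h2, LinearMap.id_apply]
  module

theorem superFlip_tensorOdd (p : Module.End Φ V) (q : Module.End Φ W) :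
    superFlip p q ∘ₗ tensorOdd p q = tensorOdd q p ∘ₗ superFlip p q := by
  apply TensorProduct.ext'
  intro x y
  simp only [LinearMap.comp_apply, superFlip_tmul, tensorOdd_tmul, map_add, map_sub, map_smul,
    TensorProduct.sub_tmul, TensorProduct.tmul_sub]
  module

theorem superFlip_map {p : Module.End Φ V} {q : Module.End Φ W} {p' : Module.End Φ V'}
    {q' : Module.End Φ W'} {f : V →ₗ[Φ] V'} {g : W →ₗ[Φ] W'} (hf : f ∘ₗ p = p' ∘ₗ f)
    (hg : g ∘ₗ q = q' ∘ₗ g) :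
    superFlip p' q' ∘ₗ TensorProduct.map f g = TensorProduct.map g f ∘ₗ superFlip p q := by
  apply TensorProduct.ext'
  intro x y
  have h1 := LinearMap.congr_fun hf x
  have h2 := LinearMap.congr_fun hg y
  simp only [LinearMap.comp_apply] at h1 h2
  simp [h1, h2]

end tensorOdd

/-- A finite-dimensional super vector space: a finite-dimensional vector space `V = V₀ ⊕ V₁`, where
the `ℤ/2`-grading is encoded by the projection `odd` onto `V₁` along `V₀` (an arbitrary idempotent
endomorphism, with `V₀` its kernel and `V₁` its image). -/
structure SVec (Φ : Type u) [Field Φ] where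
  carrier : Type u
  [addCommGroup : AddCommGroup carrier]
  [module : Module Φ carrier]
  [finite : Module.Finite Φ carrier]
  odd : Module.End Φ carrier
  odd_idem : odd ∘ₗ odd = odd

namespace SVec

variable {Φ : Type u} [Field Φ]

instance : CoeSort (SVec Φ) (Type u) := ⟨carrier⟩

attribute [instance] addCommGroup module finite

/-- Morphisms of super vector spaces: linear maps that preserve the grading. -/
@[ext] structure Hom (X Y : SVec Φ) where
  lin : X →ₗ[Φ] Y
  comm : lin ∘ₗ X.odd = Y.odd ∘ₗ lin

instance : Category (SVec Φ) where
  Hom := Hom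
  id X := ⟨LinearMap.id, rfl⟩
  comp f g := ⟨g.lin ∘ₗ f.lin, by
    rw [LinearMap.comp_assoc, f.comm, ← LinearMap.comp_assoc, g.comm, LinearMap.comp_assoc]⟩

@[ext] theorem hom_ext {X Y : SVec Φ} {f g : X ⟶ Y} (h : f.lin = g.lin) : f = g := Hom.ext h

@[simp] theorem id_lin (X : SVec Φ) : Hom.lin (𝟙 X) = LinearMap.id := rfl
@[simp] theorem comp_lin {X Y Z : SVec Φ} (f : X ⟶ Y) (g : Y ⟶ Z) :
    (f ≫ g).lin = g.lin ∘ₗ f.lin := rfl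

section linear

variable {X Y : SVec Φ}

instance : Zero (X ⟶ Y) := ⟨⟨0, by simp⟩⟩
instance : Add (X ⟶ Y) := ⟨fun f g => ⟨f.lin + g.lin, by
  rw [LinearMap.add_comp, LinearMap.comp_add, f.comm, g.comm]⟩⟩
instance : Neg (X ⟶ Y) := ⟨fun f => ⟨-f.lin, by
  rw [LinearMap.neg_comp, LinearMap.comp_neg, f.comm]⟩⟩
instance : Sub (X ⟶ Y) := ⟨fun f g => ⟨f.lin - g.lin, by
  rw [LinearMap.sub_comp, LinearMap.comp_sub, f.comm, g.comm]⟩⟩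
instance {R : Type*} [Monoid R] [DistribMulAction R Φ] [DistribMulAction R Y]
    [SMulCommClass Φ R Y] [LinearMap.CompatibleSMul Y Y R Φ] : SMul R (X ⟶ Y) :=
  ⟨fun c f => ⟨c • f.lin, by rw [LinearMap.smul_comp, LinearMap.comp_smul, f.comm]⟩⟩

instance : AddCommGroup (X ⟶ Y) :=
  Function.Injective.addCommGroup (Hom.lin : (X ⟶ Y) → (X →ₗ[Φ] Y)) (fun _ _ h => Hom.ext h)
    rfl (fun _ _ => rfl) (fun _ => rfl) (fun _ _ => rfl) (fun _ _ => rfl) (fun _ _ => rfl)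

@[simp] theorem zero_lin : Hom.lin (0 : X ⟶ Y) = 0 := rfl
@[simp] theorem add_lin (f g : X ⟶ Y) : (f + g).lin = f.lin + g.lin := rfl
@[simp] theorem sub_lin (f g : X ⟶ Y) : (f - g).lin = f.lin - g.lin := rfl
@[simp] theorem smul_lin (c : Φ) (f : X ⟶ Y) : (c • f).lin = c • f.lin := rfl

/-- `Hom.lin` as an additive map. -/
def linHom : (X ⟶ Y) →+ (X →ₗ[Φ] Y) where
  toFun := Hom.lin
  map_zero' := rfl
  map_add' _ _ := rfl

instance : Module Φ (X ⟶ Y) :=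
  Function.Injective.module Φ linHom (fun _ _ h => Hom.ext h) (fun _ _ => rfl)

end linear

instance : Preadditive (SVec Φ) where
  add_comp _ _ _ f f' g := hom_ext (LinearMap.comp_add f.lin f'.lin g.lin)
  comp_add _ _ _ f g g' := hom_ext (LinearMap.add_comp f.lin g'.lin g.lin)

instance : Linear Φ (SVec Φ) where
  smul_comp _ _ _ c f g := hom_ext (LinearMap.comp_smul g.lin c f.lin)
  comp_smul _ _ _ f c g := hom_ext (LinearMap.smul_comp c g.lin f.lin)

/-- An isomorphism from a linear equivalence commuting with the operators. -/
@[simps] def isoMk {X Y : SVec Φ} (f : X ≃ₗ[Φ] Y)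
    (h : f.toLinearMap ∘ₗ X.odd = Y.odd ∘ₗ f.toLinearMap) : X ≅ Y where
  hom := ⟨f.toLinearMap, h⟩
  inv := ⟨f.symm.toLinearMap, by
    ext y
    obtain ⟨x, rfl⟩ := f.surjective y
    have := LinearMap.congr_fun h x
    simp only [LinearMap.comp_apply, LinearEquiv.coe_coe] at this ⊢
    rw [← this]; simp⟩
  hom_inv_id := by ext; simp
  inv_hom_id := by ext; simp

instance : MonoidalCategoryStruct (SVec Φ) where
  tensorObj X Y := ⟨X ⊗[Φ] Y, tensorOdd X.odd Y.odd, tensorOdd_idem X.odd_idem Y.odd_idem⟩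
  whiskerLeft X _ _ f := ⟨f.lin.lTensor X, tensorOdd_map (f := LinearMap.id) rfl f.comm⟩
  whiskerRight f Y := ⟨f.lin.rTensor Y, tensorOdd_map (g := LinearMap.id) f.comm rfl⟩
  tensorHom f g := ⟨TensorProduct.map f.lin g.lin, tensorOdd_map f.comm g.comm⟩
  tensorUnit := ⟨Φ, 0, by simp⟩
  associator X Y Z := isoMk (TensorProduct.assoc Φ X Y Z) (tensorOdd_assoc X.odd Y.odd Z.odd)
  leftUnitor X := isoMk (TensorProduct.lid Φ X) (tensorOdd_lid X.odd)
  rightUnitor X := isoMk (TensorProduct.rid Φ X) (tensorOdd_rid X.odd)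

instance : MonoidalCategory (SVec Φ) where
  tensorHom_def _ _ := hom_ext (TensorProduct.ext' fun _ _ => rfl)
  id_tensorHom_id _ _ := hom_ext (TensorProduct.ext' fun _ _ => rfl)
  tensorHom_comp_tensorHom _ _ _ _ := hom_ext (TensorProduct.ext' fun _ _ => rfl)
  whiskerLeft_id _ _ := hom_ext (TensorProduct.ext' fun _ _ => rfl)
  id_whiskerRight _ _ := hom_ext (TensorProduct.ext' fun _ _ => rfl)
  associator_naturality _ _ _ := hom_ext (TensorProduct.ext_threefold fun _ _ _ => rfl)
  leftUnitor_naturality f := hom_ext (TensorProduct.ext' fun c x => (f.lin.map_smul c x).symm)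
  rightUnitor_naturality f := hom_ext (TensorProduct.ext' fun x c => (f.lin.map_smul c x).symm)
  pentagon _ _ _ _ := hom_ext (TensorProduct.ext_fourfold fun _ _ _ _ => rfl)
  triangle _ _ := hom_ext (TensorProduct.ext_threefold fun x (c : Φ) y =>
    (TensorProduct.smul_tmul c x y).symm)

theorem hexagon_aux {V W X : Type u} [AddCommGroup V] [AddCommGroup W] [AddCommGroup X]
    [Module Φ V] [Module Φ W] [Module Φ X] (p : Module.End Φ V) (q : Module.End Φ W)
    (r : Module.End Φ X) (hp : p ∘ₗ p = p) :
    (TensorProduct.assoc Φ W X V).toLinearMap ∘ₗ superFlip p (tensorOdd q r) ∘ₗ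
        (TensorProduct.assoc Φ V W X).toLinearMap =
      (superFlip p r).lTensor W ∘ₗ (TensorProduct.assoc Φ W V X).toLinearMap ∘ₗ
        (superFlip p q).rTensor X := by
  have h1 : ∀ x, p (p x) = p x := fun x => LinearMap.congr_fun hp x
  apply TensorProduct.ext_threefold
  intro x y z
  simp only [LinearMap.comp_apply, superFlip_tmul, tensorOdd_tmul, map_add, map_sub, map_smul, h1,
    LinearEquiv.coe_coe, TensorProduct.assoc_tmul, LinearMap.rTensor_tmul, LinearMap.lTensor_tmul,
    TensorProduct.sub_tmul, TensorProduct.tmul_sub, TensorProduct.add_tmul, TensorProduct.tmul_add,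
    ← TensorProduct.smul_tmul', TensorProduct.tmul_smul]
  module

theorem hexagon_aux' {V W X : Type u} [AddCommGroup V] [AddCommGroup W] [AddCommGroup X]
    [Module Φ V] [Module Φ W] [Module Φ X] (p : Module.End Φ V) (q : Module.End Φ W)
    (r : Module.End Φ X) (hr : r ∘ₗ r = r) :
    (TensorProduct.assoc Φ X V W).symm.toLinearMap ∘ₗ superFlip (tensorOdd p q) r ∘ₗ
        (TensorProduct.assoc Φ V W X).symm.toLinearMap =
      (superFlip p r).rTensor W ∘ₗ (TensorProduct.assoc Φ V X W).symm.toLinearMap ∘ₗ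
        (superFlip q r).lTensor V := by
  have h1 : ∀ x, r (r x) = r x := fun x => LinearMap.congr_fun hr x
  refine TensorProduct.ext (LinearMap.ext fun x => TensorProduct.ext' fun y z => ?_)
  change ((TensorProduct.assoc Φ X V W).symm.toLinearMap ∘ₗ superFlip (tensorOdd p q) r ∘ₗ
        (TensorProduct.assoc Φ V W X).symm.toLinearMap) (x ⊗ₜ (y ⊗ₜ z)) =
      ((superFlip p r).rTensor W ∘ₗ (TensorProduct.assoc Φ V X W).symm.toLinearMap ∘ₗ
        (superFlip q r).lTensor V) (x ⊗ₜ (y ⊗ₜ z))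
  simp only [LinearMap.comp_apply, superFlip_tmul, tensorOdd_tmul, map_add, map_sub, map_smul, h1,
    LinearEquiv.coe_coe, TensorProduct.assoc_symm_tmul, LinearMap.rTensor_tmul,
    LinearMap.lTensor_tmul,
    TensorProduct.sub_tmul, TensorProduct.tmul_sub, TensorProduct.add_tmul, TensorProduct.tmul_add,
    ← TensorProduct.smul_tmul', TensorProduct.tmul_smul]
  module

/-- The braiding of super vector spaces is the flip with the sign rule. -/
instance : SymmetricCategory (SVec Φ) where
  braiding X Y :=
    { hom := ⟨superFlip X.odd Y.odd, superFlip_tensorOdd X.odd Y.odd⟩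
      inv := ⟨superFlip Y.odd X.odd, superFlip_tensorOdd Y.odd X.odd⟩
      hom_inv_id := hom_ext (superFlip_superFlip X.odd_idem Y.odd_idem)
      inv_hom_id := hom_ext (superFlip_superFlip Y.odd_idem X.odd_idem) }
  braiding_naturality_right X _ _ f := hom_ext (superFlip_map (f := LinearMap.id) rfl f.comm)
  braiding_naturality_left f X := hom_ext (superFlip_map (g := LinearMap.id) f.comm rfl)
  hexagon_forward X Y Z := hom_ext (hexagon_aux X.odd Y.odd Z.odd X.odd_idem)
  hexagon_reverse X Y Z := hom_ext (hexagon_aux' X.odd Y.odd Z.odd Z.odd_idem)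
  symmetry X Y := hom_ext (superFlip_superFlip X.odd_idem Y.odd_idem)

end SVec


/-! ### Algebras in monoidal categories -/

/-- A (not necessarily associative) algebra in a monoidal category: an object with a product. -/
structure AlgebraIn (C : Type*) [Category C] [MonoidalCategory C] where
  obj : C
  mul : obj ⊗ obj ⟶ obj

namespace AlgebraIn

variable {C D : Type*} [Category C] [MonoidalCategory C] [Category D] [MonoidalCategory D]

/-- The image of an algebra under a (lax) monoidal functor, with product
`F(A) ⊗ F(A) → F(A ⊗ A) → F(A)`. -/
def map (F : C ⥤ D) [F.LaxMonoidal] (A : AlgebraIn C) : AlgebraIn D where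
  obj := F.obj A.obj
  mul := Functor.LaxMonoidal.μ F A.obj A.obj ≫ F.map A.mul

/-- Two algebras are isomorphic if there is an isomorphism of objects respecting the products. -/
def Isomorphic (A B : AlgebraIn C) : Prop :=
  ∃ φ : A.obj ≅ B.obj, A.mul ≫ φ.hom = (φ.hom ⊗ₘ φ.hom) ≫ B.mul

end AlgebraIn

/-! ### The Frank algebra as an algebra in `Rep(α₃)` -/

section FrankAlgebra

variable {Φ U : Type u} [Field Φ] [CharP Φ 3] [AddCommGroup U] [Module Φ U]
  (S : SymplecticPlane Φ U) (n : ℕ)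

/-- The inner derivation `d = ad (e ⊗ 1)` of `ℱ(n)`. -/
def frankD (e : sl Φ U) : Module.End Φ (Frank S n) :=
  LieAlgebra.ad Φ (Frank S n) (Frank.inSl S n (e ⊗ₜ 1))

theorem frankD_apply (e : sl Φ U) (X : Frank S n) :
    frankD S n e X = ⁅Frank.inSl S n (e ⊗ₜ 1), X⁆ := rfl

theorem sq_eq_zero (S : SymplecticPlane Φ U) (e : sl Φ U)
    (he : IsNilpotent (e : Module.End Φ U)) :
    (e : Module.End Φ U) * (e : Module.End Φ U) = 0 := by
  have := S.finite
  rw [LinearMap.isNilpotent_iff_charpoly, S.finrank_eq] at he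
  have h := LinearMap.aeval_self_charpoly (e : Module.End Φ U)
  rw [he] at h
  simpa [pow_two] using h

theorem frankD_pow (e : sl Φ U) (he : IsNilpotent (e : Module.End Φ U)) :
    frankD S n e ^ 3 = 0 := by
  have h0 := sq_eq_zero S e he
  have h1 : ∀ x, (e : Module.End Φ U) ((e : Module.End Φ U) x) = 0 :=
    fun x => LinearMap.congr_fun h0 x
  have h3 : (3 : Φ) = 0 := CharP.cast_eq_zero Φ 3
  refine LinearMap.ext fun X => ?_
  simp only [pow_succ, pow_zero, one_mul, Module.End.mul_apply, LinearMap.zero_apply, frankD_apply]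
  induction X using Frank.induction with
  | hU u f =>
    simp only [Frank.lie_SU, h1, TensorProduct.zero_tmul, map_zero, lie_zero]
  | hS a f =>
    simp only [Frank.lie_SS]
    have h : ⁅e, ⁅e, ⁅e, a⁆⁆⁆ = 0 := by
      ext x
      change (e : Module.End Φ U) ((e : Module.End Φ U) ((e : Module.End Φ U)
          ((a : Module.End Φ U) x) - (a : Module.End Φ U) ((e : Module.End Φ U) x)) -
          ((e : Module.End Φ U) ((a : Module.End Φ U) ((e : Module.End Φ U) x)) -
          (a : Module.End Φ U) ((e : Module.End Φ U) ((e : Module.End Φ U) x)))) -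
        ((e : Module.End Φ U) ((e : Module.End Φ U)
          ((a : Module.End Φ U) ((e : Module.End Φ U) x)) - (a : Module.End Φ U)
            ((e : Module.End Φ U) ((e : Module.End Φ U) x))) -
          ((e : Module.End Φ U) ((a : Module.End Φ U) ((e : Module.End Φ U)
            ((e : Module.End Φ U) x))) -
          (a : Module.End Φ U) ((e : Module.End Φ U) ((e : Module.End Φ U)
            ((e : Module.End Φ U) x))))) = 0
      simp only [h1, map_sub, map_zero, sub_zero]
    rw [h, TensorProduct.zero_tmul, map_zero]
  | hW f =>
    simp only [Frank.lie_SW, Derivation.map_one_eq_zero, mul_zero, TensorProduct.tmul_zero,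
      map_zero, neg_zero, lie_zero]
  | h0 => simp only [lie_zero]
  | hadd a b ha hb => simp only [lie_add, ha, hb, add_zero]

/-- `ℱ(n)` with the derivation `d = ad (e ⊗ 1)` as an object of `Rep(α₃)`. -/
def frankRep (e : sl Φ U) (he : IsNilpotent (e : Module.End Φ U)) : RepAlpha Φ where
  carrier := Frank S n
  d := frankD S n e
  d_pow := frankD_pow S n e he

/-- `ℱ(n)` with the derivation `d = ad (e ⊗ 1)` and its Lie bracket as an algebra in `Rep(α₃)`. -/
def frankAlgebra (e : sl Φ U) (he : IsNilpotent (e : Module.End Φ U)) :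
    AlgebraIn (RepAlpha Φ) where
  obj := frankRep S n e he
  mul := ⟨TensorProduct.lift (LieAlgebra.ad Φ (Frank S n)).toLinearMap, by
    apply TensorProduct.ext'
    intro (X : Frank S n) (Y : Frank S n)
    change TensorProduct.lift (LieAlgebra.ad Φ (Frank S n)).toLinearMap
      (tensorD (frankD S n e) (frankD S n e) (X ⊗ₜ Y)) = frankD S n e ⁅X, Y⁆
    rw [tensorD_tmul, map_add, TensorProduct.lift.tmul, TensorProduct.lift.tmul]
    change ⁅⁅Frank.inSl S n (e ⊗ₜ 1), X⁆, Y⁆ + ⁅X, ⁅Frank.inSl S n (e ⊗ₜ 1), Y⁆⁆ =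
      ⁅Frank.inSl S n (e ⊗ₜ 1), ⁅X, Y⁆⁆
    exact (leibniz_lie (Frank.inSl S n (e ⊗ₜ 1)) X Y).symm⟩

end FrankAlgebra

/-! ### Superalgebras -/

section superalgebra

variable {Φ : Type u} [Field Φ] {A₀ A₁ : Type u} [AddCommGroup A₀] [Module Φ A₀]
  [AddCommGroup A₁] [Module Φ A₁] (b₀₀ : A₀ →ₗ[Φ] A₀ →ₗ[Φ] A₀) (b₀₁ : A₀ →ₗ[Φ] A₁ →ₗ[Φ] A₁)
  (b₁₁ : A₁ →ₗ[Φ] A₁ →ₗ[Φ] A₀)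

/-- The product on `A₀ ⊕ A₁` given by its (even, even), (even, odd) and (odd, odd) components, and
with `[y, a] = -[a, y]` for `a` even and `y` odd. -/
def superProduct : (A₀ × A₁) →ₗ[Φ] (A₀ × A₁) →ₗ[Φ] (A₀ × A₁) :=
  LinearMap.mk₂ Φ
    (fun v w => (b₀₀ v.1 w.1 + b₁₁ v.2 w.2, b₀₁ v.1 w.2 - b₀₁ w.1 v.2))
    (fun v v' w => by ext1 <;> simp <;> abel) (fun c v w => by ext1 <;> simp [smul_sub])
    (fun v w w' => by ext1 <;> simp <;> abel) (fun c v w => by ext1 <;> simp [smul_sub])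

theorem superProduct_apply (v w : A₀ × A₁) : superProduct b₀₀ b₀₁ b₁₁ v w =
    (b₀₀ v.1 w.1 + b₁₁ v.2 w.2, b₀₁ v.1 w.2 - b₀₁ w.1 v.2) := rfl

/-- The superalgebra `A₀ ⊕ A₁` with the product `superProduct`. -/
def superalgebra [Module.Finite Φ A₀] [Module.Finite Φ A₁] : AlgebraIn (SVec Φ) where
  obj := ⟨A₀ × A₁, LinearMap.inr Φ A₀ A₁ ∘ₗ LinearMap.snd Φ A₀ A₁, rfl⟩
  mul := ⟨TensorProduct.lift (superProduct b₀₀ b₀₁ b₁₁), by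
    apply TensorProduct.ext'
    rintro ⟨a, x⟩ ⟨b, y⟩
    change TensorProduct.lift (superProduct b₀₀ b₀₁ b₁₁)
        (tensorOdd (LinearMap.inr Φ A₀ A₁ ∘ₗ LinearMap.snd Φ A₀ A₁)
          (LinearMap.inr Φ A₀ A₁ ∘ₗ LinearMap.snd Φ A₀ A₁) ((a, x) ⊗ₜ (b, y))) =
      ((0 : A₀), (superProduct b₀₀ b₀₁ b₁₁ (a, x) (b, y)).2)
    simp [superProduct_apply, sub_eq_add_neg]
    exact add_comm _ _⟩

end superalgebra

/-- The Lie superalgebra `W(1; n) ⊕ 𝒪_(div)`: even part `W(1; n)`, odd part `𝒪_(div)`, and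
`[x, y] = - x y ∂` for `x`, `y` odd. -/
def wittDivAlgebra (Φ : Type u) [Field Φ] [CharP Φ 3] (n : ℕ) : AlgebraIn (SVec Φ) :=
  superalgebra (wittBr Φ n) (divAct Φ n) (-LinearMap.mul Φ (DP Φ n))

/-! ### The modular contact Lie superalgebra -/

section Contact

variable {Φ : Type u} [Field Φ] [CharP Φ 3] {n : ℕ}

/-- The element `a ∂ + b ∂_θ` of `W(1, 1; n)`, for `a = a₀ + a₁ θ` and `b = b₀ + b₁ θ` in
`𝒪(1, 1; n)`, as an operator on `𝒪(1, 1; n)`. Elements `f + g θ` of `𝒪(1, 1; n)` are represented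
by pairs `(f, g)`; thus `∂ (f + g θ) = ∂(f) + ∂(g) θ` and `∂_θ (f + g θ) = g`. -/
def superDer (a b : DP Φ n × DP Φ n) : Module.End Φ (DP Φ n × DP Φ n) where
  toFun F := (a.1 * DP.partialD Φ n F.1 + b.1 * F.2,
    a.1 * DP.partialD Φ n F.2 + a.2 * DP.partialD Φ n F.1 + b.2 * F.2)
  map_add' F G := by ext1 <;> simp [mul_add] <;> abel
  map_smul' c F := by ext1 <;> simp

/-- `D_K(f) = θ ∂(f) ∂_θ + 2 f ∂` for `f ∈ 𝒪(1; n)`. -/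
def contactEven (f : DP Φ n) : Module.End Φ (DP Φ n × DP Φ n) :=
  superDer (2 * f, 0) (0, DP.partialD Φ n f)

/-- `D_K(g θ) = g ∂_θ + g θ ∂` for `g ∈ 𝒪(1; n)`. -/
def contactOdd (g : DP Φ n) : Module.End Φ (DP Φ n × DP Φ n) :=
  superDer (0, g) (g, 0)

variable (Φ n)

/-- The even (`false`) and odd (`true`) elements of the Lie subsuperalgebra of `W(1, 1; n)`
generated by the image of `D_K`, with respect to the supercommutator of operators. -/
inductive ContactMem : Bool → Module.End Φ (DP Φ n × DP Φ n) → Prop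
  | even (f : DP Φ n) : ContactMem false (contactEven f)
  | odd (g : DP Φ n) : ContactMem true (contactOdd g)
  | zero (s : Bool) : ContactMem s 0
  | add {s : Bool} {A B} : ContactMem s A → ContactMem s B → ContactMem s (A + B)
  | smul {s : Bool} (c : Φ) {A} : ContactMem s A → ContactMem s (c • A)
  | lie_even_even {A B} : ContactMem false A → ContactMem false B → ContactMem false (A * B - B * A)
  | lie_even_odd {A B} : ContactMem false A → ContactMem true B → ContactMem true (A * B - B * A)
  | lie_odd_odd {A B} : ContactMem true A → ContactMem true B → ContactMem false (A * B + B * A)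

/-- The even and the odd part of `K(1, 1; n)`. -/
def contactPart (s : Bool) : Submodule Φ (Module.End Φ (DP Φ n × DP Φ n)) where
  carrier := {A | ContactMem Φ n s A}
  add_mem' := ContactMem.add
  zero_mem' := ContactMem.zero s
  smul_mem' c _ := ContactMem.smul c

/-- The modular contact Lie superalgebra `K(1, 1; n)`. -/
def contactAlgebra : AlgebraIn (SVec Φ) :=
  superalgebra (A₀ := contactPart Φ n false) (A₁ := contactPart Φ n true)
    (LinearMap.mk₂ Φ (fun A B => ⟨A.1 * B.1 - B.1 * A.1, ContactMem.lie_even_even A.2 B.2⟩)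
      (fun A A' B => Subtype.ext (by simp [add_mul, mul_add]; abel))
      (fun c A B => Subtype.ext (by simp [smul_sub]))
      (fun A A' B => Subtype.ext (by simp [add_mul, mul_add]; abel))
      (fun c A B => Subtype.ext (by simp [smul_sub])))
    (LinearMap.mk₂ Φ (fun A B => ⟨A.1 * B.1 - B.1 * A.1, ContactMem.lie_even_odd A.2 B.2⟩)
      (fun A A' B => Subtype.ext (by simp [add_mul, mul_add]; abel))
      (fun c A B => Subtype.ext (by simp [smul_sub]))
      (fun A A' B => Subtype.ext (by simp [add_mul, mul_add]; abel))
      (fun c A B => Subtype.ext (by simp [smul_sub])))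
    (LinearMap.mk₂ Φ (fun A B => ⟨A.1 * B.1 + B.1 * A.1, ContactMem.lie_odd_odd A.2 B.2⟩)
      (fun A A' B => Subtype.ext (by simp [add_mul, mul_add]; abel))
      (fun c A B => Subtype.ext (by simp))
      (fun A A' B => Subtype.ext (by simp [add_mul, mul_add]; abel))
      (fun c A B => Subtype.ext (by simp)))

end Contact

end

end FrankSemisimplification

open FrankSemisimplification

/-!
Let `d` be an endomorphism with `d ^ 3 = 0` of a finite-dimensional vector space `V` over a field of
characteristic three. Then `V` is a sum of Jordan blocks `J₁`, `J₂`, `J₃` of sizes one, two and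
three. The multiplicity spaces of `J₁` and `J₂` are functorial in `V`:
`Ev d = ker d / (ker d ∩ im d)` and `Od d = ker d² / (ker d² ∩ (ker d + im d))`. The functor
`toSuper`, `V ↦ Ev d ⊕ Od d`, induces the equivalence `semiToSuper` between the semisimplification
of `Rep(α₃)` and `sVec`:

* A morphism is negligible if and only if it vanishes on the even and the odd part
  (`negligible_iff`). One direction holds since an endomorphism that vanishes on both parts agrees,
  up to a nilpotent one, with an endomorphism through blocks of size three, and the latter has trace
  zero because `3 = 0` (`trace_eq_zero_of_superMap_eq_zero`). For the other direction, a functional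
  on `Ev d` or `Od d` gives a morphism back whose composite has a non-zero trace.
* The tensor structure `superMul` is induced by `v ⊗ w`, except on two odd parts, where it is the
  class of `v ⊗ d w - d v ⊗ w`. That element is antisymmetric under the flip, which yields the sign
  rule of `sVec` (`superMul_comm`), and associativity on three odd parts holds up to a value of `d`
  since `3 = 0` (`superMul_assoc`). It is an isomorphism (`superMul_bijective`): a left inverse is
  written down from splittings `V ⇄ J₁ ⊗ Ev d ⊕ J₂ ⊗ Od d`, and it is surjective because, up to
  negligible morphisms, the objects are sums of copies of `J₁` and `J₂`.

For the Frank algebra with `d = ad (e ⊗ 1)`, choose `v` with `w = e v ≠ 0`. Under `d` the summand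
`W` is trivial, `𝔰𝔩(U) ⊗ 𝒪` is a sum of blocks of size three (`SlFrame.lie_sum_eq`) and
`U ⊗ 𝒪_(div)` is a sum of blocks of size two generated by `v ⊗ 𝒪_(div)`. Thus the even part is `W`
and the odd part is `𝒪_(div)`, and the formula for `superMul` turns the bracket of `ℱ(n)` into the
product of `W ⊕ 𝒪_(div)` with `[y, y'] = λ(w, v) y y' ∂` for odd `y`, `y'`
(`SlFrame.superalgebra_isomorphic_frank`). The scalar need not be a square, but it can be changed to
`-1` by the automorphism `x⁽ⁱ⁾ ↦ cⁱ x⁽ⁱ⁾` of `𝒪`, which rescales `∂`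
(`superalgebra_isomorphic_wittDivAlgebra`).

Finally the elements `D_K(f)` and `D_K(g θ)` are closed under the supercommutator and satisfy the
relations of `W ⊕ 𝒪_(div)` (`wittDivAlgebra_isomorphic_contactAlgebra`).
-/

namespace FrankSemisimplification

noncomputable section

/-! ### Subquotients of vector spaces -/

section Subquot

variable {Φ : Type u} [Field Φ] {V W Z V' : Type u} [AddCommGroup V] [AddCommGroup W]
  [AddCommGroup Z] [AddCommGroup V'] [Module Φ V] [Module Φ W] [Module Φ Z] [Module Φ V']

/-- The subquotient `K / (K ⊓ N)` of a vector space, for subspaces `K` and `N`. It is not assumed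
that `N ≤ K`. -/
def Subquot (K N : Submodule Φ V) : Type u := K ⧸ N.submoduleOf K

namespace Subquot

variable (K N : Submodule Φ V)

instance : AddCommGroup (Subquot K N) := inferInstanceAs (AddCommGroup (K ⧸ N.submoduleOf K))
instance : Module Φ (Subquot K N) := inferInstanceAs (Module Φ (K ⧸ N.submoduleOf K))
instance [Module.Finite Φ V] : Module.Finite Φ (Subquot K N) :=
  inferInstanceAs (Module.Finite Φ (K ⧸ N.submoduleOf K))

variable {K N} {L P : Submodule Φ W} {M Q : Submodule Φ Z}

/-- The class of an element of `K`. -/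
def cls (x : V) (hx : x ∈ K) : Subquot K N := (N.submoduleOf K).mkQ ⟨x, hx⟩

theorem induction {p : Subquot K N → Prop} (h : ∀ x hx, p (cls x hx)) (t : Subquot K N) : p t := by
  obtain ⟨⟨x, hx⟩, rfl⟩ := Submodule.mkQ_surjective _ t
  exact h x hx

theorem cls_eq_cls {x y : V} {hx : x ∈ K} {hy : y ∈ K} :
    (cls x hx : Subquot K N) = cls y hy ↔ x - y ∈ N :=
  Submodule.Quotient.eq (N.submoduleOf K)

theorem cls_eq_zero {x : V} {hx : x ∈ K} : (cls x hx : Subquot K N) = 0 ↔ x ∈ N :=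
  Submodule.Quotient.mk_eq_zero (N.submoduleOf K)

theorem cls_congr {x y : V} (hx : x ∈ K) (h : x = y) :
    (cls x hx : Subquot K N) = cls y (h ▸ hx) := by subst h; rfl

/-- The linear map out of a subquotient induced by a linear map that vanishes on `N`. -/
def lift (f : V →ₗ[Φ] V') (hN : ∀ x ∈ K, x ∈ N → f x = 0) : Subquot K N →ₗ[Φ] V' :=
  (N.submoduleOf K).liftQ (f ∘ₗ K.subtype) (fun x hx => hN x.1 x.2 hx)

@[simp] theorem lift_cls (f : V →ₗ[Φ] V') (hN : ∀ x ∈ K, x ∈ N → f x = 0) (x : V) (hx : x ∈ K) :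
    lift (N := N) f hN (cls x hx) = f x := rfl

/-- The linear map into a subquotient given by a linear map with values in `K`. -/
def lin (f : V' →ₗ[Φ] V) (h : ∀ x, f x ∈ K) : V' →ₗ[Φ] Subquot K N :=
  (N.submoduleOf K).mkQ ∘ₗ f.codRestrict K h

/-- The linear map between subquotients induced by a linear map. -/
def map (f : V →ₗ[Φ] W) (hK : ∀ x ∈ K, f x ∈ L) (hN : ∀ x ∈ K, x ∈ N → f x ∈ P) :
    Subquot K N →ₗ[Φ] Subquot L P :=
  (N.submoduleOf K).mapQ (P.submoduleOf L) (f.restrict hK) (fun x hx => hN x.1 x.2 hx)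

/-- The bilinear map between subquotients induced by a bilinear map. -/
def map₂ (B : V →ₗ[Φ] W →ₗ[Φ] Z) (h : ∀ x ∈ K, ∀ y ∈ L, B x y ∈ M)
    (hN : ∀ x ∈ K, x ∈ N → ∀ y ∈ L, B x y ∈ Q) (hP : ∀ x ∈ K, ∀ y ∈ L, y ∈ P → B x y ∈ Q) :
    Subquot K N →ₗ[Φ] Subquot L P →ₗ[Φ] Subquot M Q :=
  (N.submoduleOf K).liftQ
    { toFun := fun x => map (B x.1) (h x.1 x.2) (hP x.1 x.2)
      map_add' := fun x x' => LinearMap.ext fun t => by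
        induction t using induction with
        | h y hy => exact cls_congr _ (by simp)
      map_smul' := fun c x => LinearMap.ext fun t => by
        induction t using induction with
        | h y hy => exact cls_congr _ (by simp) }
    (fun x hx => LinearMap.ext fun t => by
      induction t using induction with
      | h y hy => exact cls_eq_zero.mpr (hN x.1 x.2 hx y hy))

variable (K N)

/-- A subquotient has a linear system of representatives. -/
theorem exists_section : ∃ s : Subquot K N →ₗ[Φ] V, ∀ t, ∃ h : s t ∈ K, cls (s t) h = t := by
  obtain ⟨s, hs⟩ := (N.submoduleOf K).mkQ.exists_rightInverse_of_surjective
    (Submodule.range_mkQ (N.submoduleOf K))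
  exact ⟨K.subtype ∘ₗ s, fun t => ⟨(s t).2, LinearMap.congr_fun hs t⟩⟩

/-- A linear map `f` with `f ⁻¹ (R) ∩ K = N ∩ K` identifies `K / (K ⊓ N)` with a subspace of
`W / R`, and the inverse extends linearly to `W`. -/
theorem exists_retraction (f : V →ₗ[Φ] W) (R : Submodule Φ W)
    (h : ∀ x ∈ K, x ∈ N ↔ f x ∈ R) :
    ∃ p : W →ₗ[Φ] Subquot K N, (∀ y ∈ R, p y = 0) ∧ ∀ x (hx : x ∈ K), p (f x) = cls x hx := by
  let j : Subquot K N →ₗ[Φ] W ⧸ R := lift (R.mkQ ∘ₗ f) fun x hx hN => by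
    simpa using (h x hx).mp hN
  have hj : LinearMap.ker j = ⊥ := by
    rw [LinearMap.ker_eq_bot']
    intro t ht
    induction t using induction with
    | h x hx =>
      rw [cls_eq_zero, h x hx]
      simpa [j] using ht
  obtain ⟨q, hq⟩ := j.exists_leftInverse_of_injective hj
  refine ⟨q ∘ₗ R.mkQ, fun y hy => ?_, fun x hx => ?_⟩
  · have : R.mkQ y = 0 := by simpa using hy
    rw [LinearMap.comp_apply, this, map_zero]
  · exact LinearMap.congr_fun hq (cls x hx)

end Subquot

end Subquot

/-! ### The even and the odd part of an operator with vanishing cube -/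

section EvOd

open Subquot

variable {Φ : Type u} [Field Φ] {V W Z V' W' : Type u} [AddCommGroup V] [AddCommGroup W]
  [AddCommGroup Z] [AddCommGroup V'] [AddCommGroup W'] [Module Φ V] [Module Φ W] [Module Φ Z]
  [Module Φ V'] [Module Φ W']

/-- The space `ker a / (ker a ⊓ im a)`. If `a ^ 3 = 0`, then its dimension is the number of
Jordan blocks of size one of `a`. -/
abbrev Ev (a : Module.End Φ V) : Type u := Subquot (LinearMap.ker a) (LinearMap.range a)

/-- The space `ker a² / (ker a² ⊓ (ker a + im a))`. If `a ^ 3 = 0`, then its dimension is the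
number of Jordan blocks of size two of `a`. -/
abbrev Od (a : Module.End Φ V) : Type u :=
  Subquot (LinearMap.ker (a ∘ₗ a)) (LinearMap.ker a ⊔ LinearMap.range a)

variable {a : Module.End Φ V} {b : Module.End Φ W} {c : Module.End Φ Z}

/-- The class of a vector annihilated by `a`. -/
abbrev evCls (a : Module.End Φ V) (x : V) (hx : a x = 0) : Ev a := cls x hx

/-- The class of a vector annihilated by `a ^ 2`. -/
abbrev odCls (a : Module.End Φ V) (x : V) (hx : a (a x) = 0) : Od a := cls x hx

theorem mem_ker_sup_range {x : V} :
    x ∈ LinearMap.ker a ⊔ LinearMap.range a ↔ ∃ y, a (x - a y) = 0 := by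
  rw [Submodule.mem_sup]
  constructor
  · rintro ⟨y, hy, _, ⟨z, rfl⟩, rfl⟩
    exact ⟨z, by simpa using hy⟩
  · rintro ⟨y, hy⟩
    exact ⟨x - a y, hy, a y, ⟨y, rfl⟩, by abel⟩

theorem evCls_eq {x y : V} {hx : a x = 0} {hy : a y = 0} (z : V) (h : x - y = a z) :
    evCls a x hx = evCls a y hy := cls_eq_cls.mpr ⟨z, h.symm⟩

theorem odCls_eq {x y : V} {hx : a (a x) = 0} {hy : a (a y) = 0} (z : V)
    (h : a (x - y) = a (a z)) : odCls a x hx = odCls a y hy := by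
  refine cls_eq_cls.mpr (mem_ker_sup_range.mpr ⟨z, ?_⟩)
  rw [map_sub a (x - y), h, sub_self]

theorem evCls_eq_zero {x : V} {hx : a x = 0} : evCls a x hx = 0 ↔ ∃ z, a z = x := cls_eq_zero

theorem odCls_eq_zero {x : V} {hx : a (a x) = 0} :
    odCls a x hx = 0 ↔ ∃ z, a (x - a z) = 0 := cls_eq_zero.trans mem_ker_sup_range

section intertwiner

variable (f : V →ₗ[Φ] W) (hf : f ∘ₗ a = b ∘ₗ f)
include hf

theorem intertwine_apply (x : V) : b (f x) = f (a x) := (LinearMap.congr_fun hf x).symm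

/-- The map on even parts induced by an intertwiner. -/
def evMap : Ev a →ₗ[Φ] Ev b :=
  Subquot.map f (fun x hx => by
      rw [LinearMap.mem_ker] at hx ⊢; rw [intertwine_apply f hf, hx, map_zero])
    (by rintro _ - ⟨z, rfl⟩; exact ⟨f z, intertwine_apply f hf z⟩)

/-- The map on odd parts induced by an intertwiner. -/
def odMap : Od a →ₗ[Φ] Od b :=
  Subquot.map f (fun x hx => by
      rw [LinearMap.mem_ker, LinearMap.comp_apply] at hx ⊢
      rw [intertwine_apply f hf, intertwine_apply f hf, hx, map_zero])
    (fun x _ hx => by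
      rw [mem_ker_sup_range] at hx ⊢
      obtain ⟨z, hz⟩ := hx
      exact ⟨f z, by rw [intertwine_apply f hf, ← map_sub, intertwine_apply f hf, hz, map_zero]⟩)

end intertwiner

/-! ### The products of the even and the odd parts -/

/-- The product `[v] ⊗ [w] ↦ [v ⊗ w]` of even parts. -/
def evEv (a : Module.End Φ V) (b : Module.End Φ W) : Ev a →ₗ[Φ] Ev b →ₗ[Φ] Ev (tensorD a b) :=
  map₂ (TensorProduct.mk Φ V W)
    (fun x hx y hy => by
      rw [LinearMap.mem_ker] at *
      simp [hx, hy])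
    (by
      rintro _ - ⟨z, rfl⟩ y hy
      rw [LinearMap.mem_ker] at *
      exact ⟨z ⊗ₜ y, by simp [hy]⟩)
    (by
      rintro x hx _ - ⟨z, rfl⟩
      rw [LinearMap.mem_ker] at *
      exact ⟨x ⊗ₜ z, by simp [hx]⟩)

/-- If `x = a z` is annihilated by `a`, then `2 (x ⊗ y) = (x ⊗ y - z ⊗ b y) + d (z ⊗ y)` with
`d = a ⊗ 1 + 1 ⊗ b` annihilating the first term; since `2 = -1` this shows that `x ⊗ y` has trivial
class in the odd part. -/
theorem tmul_mem_of_range_left [CharP Φ 3] {z : V} {y : W} (hz : a (a z) = 0)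
    (hy : b (b y) = 0) : a z ⊗ₜ[Φ] y ∈
      LinearMap.ker (tensorD a b) ⊔ LinearMap.range (tensorD a b) := by
  have h3 : (3 : Φ) = 0 := CharP.cast_eq_zero Φ 3
  refine mem_ker_sup_range.mpr ⟨-(z ⊗ₜ y), ?_⟩
  simp only [map_sub, map_neg, tensorD_tmul, map_add, hz, hy, TensorProduct.zero_tmul,
    TensorProduct.tmul_zero]
  linear_combination (norm := module) h3 • (a z ⊗ₜ[Φ] b y)

theorem tmul_mem_of_range_right [CharP Φ 3] {y : V} {z : W} (hz : b (b z) = 0)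
    (hy : a (a y) = 0) : y ⊗ₜ[Φ] b z ∈
      LinearMap.ker (tensorD a b) ⊔ LinearMap.range (tensorD a b) := by
  have h3 : (3 : Φ) = 0 := CharP.cast_eq_zero Φ 3
  refine mem_ker_sup_range.mpr ⟨-(y ⊗ₜ z), ?_⟩
  simp only [map_sub, map_neg, tensorD_tmul, map_add, hz, hy, TensorProduct.zero_tmul,
    TensorProduct.tmul_zero]
  linear_combination (norm := module) h3 • (a y ⊗ₜ[Φ] b z)

/-- The product `[v] ⊗ [w] ↦ [v ⊗ w]` of an even and an odd part. -/
def evOd [CharP Φ 3] (a : Module.End Φ V) (b : Module.End Φ W) :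
    Ev a →ₗ[Φ] Od b →ₗ[Φ] Od (tensorD a b) :=
  map₂ (TensorProduct.mk Φ V W)
    (fun x hx y hy => by
      rw [LinearMap.mem_ker] at *
      rw [LinearMap.comp_apply] at *
      simp [hx, hy])
    (by
      rintro _ hx ⟨z, rfl⟩ y hy
      exact tmul_mem_of_range_left hx hy)
    (by
      rintro x hx y - hy
      rw [mem_ker_sup_range] at *
      rw [LinearMap.mem_ker] at hx
      obtain ⟨z, hz⟩ := hy
      exact ⟨x ⊗ₜ z, by
        rw [map_sub, sub_eq_zero] at hz
        simp [hx, hz]⟩)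

/-- The product `[v] ⊗ [w] ↦ [v ⊗ w]` of an odd and an even part. -/
def odEv [CharP Φ 3] (a : Module.End Φ V) (b : Module.End Φ W) :
    Od a →ₗ[Φ] Ev b →ₗ[Φ] Od (tensorD a b) :=
  map₂ (TensorProduct.mk Φ V W)
    (fun x hx y hy => by
      rw [LinearMap.mem_ker] at *
      rw [LinearMap.comp_apply] at *
      simp [hx, hy])
    (by
      rintro x - hx y hy
      rw [mem_ker_sup_range] at *
      rw [LinearMap.mem_ker] at hy
      obtain ⟨z, hz⟩ := hx
      exact ⟨z ⊗ₜ y, by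
        rw [map_sub, sub_eq_zero] at hz
        simp [hy, hz]⟩)
    (by
      rintro x hx _ hy ⟨z, rfl⟩
      exact tmul_mem_of_range_right hy hx)

/-- The bilinear map `(v, w) ↦ v ⊗ b w - a v ⊗ w`. -/
def wronskian (a : Module.End Φ V) (b : Module.End Φ W) : V →ₗ[Φ] W →ₗ[Φ] V ⊗[Φ] W :=
  (TensorProduct.mk Φ V W).compl₂ b - TensorProduct.mk Φ V W ∘ₗ a

@[simp] theorem wronskian_apply (v : V) (w : W) :
    wronskian a b v w = v ⊗ₜ b w - a v ⊗ₜ w := rfl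

/-- The product `[v] ⊗ [w] ↦ [v ⊗ b w - a v ⊗ w]` of odd parts. Its antisymmetry under the flip is
the source of the sign rule. -/
def odOd [CharP Φ 3] (a : Module.End Φ V) (b : Module.End Φ W) :
    Od a →ₗ[Φ] Od b →ₗ[Φ] Ev (tensorD a b) :=
  have h3 : (3 : Φ) = 0 := CharP.cast_eq_zero Φ 3
  map₂ (wronskian a b)
    (fun x hx y hy => by
      rw [LinearMap.mem_ker] at *
      rw [LinearMap.comp_apply] at hx hy
      simp [hx, hy])
    (by
      rintro x - hx y hy
      rw [mem_ker_sup_range] at hx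
      rw [LinearMap.mem_ker, LinearMap.comp_apply] at hy
      obtain ⟨z, hz⟩ := hx
      rw [map_sub, sub_eq_zero] at hz
      refine ⟨x ⊗ₜ y + a z ⊗ₜ y - z ⊗ₜ b y, ?_⟩
      simp only [map_sub, map_add, tensorD_tmul, wronskian_apply, hz, hy,
        TensorProduct.tmul_zero]
      linear_combination (norm := module) h3 • (a (a z) ⊗ₜ[Φ] y))
    (by
      rintro x hx y - hy
      rw [mem_ker_sup_range] at hy
      rw [LinearMap.mem_ker, LinearMap.comp_apply] at hx
      obtain ⟨z, hz⟩ := hy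
      rw [map_sub, sub_eq_zero] at hz
      refine ⟨-(x ⊗ₜ y) + a x ⊗ₜ z - x ⊗ₜ b z, ?_⟩
      simp only [map_add, map_sub, map_neg, tensorD_tmul, wronskian_apply, hz, hx,
        TensorProduct.zero_tmul]
      linear_combination (norm := module) -h3 • (x ⊗ₜ[Φ] b (b z)))

section apply

variable (x : V) (y : W)

@[simp] theorem evEv_cls (hx : a x = 0) (hy : b y = 0) :
    evEv a b (evCls a x hx) (evCls b y hy) =
      evCls (tensorD a b) (x ⊗ₜ y) (by simp [hx, hy]) := rfl

variable [CharP Φ 3]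

@[simp] theorem evOd_cls (hx : a x = 0) (hy : b (b y) = 0) :
    evOd a b (evCls a x hx) (odCls b y hy) =
      odCls (tensorD a b) (x ⊗ₜ y) (by simp [hx, hy]) := rfl

@[simp] theorem odEv_cls (hx : a (a x) = 0) (hy : b y = 0) :
    odEv a b (odCls a x hx) (evCls b y hy) =
      odCls (tensorD a b) (x ⊗ₜ y) (by simp [hx, hy]) := rfl

@[simp] theorem odOd_cls (hx : a (a x) = 0) (hy : b (b y) = 0) :
    odOd a b (odCls a x hx) (odCls b y hy) =
      evCls (tensorD a b) (x ⊗ₜ b y - a x ⊗ₜ y) (by simp [hx, hy]) := rfl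

end apply

end EvOd

/-! ### The super vector space attached to a representation -/

section SuperMul

open Subquot

variable {Φ : Type u} [Field Φ] {V W Z M : Type u} [AddCommGroup V] [AddCommGroup W]
  [AddCommGroup Z] [AddCommGroup M] [Module Φ V] [Module Φ W] [Module Φ Z] [Module Φ M]
  {a : Module.End Φ V} {b : Module.End Φ W} {c : Module.End Φ Z}

/-- The class in `Ev a × Od a` of a vector annihilated by `a`. -/
def inEv (a : Module.End Φ V) (x : V) (hx : a x = 0) : Ev a × Od a := (evCls a x hx, 0)

/-- The class in `Ev a × Od a` of a vector annihilated by `a ^ 2`. -/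
def inOd (a : Module.End Φ V) (x : V) (hx : a (a x) = 0) : Ev a × Od a := (0, odCls a x hx)

theorem inEv_eq {x y : V} {hx : a x = 0} {hy : a y = 0} (z : V) (h : x - y = a z) :
    inEv a x hx = inEv a y hy := congrArg (·, 0) (evCls_eq z h)

theorem inOd_eq {x y : V} {hx : a (a x) = 0} {hy : a (a y) = 0} (z : V)
    (h : a (x - y) = a (a z)) : inOd a x hx = inOd a y hy := congrArg (0, ·) (odCls_eq z h)

theorem inEv_congr {x y : V} {hx : a x = 0} (h : x = y) : inEv a x hx = inEv a y (h ▸ hx) := by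
  subst h; rfl

theorem inEv_add {x y : V} (hx : a x = 0) (hy : a y = 0) :
    inEv a x hx + inEv a y hy = inEv a (x + y) (by rw [map_add, hx, hy, add_zero]) :=
  Prod.ext rfl (add_zero _)

theorem inEv_smul (r : Φ) {x : V} (hx : a x = 0) :
    r • inEv a x hx = inEv a (r • x) (by rw [map_smul, hx, smul_zero]) :=
  Prod.ext rfl (smul_zero _)

theorem inOd_add {x y : V} (hx : a (a x) = 0) (hy : a (a y) = 0) :
    inOd a x hx + inOd a y hy =
      inOd a (x + y) (by rw [map_add, map_add, hx, hy, add_zero]) :=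
  Prod.ext (add_zero _) rfl

theorem inOd_smul (r : Φ) {x : V} (hx : a (a x) = 0) :
    r • inOd a x hx = inOd a (r • x) (by rw [map_smul, map_smul, hx, smul_zero]) :=
  Prod.ext (smul_zero _) rfl

theorem evOd_induction {p : Ev a × Od a → Prop} (t : Ev a × Od a)
    (h0 : ∀ x hx, p (inEv a x hx)) (h1 : ∀ x hx, p (inOd a x hx))
    (hadd : ∀ s t, p s → p t → p (s + t)) : p t := by
  obtain ⟨t0, t1⟩ := t
  have e : (t0, t1) = ((t0, 0) : Ev a × Od a) + (0, t1) := by simp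
  rw [e]
  refine hadd _ _ ?_ ?_
  · induction t0 using Subquot.induction with
    | h x hx => exact h0 x hx
  · induction t1 using Subquot.induction with
    | h x hx => exact h1 x hx

theorem evOd_ext {f g : (Ev a × Od a) →ₗ[Φ] M}
    (h0 : ∀ x hx, f (inEv a x hx) = g (inEv a x hx))
    (h1 : ∀ x hx, f (inOd a x hx) = g (inOd a x hx)) : f = g :=
  LinearMap.ext fun t => evOd_induction (p := fun t => f t = g t) t h0 h1 fun s t hs ht => by
    rw [map_add, map_add, hs, ht]

theorem evOd_ext₂ {f g : (Ev a × Od a) ⊗[Φ] (Ev b × Od b) →ₗ[Φ] M}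
    (h00 : ∀ x hx y hy, f (inEv a x hx ⊗ₜ inEv b y hy) = g (inEv a x hx ⊗ₜ inEv b y hy))
    (h01 : ∀ x hx y hy, f (inEv a x hx ⊗ₜ inOd b y hy) = g (inEv a x hx ⊗ₜ inOd b y hy))
    (h10 : ∀ x hx y hy, f (inOd a x hx ⊗ₜ inEv b y hy) = g (inOd a x hx ⊗ₜ inEv b y hy))
    (h11 : ∀ x hx y hy, f (inOd a x hx ⊗ₜ inOd b y hy) = g (inOd a x hx ⊗ₜ inOd b y hy)) :
    f = g :=
  TensorProduct.ext <| evOd_ext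
    (fun x hx => evOd_ext (fun y hy => h00 x hx y hy) fun y hy => h01 x hx y hy)
    (fun x hx => evOd_ext (fun y hy => h10 x hx y hy) fun y hy => h11 x hx y hy)

theorem evOd_ext₃ {f g : ((Ev a × Od a) ⊗[Φ] (Ev b × Od b)) ⊗[Φ] (Ev c × Od c) →ₗ[Φ] M}
    (h000 : ∀ x hx y hy z hz, f ((inEv a x hx ⊗ₜ inEv b y hy) ⊗ₜ inEv c z hz) =
      g ((inEv a x hx ⊗ₜ inEv b y hy) ⊗ₜ inEv c z hz))
    (h010 : ∀ x hx y hy z hz, f ((inEv a x hx ⊗ₜ inOd b y hy) ⊗ₜ inEv c z hz) =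
      g ((inEv a x hx ⊗ₜ inOd b y hy) ⊗ₜ inEv c z hz))
    (h100 : ∀ x hx y hy z hz, f ((inOd a x hx ⊗ₜ inEv b y hy) ⊗ₜ inEv c z hz) =
      g ((inOd a x hx ⊗ₜ inEv b y hy) ⊗ₜ inEv c z hz))
    (h110 : ∀ x hx y hy z hz, f ((inOd a x hx ⊗ₜ inOd b y hy) ⊗ₜ inEv c z hz) =
      g ((inOd a x hx ⊗ₜ inOd b y hy) ⊗ₜ inEv c z hz))
    (h001 : ∀ x hx y hy z hz, f ((inEv a x hx ⊗ₜ inEv b y hy) ⊗ₜ inOd c z hz) =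
      g ((inEv a x hx ⊗ₜ inEv b y hy) ⊗ₜ inOd c z hz))
    (h011 : ∀ x hx y hy z hz, f ((inEv a x hx ⊗ₜ inOd b y hy) ⊗ₜ inOd c z hz) =
      g ((inEv a x hx ⊗ₜ inOd b y hy) ⊗ₜ inOd c z hz))
    (h101 : ∀ x hx y hy z hz, f ((inOd a x hx ⊗ₜ inEv b y hy) ⊗ₜ inOd c z hz) =
      g ((inOd a x hx ⊗ₜ inEv b y hy) ⊗ₜ inOd c z hz))
    (h111 : ∀ x hx y hy z hz, f ((inOd a x hx ⊗ₜ inOd b y hy) ⊗ₜ inOd c z hz) =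
      g ((inOd a x hx ⊗ₜ inOd b y hy) ⊗ₜ inOd c z hz)) :
    f = g :=
  TensorProduct.ext <| evOd_ext₂
    (fun x hx y hy => evOd_ext (fun z hz => h000 x hx y hy z hz) fun z hz => h001 x hx y hy z hz)
    (fun x hx y hy => evOd_ext (fun z hz => h010 x hx y hy z hz) fun z hz => h011 x hx y hy z hz)
    (fun x hx y hy => evOd_ext (fun z hz => h100 x hx y hy z hz) fun z hz => h101 x hx y hy z hz)
    (fun x hx y hy => evOd_ext (fun z hz => h110 x hx y hy z hz) fun z hz => h111 x hx y hy z hz)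

/-- The map on even and odd parts induced by an intertwiner. -/
def superMap (f : V →ₗ[Φ] W) (hf : f ∘ₗ a = b ∘ₗ f) : (Ev a × Od a) →ₗ[Φ] (Ev b × Od b) :=
  (evMap f hf).prodMap (odMap f hf)

@[simp] theorem superMap_inEv (f : V →ₗ[Φ] W) (hf : f ∘ₗ a = b ∘ₗ f) (x : V) (hx : a x = 0) :
    superMap f hf (inEv a x hx) =
      inEv b (f x) (by rw [intertwine_apply f hf, hx, map_zero]) :=
  Prod.ext rfl (map_zero (odMap f hf))

@[simp] theorem superMap_inOd (f : V →ₗ[Φ] W) (hf : f ∘ₗ a = b ∘ₗ f) (x : V)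
    (hx : a (a x) = 0) : superMap f hf (inOd a x hx) =
      inOd b (f x) (by rw [intertwine_apply f hf, intertwine_apply f hf, hx, map_zero]) :=
  Prod.ext (map_zero (evMap f hf)) rfl

variable (a) in
/-- The projection onto the odd part. -/
def superOdd : Module.End Φ (Ev a × Od a) := LinearMap.inr Φ _ _ ∘ₗ LinearMap.snd Φ _ _

@[simp] theorem superOdd_inEv (x : V) (hx : a x = 0) : superOdd a (inEv a x hx) = 0 := rfl

@[simp] theorem superOdd_inOd (x : V) (hx : a (a x) = 0) :
    superOdd a (inOd a x hx) = inOd a x hx := rfl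

variable (Φ) in
/-- The identification of `Φ` with the even part of the trivial representation. -/
def superUnit : Φ →ₗ[Φ] Ev (0 : Module.End Φ Φ) × Od (0 : Module.End Φ Φ) where
  toFun r := inEv 0 r rfl
  map_add' _ _ := (inEv_add (a := (0 : Module.End Φ Φ)) rfl rfl).symm
  map_smul' r _ := Prod.ext rfl (smul_zero r).symm

@[simp] theorem superUnit_apply (r : Φ) : superUnit Φ r = inEv 0 r rfl := rfl

theorem superUnit_bijective : Function.Bijective (superUnit Φ) := by
  constructor
  · rw [injective_iff_map_eq_zero]
    intro r hr
    obtain ⟨z, hz⟩ := evCls_eq_zero.mp (congrArg Prod.fst hr)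
    exact hz.symm
  · intro t
    refine evOd_induction (p := fun t => ∃ r, superUnit Φ r = t) t (fun r _ => ⟨r, rfl⟩) ?_ ?_
    · exact fun x hx => ⟨0, (map_zero _).trans
        (Prod.ext rfl (odCls_eq_zero.mpr ⟨0, rfl⟩).symm)⟩
    · rintro _ _ ⟨r, rfl⟩ ⟨s, rfl⟩
      exact ⟨r + s, map_add _ _ _⟩

variable [CharP Φ 3]

/-- The product of the even and odd parts of `a` and `b`, with values in those of
`a ⊗ 1 + 1 ⊗ b`. -/
def superMul (a : Module.End Φ V) (b : Module.End Φ W) :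
    (Ev a × Od a) ⊗[Φ] (Ev b × Od b) →ₗ[Φ] Ev (tensorD a b) × Od (tensorD a b) :=
  TensorProduct.lift <| LinearMap.mk₂ Φ
    (fun v w => (evEv a b v.1 w.1 + odOd a b v.2 w.2, evOd a b v.1 w.2 + odEv a b v.2 w.1))
    (fun v v' w => by ext1 <;> simp <;> abel) (fun c v w => by ext1 <;> simp)
    (fun v w w' => by ext1 <;> simp <;> abel) (fun c v w => by ext1 <;> simp)

theorem superMul_tmul (v : Ev a × Od a) (w : Ev b × Od b) : superMul a b (v ⊗ₜ w) =
    (evEv a b v.1 w.1 + odOd a b v.2 w.2, evOd a b v.1 w.2 + odEv a b v.2 w.1) := rfl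

section apply

variable (x : V) (y : W)

@[simp] theorem superMul_inEv_inEv (hx : a x = 0) (hy : b y = 0) :
    superMul a b (inEv a x hx ⊗ₜ inEv b y hy) =
      inEv (tensorD a b) (x ⊗ₜ y) (by simp [hx, hy]) := by
  simp [superMul_tmul, inEv]

@[simp] theorem superMul_inEv_inOd (hx : a x = 0) (hy : b (b y) = 0) :
    superMul a b (inEv a x hx ⊗ₜ inOd b y hy) =
      inOd (tensorD a b) (x ⊗ₜ y) (by simp [hx, hy]) := by
  simp [superMul_tmul, inEv, inOd]

@[simp] theorem superMul_inOd_inEv (hx : a (a x) = 0) (hy : b y = 0) :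
    superMul a b (inOd a x hx ⊗ₜ inEv b y hy) =
      inOd (tensorD a b) (x ⊗ₜ y) (by simp [hx, hy]) := by
  simp [superMul_tmul, inEv, inOd]

@[simp] theorem superMul_inOd_inOd (hx : a (a x) = 0) (hy : b (b y) = 0) :
    superMul a b (inOd a x hx ⊗ₜ inOd b y hy) =
      inEv (tensorD a b) (x ⊗ₜ b y - a x ⊗ₜ y) (by simp [hx, hy]) := by
  simp [superMul_tmul, inEv, inOd]

end apply

theorem superMul_natural {V' W' : Type u} [AddCommGroup V'] [AddCommGroup W'] [Module Φ V']
    [Module Φ W'] {a' : Module.End Φ V'} {b' : Module.End Φ W'} {f : V →ₗ[Φ] V'}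
    {g : W →ₗ[Φ] W'} (hf : f ∘ₗ a = a' ∘ₗ f) (hg : g ∘ₗ b = b' ∘ₗ g) :
    superMul a' b' ∘ₗ TensorProduct.map (superMap f hf) (superMap g hg) =
      superMap (TensorProduct.map f g) (tensorD_map hf hg) ∘ₗ superMul a b := by
  apply evOd_ext₂ <;> intro x hx y hy <;>
    simp only [LinearMap.comp_apply, TensorProduct.map_tmul, superMap_inEv, superMap_inOd,
      superMul_inEv_inEv, superMul_inEv_inOd, superMul_inOd_inEv, superMul_inOd_inOd, map_sub,
      intertwine_apply f hf, intertwine_apply g hg]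

theorem superMul_assoc : superMap (TensorProduct.assoc Φ V W Z).toLinearMap
      (tensorD_assoc a b c) ∘ₗ superMul (tensorD a b) c ∘ₗ (superMul a b).rTensor (Ev c × Od c) =
    superMul a (tensorD b c) ∘ₗ (superMul b c).lTensor (Ev a × Od a) ∘ₗ
      (TensorProduct.assoc Φ (Ev a × Od a) (Ev b × Od b) (Ev c × Od c)).toLinearMap := by
  have h3 : (3 : Φ) = 0 := CharP.cast_eq_zero Φ 3
  apply evOd_ext₃ <;> intro x hx y hy z hz <;>
    simp only [LinearMap.comp_apply, TensorProduct.assoc_tmul, superMap_inEv, superMap_inOd,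
      superMul_inEv_inEv, superMul_inEv_inOd, superMul_inOd_inEv, superMul_inOd_inOd, map_sub,
      LinearMap.rTensor_tmul, LinearMap.lTensor_tmul, LinearEquiv.coe_coe, TensorProduct.tmul_sub,
      TensorProduct.sub_tmul, tensorD_tmul, TensorProduct.tmul_zero,
      TensorProduct.zero_tmul, hx, hy, hz, add_zero, zero_add]
  -- only the product of three odd parts remains; there the difference is `-d (x ⊗ y ⊗ z)`
  refine inOd_eq (-(x ⊗ₜ (y ⊗ₜ z))) (congrArg _ ?_)
  rw [map_neg, tensorD_tmul, tensorD_tmul, TensorProduct.tmul_add]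
  linear_combination (norm := module) h3 • (x ⊗ₜ[Φ] (b y ⊗ₜ[Φ] z))

theorem superMul_tensorOdd : superMul a b ∘ₗ tensorOdd (superOdd a) (superOdd b) =
    superOdd (tensorD a b) ∘ₗ superMul a b := by
  apply evOd_ext₂ <;> intro x hx y hy <;> simp

theorem superMul_comm : superMap (TensorProduct.comm Φ V W).toLinearMap (tensorD_comm a b) ∘ₗ
    superMul a b = superMul b a ∘ₗ superFlip (superOdd a) (superOdd b) := by
  have h3 : (3 : Φ) = 0 := CharP.cast_eq_zero Φ 3
  have h2 : (2 : Φ) = -1 := by linear_combination h3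
  apply evOd_ext₂ <;> intro x hx y hy <;>
    simp only [LinearMap.comp_apply, superFlip_tmul, superOdd_inEv, superOdd_inOd, map_sub,
      TensorProduct.zero_tmul, TensorProduct.tmul_zero, map_smul, smul_zero, sub_zero,
      superMap_inEv, superMap_inOd, LinearEquiv.coe_coe, TensorProduct.comm_tmul,
      superMul_inEv_inEv, superMul_inEv_inOd, superMul_inOd_inEv, superMul_inOd_inOd, h2,
      neg_smul, one_smul, sub_neg_eq_add, inEv_add]
  refine inEv_congr ?_
  linear_combination (norm := module) h3 • (b y ⊗ₜ[Φ] x - y ⊗ₜ[Φ] a x)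

theorem superMul_lid : superMap (TensorProduct.lid Φ W).toLinearMap (tensorD_lid b) ∘ₗ
    superMul 0 b ∘ₗ (superUnit Φ).rTensor (Ev b × Od b) =
      (TensorProduct.lid Φ (Ev b × Od b)).toLinearMap := by
  refine TensorProduct.ext (LinearMap.ext fun r => evOd_ext (fun y hy => ?_) fun y hy => ?_) <;>
    simp [inEv_smul, inOd_smul]

theorem superMul_rid : superMap (TensorProduct.rid Φ W).toLinearMap (tensorD_rid b) ∘ₗ
    superMul b 0 ∘ₗ (superUnit Φ).lTensor (Ev b × Od b) =
      (TensorProduct.rid Φ (Ev b × Od b)).toLinearMap := by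
  refine TensorProduct.ext (evOd_ext (fun y hy => LinearMap.ext fun r => ?_)
    fun y hy => LinearMap.ext fun r => ?_) <;>
    simp [inEv_smul, inOd_smul]

end SuperMul

/-! ### Splittings -/

section Splitting

open Subquot

variable {Φ : Type u} [Field Φ] {V W : Type u} [AddCommGroup V] [AddCommGroup W]
  [Module Φ V] [Module Φ W] {a : Module.End Φ V} {b : Module.End Φ W}

/-- Linear representatives `s₀`, `s₁` of the even and the odd part of `a`, and linear extensions
to `V` of the class maps: `p₀` of `ker a → Ev a`, and `z` of the map `a x ↦ [x]` defined on
`a (ker a²)`. Thus `s₀` and `p₀` give morphisms between `V` and copies of the Jordan block of size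
one, and `(s₁, a s₁)` and `(z a, z)` give morphisms between `V` and copies of the Jordan block of
size two. -/
structure Splitting (a : Module.End Φ V) where
  s₀ : Ev a →ₗ[Φ] V
  p₀ : V →ₗ[Φ] Ev a
  s₁ : Od a →ₗ[Φ] V
  z : V →ₗ[Φ] Od a
  a_s₀ : ∀ t, a (s₀ t) = 0
  evCls_s₀ : ∀ t, evCls a (s₀ t) (a_s₀ t) = t
  p₀_a : ∀ x, p₀ (a x) = 0
  p₀_apply : ∀ x (hx : a x = 0), p₀ x = evCls a x hx
  a_a_s₁ : ∀ t, a (a (s₁ t)) = 0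
  odCls_s₁ : ∀ t, odCls a (s₁ t) (a_a_s₁ t) = t
  z_a_a : ∀ x, z (a (a x)) = 0
  z_a : ∀ x (hx : a (a x) = 0), z (a x) = odCls a x hx

variable (a) in
theorem Splitting.nonempty : Nonempty (Splitting a) := by
  obtain ⟨s₀, hs₀⟩ := exists_section (LinearMap.ker a) (LinearMap.range a)
  obtain ⟨s₁, hs₁⟩ := exists_section (LinearMap.ker (a ∘ₗ a)) (LinearMap.ker a ⊔ LinearMap.range a)
  obtain ⟨p₀, hp, hp'⟩ := exists_retraction (LinearMap.ker a) (LinearMap.range a)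
    LinearMap.id (LinearMap.range a) (fun _ _ => Iff.rfl)
  obtain ⟨z, hz, hz'⟩ := exists_retraction (LinearMap.ker (a ∘ₗ a))
    (LinearMap.ker a ⊔ LinearMap.range a) a (LinearMap.range (a ∘ₗ a)) (fun x _ => by
      rw [mem_ker_sup_range]
      exact exists_congr fun y => by rw [map_sub, sub_eq_zero, eq_comm]; rfl)
  exact ⟨⟨s₀, p₀, s₁, z, fun t => (hs₀ t).1, fun t => (hs₀ t).2, fun x => hp _ ⟨x, rfl⟩, hp',
    fun t => (hs₁ t).1, fun t => (hs₁ t).2, fun x => hz _ ⟨x, rfl⟩, hz'⟩⟩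

namespace Splitting

variable (A : Splitting a) (B : Splitting b)

/-- The endomorphism of `V` that factors through the Jordan blocks of sizes one and two. -/
def proj : Module.End Φ V := A.s₀ ∘ₗ A.p₀ + a ∘ₗ A.s₁ ∘ₗ A.z + A.s₁ ∘ₗ A.z ∘ₗ a

theorem proj_apply (x : V) : A.proj x = A.s₀ (A.p₀ x) + a (A.s₁ (A.z x)) + A.s₁ (A.z (a x)) := rfl

theorem proj_comm : A.proj ∘ₗ a = a ∘ₗ A.proj := by
  ext x
  simp [proj_apply, A.a_s₀, A.p₀_a, A.a_a_s₁, A.z_a_a]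

theorem superMap_proj : superMap A.proj A.proj_comm = LinearMap.id := by
  refine evOd_ext (fun x hx => ?_) fun x hx => ?_
  · rw [superMap_inEv, LinearMap.id_apply]
    obtain ⟨w, hw⟩ := cls_eq_cls.mp ((A.evCls_s₀ (A.p₀ x)).trans (A.p₀_apply x hx))
    refine inEv_eq (w + A.s₁ (A.z x)) ?_
    rw [proj_apply, hx, map_zero, map_zero, map_add, hw]
    abel
  · rw [superMap_inOd, LinearMap.id_apply]
    obtain ⟨w, hw⟩ := mem_ker_sup_range.mp
      (cls_eq_cls.mp ((A.odCls_s₁ (A.z (a x))).trans (A.z_a x hx)))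
    refine inOd_eq w ?_
    rw [map_sub, sub_eq_zero, map_sub] at hw
    rw [proj_apply, map_sub, map_add, map_add, A.a_s₀, A.a_a_s₁, zero_add, zero_add, hw]

/-! ### Bijectivity of the product -/

/-- The even component of the inverse of `superMul`. On the odd parts it is the morphism from the
tensor square of the Jordan block of size two to the trivial representation. -/
def comulEv : V ⊗[Φ] W →ₗ[Φ] (Ev a × Od a) ⊗[Φ] (Ev b × Od b) :=
  TensorProduct.map (.inl Φ (Ev a) (Od a) ∘ₗ A.p₀) (.inl Φ (Ev b) (Od b) ∘ₗ B.p₀) +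
    (TensorProduct.map (.inr Φ (Ev a) (Od a) ∘ₗ A.z) (.inr Φ (Ev b) (Od b) ∘ₗ B.z ∘ₗ b) -
      TensorProduct.map (.inr Φ (Ev a) (Od a) ∘ₗ A.z ∘ₗ a) (.inr Φ (Ev b) (Od b) ∘ₗ B.z))

/-- The odd component of the inverse of `superMul`. -/
def comulOd : V ⊗[Φ] W →ₗ[Φ] (Ev a × Od a) ⊗[Φ] (Ev b × Od b) :=
  (TensorProduct.map (.inl Φ (Ev a) (Od a) ∘ₗ A.p₀) (.inr Φ (Ev b) (Od b) ∘ₗ B.z) +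
    TensorProduct.map (.inr Φ (Ev a) (Od a) ∘ₗ A.z) (.inl Φ (Ev b) (Od b) ∘ₗ B.p₀)) ∘ₗ
      tensorD a b

theorem comulEv_tensorD (t : V ⊗[Φ] W) : comulEv A B (tensorD a b t) = 0 := by
  induction t using TensorProduct.induction_on with
  | zero => simp
  | tmul x y => simp [comulEv, A.p₀_a, B.p₀_a, A.z_a_a, B.z_a_a, ← Prod.zero_eq_mk]
  | add s t hs ht => rw [map_add, map_add, hs, ht, add_zero]

theorem comulOd_tensorD (t : V ⊗[Φ] W) : comulOd A B (tensorD a b t) = 0 := by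
  induction t using TensorProduct.induction_on with
  | zero => simp
  | tmul x y => simp [comulOd, A.p₀_a, B.p₀_a, A.z_a_a, B.z_a_a, ← Prod.zero_eq_mk]
  | add s t hs ht => rw [map_add, map_add, hs, ht, add_zero]

/-- The inverse of `superMul` given by splittings. -/
def comul : (Ev (tensorD a b) × Od (tensorD a b)) →ₗ[Φ] (Ev a × Od a) ⊗[Φ] (Ev b × Od b) :=
  LinearMap.coprod
    (Subquot.lift (comulEv A B) (by
      rintro _ - ⟨t, rfl⟩
      exact comulEv_tensorD A B t))
    (Subquot.lift (comulOd A B) (by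
      rintro t - ht
      obtain ⟨y, hy⟩ := mem_ker_sup_range.mp ht
      rw [map_sub, sub_eq_zero] at hy
      rw [comulOd, LinearMap.comp_apply, hy]
      exact comulOd_tensorD A B y))

theorem comul_inEv (t : V ⊗[Φ] W) (ht : tensorD a b t = 0) :
    comul A B (inEv (tensorD a b) t ht) = comulEv A B t := by
  rw [comul, inEv, LinearMap.coprod_apply, map_zero, add_zero]; rfl

theorem comul_inOd (t : V ⊗[Φ] W) (ht : tensorD a b (tensorD a b t) = 0) :
    comul A B (inOd (tensorD a b) t ht) = comulOd A B t := by
  rw [comul, inOd, LinearMap.coprod_apply, map_zero, zero_add]; rfl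

variable [CharP Φ 3]

theorem comul_superMul : comul A B ∘ₗ superMul a b = LinearMap.id := by
  have h3 : (3 : Φ) = 0 := CharP.cast_eq_zero Φ 3
  apply evOd_ext₂ <;> intro x hx y hy
  · rw [LinearMap.comp_apply, superMul_inEv_inEv, comul_inEv]
    simp [comulEv, inEv, A.p₀_apply x hx, B.p₀_apply y hy, hx, hy, ← Prod.zero_eq_mk]
  · rw [LinearMap.comp_apply, superMul_inEv_inOd, comul_inOd]
    simp [comulOd, inEv, inOd, A.p₀_apply x hx, B.z_a y hy, hx, B.p₀_a, ← Prod.zero_eq_mk]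
  · rw [LinearMap.comp_apply, superMul_inOd_inEv, comul_inOd]
    simp [comulOd, inEv, inOd, B.p₀_apply y hy, A.z_a x hx, hy, A.p₀_a, ← Prod.zero_eq_mk]
  · rw [LinearMap.comp_apply, superMul_inOd_inOd, comul_inEv]
    simp only [comulEv, inOd, LinearMap.add_apply, LinearMap.sub_apply, TensorProduct.map_tmul,
      LinearMap.comp_apply, map_sub, A.p₀_a, B.p₀_a, hx, hy, map_zero, TensorProduct.zero_tmul,
      TensorProduct.tmul_zero, A.z_a x hx, B.z_a y hy, LinearMap.inr_apply, LinearMap.id_apply]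
    linear_combination (norm := module) -h3 •
      (((0, odCls a x hx) : Ev a × Od a) ⊗ₜ[Φ] ((0, odCls b y hy) : Ev b × Od b))

/-- The vectors annihilated by `a` with class in a given subspace of `Ev a × Od a`. -/
def evReps (R : Submodule Φ (Ev a × Od a)) : Submodule Φ V where
  carrier := {v | ∃ h, inEv a v h ∈ R}
  zero_mem' := ⟨map_zero a, R.zero_mem⟩
  add_mem' := by
    rintro v w ⟨hv, mv⟩ ⟨hw, mw⟩
    exact ⟨by rw [map_add, hv, hw, add_zero], inEv_add hv hw ▸ R.add_mem mv mw⟩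
  smul_mem' := by
    rintro r v ⟨hv, mv⟩
    exact ⟨by rw [map_smul, hv, smul_zero], inEv_smul r hv ▸ R.smul_mem r mv⟩

/-- The vectors annihilated by `a ^ 2` with class in a given subspace of `Ev a × Od a`. -/
def odReps (R : Submodule Φ (Ev a × Od a)) : Submodule Φ V where
  carrier := {v | ∃ h, inOd a v h ∈ R}
  zero_mem' := ⟨by rw [map_zero, map_zero], R.zero_mem⟩
  add_mem' := by
    rintro v w ⟨hv, mv⟩ ⟨hw, mw⟩
    exact ⟨by rw [map_add, map_add, hv, hw, add_zero], inOd_add hv hw ▸ R.add_mem mv mw⟩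
  smul_mem' := by
    rintro r v ⟨hv, mv⟩
    exact ⟨by rw [map_smul, map_smul, hv, smul_zero], inOd_smul r hv ▸ R.smul_mem r mv⟩

/-- The product maps onto the part of `V ⊗ W` that factors through tensor products of Jordan
blocks of sizes one and two. -/
theorem superMap_proj_mem_range (h : TensorProduct.map A.proj B.proj ∘ₗ tensorD a b =
      tensorD a b ∘ₗ TensorProduct.map A.proj B.proj) (t : Ev (tensorD a b) × Od (tensorD a b)) :
    superMap (TensorProduct.map A.proj B.proj) h t ∈ LinearMap.range (superMul a b) := by
  have h3 : (3 : Φ) = 0 := CharP.cast_eq_zero Φ 3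
  have m00 : ∀ τ, TensorProduct.map A.s₀ B.s₀ τ ∈ evReps (LinearMap.range (superMul a b)) := by
    intro τ
    induction τ using TensorProduct.induction_on with
    | zero => rw [map_zero]; exact zero_mem _
    | tmul x y => exact ⟨_, _, superMul_inEv_inEv _ _ (A.a_s₀ x) (B.a_s₀ y)⟩
    | add σ τ hσ hτ => rw [map_add]; exact add_mem hσ hτ
  have m11 : ∀ τ, TensorProduct.map A.s₁ (b ∘ₗ B.s₁) τ - TensorProduct.map (a ∘ₗ A.s₁) B.s₁ τ ∈
      evReps (LinearMap.range (superMul a b)) := by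
    intro τ
    induction τ using TensorProduct.induction_on with
    | zero => rw [map_zero, map_zero, sub_zero]; exact zero_mem _
    | tmul x y => exact ⟨_, _, superMul_inOd_inOd _ _ (A.a_a_s₁ x) (B.a_a_s₁ y)⟩
    | add σ τ hσ hτ => rw [map_add, map_add, add_sub_add_comm]; exact add_mem hσ hτ
  have m01 : ∀ τ, TensorProduct.map A.s₀ B.s₁ τ ∈ odReps (LinearMap.range (superMul a b)) := by
    intro τ
    induction τ using TensorProduct.induction_on with
    | zero => rw [map_zero]; exact zero_mem _
    | tmul x y => exact ⟨_, _, superMul_inEv_inOd _ _ (A.a_s₀ x) (B.a_a_s₁ y)⟩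
    | add σ τ hσ hτ => rw [map_add]; exact add_mem hσ hτ
  have m10 : ∀ τ, TensorProduct.map A.s₁ B.s₀ τ ∈ odReps (LinearMap.range (superMul a b)) := by
    intro τ
    induction τ using TensorProduct.induction_on with
    | zero => rw [map_zero]; exact zero_mem _
    | tmul x y => exact ⟨_, _, superMul_inOd_inEv _ _ (A.a_a_s₁ x) (B.a_s₀ y)⟩
    | add σ τ hσ hτ => rw [map_add]; exact add_mem hσ hτ
  refine evOd_induction
    (p := fun t => superMap (TensorProduct.map A.proj B.proj) h t ∈ _) t ?_ ?_ ?_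
  · intro t ht
    obtain ⟨hv, mv⟩ := sub_mem (m00 (TensorProduct.map A.p₀ B.p₀ t))
      (m11 (TensorProduct.map A.z (B.z ∘ₗ b) t))
    let r : Module.End Φ (V ⊗[Φ] W) := TensorProduct.map (A.s₀ ∘ₗ A.p₀) (B.s₁ ∘ₗ B.z) +
      TensorProduct.map (A.s₁ ∘ₗ A.z) (B.s₀ ∘ₗ B.p₀) +
      TensorProduct.map (A.s₁ ∘ₗ A.z) (b ∘ₗ B.s₁ ∘ₗ B.z)
    let q : Module.End Φ (V ⊗[Φ] W) := r + TensorProduct.map (A.s₁ ∘ₗ A.z) (B.s₁ ∘ₗ B.z ∘ₗ b)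
    have key : TensorProduct.map A.proj B.proj =
        TensorProduct.map A.s₀ B.s₀ ∘ₗ TensorProduct.map A.p₀ B.p₀ -
          (TensorProduct.map A.s₁ (b ∘ₗ B.s₁) - TensorProduct.map (a ∘ₗ A.s₁) B.s₁) ∘ₗ
            TensorProduct.map A.z (B.z ∘ₗ b) + tensorD a b ∘ₗ r + q ∘ₗ tensorD a b := by
      apply TensorProduct.ext'
      intro x y
      simp only [q, r, LinearMap.add_apply, LinearMap.sub_apply, LinearMap.comp_apply,
        TensorProduct.map_tmul, tensorD_tmul, proj_apply, map_add, A.a_s₀, B.a_s₀, A.p₀_a, B.p₀_a,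
        B.a_a_s₁, B.z_a_a, map_zero, TensorProduct.zero_tmul,
        TensorProduct.tmul_zero, TensorProduct.add_tmul, TensorProduct.tmul_add]
      module
    rw [superMap_inEv]
    convert mv using 1
    refine inEv_eq (r t) ?_
    have e := LinearMap.congr_fun key t
    simp only [LinearMap.add_apply, LinearMap.sub_apply, LinearMap.comp_apply, ht, map_zero] at e
    rw [e]
    abel
  · intro t ht
    obtain ⟨hv, mv⟩ := add_mem (m01 (TensorProduct.map A.p₀ (B.z ∘ₗ b) t))
      (m10 (TensorProduct.map (A.z ∘ₗ a) B.p₀ t))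
    let r : Module.End Φ (V ⊗[Φ] W) := TensorProduct.map (A.s₀ ∘ₗ A.p₀) (B.s₁ ∘ₗ B.z) +
      TensorProduct.map (A.s₁ ∘ₗ A.z) (B.s₀ ∘ₗ B.p₀) +
      TensorProduct.map (A.s₁ ∘ₗ A.z) (b ∘ₗ B.s₁ ∘ₗ B.z) -
      TensorProduct.map (A.s₁ ∘ₗ A.z) (B.s₁ ∘ₗ B.z ∘ₗ b) -
      TensorProduct.map (A.s₁ ∘ₗ A.z ∘ₗ a) (B.s₁ ∘ₗ B.z)
    let q : Module.End Φ (V ⊗[Φ] W) := TensorProduct.map (A.s₁ ∘ₗ A.z) (B.s₁ ∘ₗ B.z)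
    have key : tensorD a b ∘ₗ TensorProduct.map A.proj B.proj =
        tensorD a b ∘ₗ (TensorProduct.map A.s₀ B.s₁ ∘ₗ TensorProduct.map A.p₀ (B.z ∘ₗ b) +
          TensorProduct.map A.s₁ B.s₀ ∘ₗ TensorProduct.map (A.z ∘ₗ a) B.p₀) +
        tensorD a b ∘ₗ tensorD a b ∘ₗ r - tensorD a b ∘ₗ q ∘ₗ tensorD a b ∘ₗ tensorD a b := by
      apply TensorProduct.ext'
      intro x y
      simp only [q, r, LinearMap.add_apply, LinearMap.sub_apply, LinearMap.comp_apply,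
        TensorProduct.map_tmul, tensorD_tmul, proj_apply, map_add, map_sub, A.a_s₀, B.a_s₀,
        A.a_a_s₁, B.a_a_s₁, A.z_a_a, B.z_a_a, map_zero, TensorProduct.zero_tmul,
        TensorProduct.tmul_zero, TensorProduct.add_tmul, TensorProduct.tmul_add]
      linear_combination (norm := module) h3 • (a (A.s₁ (A.z x)) ⊗ₜ[Φ] b (B.s₁ (B.z (b y)))) +
        h3 • (a (A.s₁ (A.z (a x))) ⊗ₜ[Φ] b (B.s₁ (B.z y))) +
        h3 • (a (A.s₁ (A.z (a x))) ⊗ₜ[Φ] B.s₁ (B.z (b y)) +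
          A.s₁ (A.z (a x)) ⊗ₜ[Φ] b (B.s₁ (B.z (b y))))
    rw [superMap_inOd]
    convert mv using 1
    refine inOd_eq (r t) ?_
    have e := LinearMap.congr_fun key t
    simp only [LinearMap.add_apply, LinearMap.sub_apply, LinearMap.comp_apply, ht, map_zero,
      sub_zero] at e
    rw [map_sub, e, sub_eq_iff_eq_add']
  · intro s t hs ht
    rw [map_add]
    exact add_mem hs ht

end Splitting

end Splitting

/-! ### Negligible morphisms -/

section Negligible

variable {Φ : Type u} [Field Φ]

/-- A linear map over a field has a generalized inverse. -/
theorem exists_comp_comp_eq {V W : Type u} [AddCommGroup V] [AddCommGroup W] [Module Φ V]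
    [Module Φ W] (c : V →ₗ[Φ] W) : ∃ h : W →ₗ[Φ] V, ∀ x, c (h (c x)) = c x := by
  obtain ⟨r, hr⟩ := c.rangeRestrict.exists_rightInverse_of_surjective
    (LinearMap.range_rangeRestrict c)
  obtain ⟨h, hh⟩ := LinearMap.exists_extend r
  refine ⟨h, fun x => ?_⟩
  have h1 : h (c x) = r (c.rangeRestrict x) := LinearMap.congr_fun hh (c.rangeRestrict x)
  rw [h1]
  exact congrArg Subtype.val (LinearMap.congr_fun hr (c.rangeRestrict x))

/-- An endomorphism that vanishes on the even and the odd part has trace zero. For `h` with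
`a² h a² = a²`, the endomorphism `N = a² h + a h a + h a²` commutes with `a`, the trace of `g N` is
`3 tr (g h a²) = 0`, and `g (1 - N)` maps `V` successively into `ker a + im a`, `im a`, `im a²`
and `0`. -/
theorem trace_eq_zero_of_superMap_eq_zero [CharP Φ 3] {V : Type u} [AddCommGroup V] [Module Φ V]
    [Module.Finite Φ V] {a : Module.End Φ V} (ha : a ^ 3 = 0) (g : Module.End Φ V)
    (hg : g ∘ₗ a = a ∘ₗ g) (h0 : superMap g hg = 0) : LinearMap.trace Φ V g = 0 := by
  have h3 : (3 : Φ) = 0 := CharP.cast_eq_zero Φ 3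
  have ha' : ∀ x, a (a (a x)) = 0 := fun x => LinearMap.congr_fun ha x
  have hg' : ∀ x, g (a x) = a (g x) := fun x => LinearMap.congr_fun hg x
  have hev : ∀ x, a x = 0 → ∃ z, a z = g x := fun x hx =>
    evCls_eq_zero.mp (congrArg Prod.fst ((superMap_inEv g hg x hx).symm.trans
      (LinearMap.congr_fun h0 _)))
  have hod : ∀ x, a (a x) = 0 → ∃ z, a (g x - a z) = 0 := fun x hx =>
    odCls_eq_zero.mp (congrArg Prod.snd ((superMap_inOd g hg x hx).symm.trans
      (LinearMap.congr_fun h0 _)))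
  obtain ⟨h, hh⟩ := exists_comp_comp_eq (a * a)
  let N : Module.End Φ V := a * a * h + a * h * a + h * (a * a)
  have hN : ∀ x, N x = a (a (h x)) + a (h (a x)) + h (a (a x)) := fun _ => rfl
  have hgN : LinearMap.trace Φ V (g * N) = 0 := by
    have hc : g * a = a * g := hg
    have e1 : LinearMap.trace Φ V (g * (a * a * h)) = LinearMap.trace Φ V (g * (h * (a * a))) := by
      rw [← mul_assoc, ← mul_assoc g a a, hc, mul_assoc a g a, hc, ← mul_assoc, mul_assoc,
        LinearMap.trace_mul_comm, mul_assoc]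
    have e2 : LinearMap.trace Φ V (g * (a * h * a)) = LinearMap.trace Φ V (g * (h * (a * a))) := by
      rw [mul_assoc a, ← mul_assoc, hc, mul_assoc, LinearMap.trace_mul_comm]
      simp only [mul_assoc]
    rw [mul_add, mul_add, map_add, map_add, e1, e2]
    linear_combination LinearMap.trace Φ V (g * (h * (a * a))) * h3
  let G : Module.End Φ V := g * (1 - N)
  have hG : ∀ x, G x = g (x - N x) := fun _ => rfl
  have hGa : ∀ x, G (a x) = a (G x) := fun x => by
    rw [hG, hG, ← hg']
    congr 1
    simp only [hN, map_sub, map_add, ha', map_zero]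
    abel
  have haaG : ∀ x, a (a (x - N x)) = 0 := fun x => by
    simp only [hN, map_sub, map_add, ha', zero_add]
    exact sub_eq_zero.mpr (hh x).symm
  have h1 : ∀ x, ∃ z, a (G x - a z) = 0 := fun x => hod _ (haaG x)
  have h2 : ∀ x, a x = 0 → ∃ w, a w = G x := fun x hx => hev _ (by
    simp [hN, hx, ha'])
  have hnil : G ^ 4 = 0 := by
    refine LinearMap.ext fun x => ?_
    simp only [pow_succ, pow_zero, one_mul, Module.End.mul_apply, LinearMap.zero_apply]
    obtain ⟨z, hz⟩ := h1 x
    obtain ⟨w, hw⟩ := h2 _ hz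
    have e2 : G (G x) = a (w + G z) := by
      rw [map_add, hw, map_sub, hGa]; abel
    obtain ⟨v, hv⟩ := h1 (w + G z)
    rw [map_sub, sub_eq_zero] at hv
    rw [e2, hGa, hv, hGa, hGa]
    exact (hg' _ ▸ hg' _ ▸ congrArg g (haaG v)).trans (map_zero g)
  have htr := (LinearMap.isNilpotent_trace_of_isNilpotent ⟨4, hnil⟩ :
    IsNilpotent (LinearMap.trace Φ V G)).eq_zero
  have e : g = G + g * N := by simp only [G, mul_sub, mul_one, sub_add_cancel]
  rw [e, map_add, htr, hgN, add_zero]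

theorem superMap_comp {V W Z : Type u} [AddCommGroup V] [AddCommGroup W] [AddCommGroup Z]
    [Module Φ V] [Module Φ W] [Module Φ Z] {a : Module.End Φ V} {b : Module.End Φ W}
    {c : Module.End Φ Z} (f : V →ₗ[Φ] W) (hf : f ∘ₗ a = b ∘ₗ f) (g : W →ₗ[Φ] Z)
    (hg : g ∘ₗ b = c ∘ₗ g) (hgf : (g ∘ₗ f) ∘ₗ a = c ∘ₗ g ∘ₗ f) :
    superMap (g ∘ₗ f) hgf = superMap g hg ∘ₗ superMap f hf :=
  evOd_ext (fun x hx => by simp) fun x hx => by simp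

variable {X Y : RepAlpha Φ}

/-- A morphism is negligible if and only if it vanishes on the even and the odd part. -/
theorem negligible_iff [CharP Φ 3] (f : X ⟶ Y) : Negligible f ↔ superMap f.lin f.comm = 0 := by
  constructor
  · intro hf
    obtain ⟨B⟩ := Splitting.nonempty Y.d
    refine evOd_ext (fun x hx => ?_) fun x hx => ?_
    · have key : evCls Y.d (f.lin x) (by rw [intertwine_apply _ f.comm, hx, map_zero]) = 0 := by
        rw [← Module.forall_dual_apply_eq_zero_iff Φ]
        intro χ
        have h := hf ⟨(χ ∘ₗ B.p₀).smulRight x, by ext y; simp [B.p₀_a, hx]⟩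
        have e : f.lin ∘ₗ (χ ∘ₗ B.p₀).smulRight x = (χ ∘ₗ B.p₀).smulRight (f.lin x) := by
          ext y; simp
        rw [e, LinearMap.trace_smulRight] at h
        rw [← B.p₀_apply]; exact h
      rw [superMap_inEv]
      exact Prod.ext key rfl
    · have key : odCls Y.d (f.lin x) (by
          rw [intertwine_apply _ f.comm, intertwine_apply _ f.comm, hx, map_zero]) = 0 := by
        rw [← Module.forall_dual_apply_eq_zero_iff Φ]
        intro χ
        have h := hf ⟨(χ ∘ₗ B.z ∘ₗ Y.d).smulRight x + (χ ∘ₗ B.z).smulRight (X.d x), by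
          ext y; simp [B.z_a_a, hx]⟩
        have e : f.lin ∘ₗ ((χ ∘ₗ B.z ∘ₗ Y.d).smulRight x + (χ ∘ₗ B.z).smulRight (X.d x)) =
            (χ ∘ₗ B.z ∘ₗ Y.d).smulRight (f.lin x) + (χ ∘ₗ B.z).smulRight (Y.d (f.lin x)) := by
          ext y; simp [intertwine_apply _ f.comm]
        rw [e, map_add, LinearMap.trace_smulRight, LinearMap.trace_smulRight] at h
        rw [← B.z_a]
        have h3 : (3 : Φ) = 0 := CharP.cast_eq_zero Φ 3
        simp only [LinearMap.comp_apply] at h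
        linear_combination -h + χ (B.z (Y.d (f.lin x))) * h3
      rw [superMap_inOd]
      exact Prod.ext rfl key
  · intro hf u
    refine trace_eq_zero_of_superMap_eq_zero Y.d_pow _ (u ≫ f).comm ?_
    have e := superMap_comp u.lin u.comm f.lin f.comm (u ≫ f).comm
    rw [hf, LinearMap.zero_comp] at e
    exact e

end Negligible

/-! ### The equivalence with super vector spaces -/

section Equivalence

variable {Φ : Type u} [Field Φ]

theorem superMap_superOdd {V W : Type u} [AddCommGroup V] [AddCommGroup W] [Module Φ V]
    [Module Φ W] {a : Module.End Φ V} {b : Module.End Φ W} (f : V →ₗ[Φ] W)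
    (hf : f ∘ₗ a = b ∘ₗ f) : superMap f hf ∘ₗ superOdd a = superOdd b ∘ₗ superMap f hf :=
  evOd_ext (fun x hx => by simp) fun x hx => by simp

theorem superMap_id {V : Type u} [AddCommGroup V] [Module Φ V] (a : Module.End Φ V)
    (h : LinearMap.id ∘ₗ a = a ∘ₗ LinearMap.id) :
    superMap (LinearMap.id : V →ₗ[Φ] V) h = LinearMap.id :=
  evOd_ext (fun x hx => by simp) fun x hx => by simp

theorem superMap_add {V W : Type u} [AddCommGroup V] [AddCommGroup W] [Module Φ V]
    [Module Φ W] {a : Module.End Φ V} {b : Module.End Φ W} (f g : V →ₗ[Φ] W)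
    (hf : f ∘ₗ a = b ∘ₗ f) (hg : g ∘ₗ a = b ∘ₗ g) (h : (f + g) ∘ₗ a = b ∘ₗ (f + g)) :
    superMap (f + g) h = superMap f hf + superMap g hg :=
  evOd_ext (fun x hx => by simp [inEv_add]) fun x hx => by simp [inOd_add]

theorem superMap_smul {V W : Type u} [AddCommGroup V] [AddCommGroup W] [Module Φ V]
    [Module Φ W] {a : Module.End Φ V} {b : Module.End Φ W} (r : Φ) (f : V →ₗ[Φ] W)
    (hf : f ∘ₗ a = b ∘ₗ f) (h : (r • f) ∘ₗ a = b ∘ₗ (r • f)) :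
    superMap (r • f) h = r • superMap f hf :=
  evOd_ext (fun x hx => by simp [inEv_smul]) fun x hx => by simp [inOd_smul]

/-- A representation of `α₃` gives a super vector space with even part `Ev d` and odd part
`Od d`. -/
def toSuper : RepAlpha Φ ⥤ SVec Φ where
  obj X := ⟨Ev X.d × Od X.d, superOdd X.d, rfl⟩
  map f := ⟨superMap f.lin f.comm, superMap_superOdd f.lin f.comm⟩
  map_id X := SVec.hom_ext (superMap_id X.d _)
  map_comp f g := SVec.hom_ext (superMap_comp f.lin f.comm g.lin g.comm (f ≫ g).comm)

theorem toSuper_map_add {X Y : RepAlpha Φ} (f g : X ⟶ Y) :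
    toSuper.map (f + g) = toSuper.map f + toSuper.map g :=
  SVec.hom_ext (superMap_add f.lin g.lin f.comm g.comm (f + g).comm)

theorem toSuper_map_smul {X Y : RepAlpha Φ} (r : Φ) (f : X ⟶ Y) :
    toSuper.map (r • f) = r • toSuper.map f :=
  SVec.hom_ext (superMap_smul r f.lin f.comm (r • f).comm)

instance : (toSuper (Φ := Φ)).Additive where
  map_add {_ _ f g} := toSuper_map_add f g

/-- Every morphism of super vector spaces lifts to representations, through the Jordan blocks of
sizes one and two. -/
instance : (toSuper (Φ := Φ)).Full where
  map_surjective {X Y} φ := by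
    obtain ⟨A⟩ := Splitting.nonempty X.d
    obtain ⟨B⟩ := Splitting.nonempty Y.d
    let φl : (Ev X.d × Od X.d) →ₗ[Φ] (Ev Y.d × Od Y.d) := φ.lin
    have hφ : ∀ t, φl (superOdd X.d t) = superOdd Y.d (φl t) := LinearMap.congr_fun φ.comm
    let φ₀ : Ev X.d →ₗ[Φ] Ev Y.d := .fst Φ _ _ ∘ₗ φl ∘ₗ .inl Φ _ _
    let φ₁ : Od X.d →ₗ[Φ] Od Y.d := .snd Φ _ _ ∘ₗ φl ∘ₗ .inr Φ _ _
    have h₀ : ∀ t, φl (t, 0) = (φ₀ t, 0) := fun t =>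
      have h : superOdd Y.d (φl (t, 0)) = 0 := (hφ (t, 0)).symm.trans (map_zero φl)
      Prod.ext rfl (show (superOdd Y.d (φl (t, 0))).2 = 0 from congrArg Prod.snd h)
    have h₁ : ∀ t, φl (0, t) = (0, φ₁ t) := fun t =>
      Prod.ext (congrArg Prod.fst (hφ (0, t))) rfl
    let f : X →ₗ[Φ] Y := B.s₀ ∘ₗ φ₀ ∘ₗ A.p₀ + Y.d ∘ₗ B.s₁ ∘ₗ φ₁ ∘ₗ A.z +
      B.s₁ ∘ₗ φ₁ ∘ₗ A.z ∘ₗ X.d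
    have hf : f ∘ₗ X.d = Y.d ∘ₗ f := by
      ext x
      simp [f, A.p₀_a, B.a_s₀, B.a_a_s₁, A.z_a_a]
    refine ⟨⟨f, hf⟩, SVec.hom_ext ?_⟩
    change superMap f hf = φl
    refine evOd_ext (fun x hx => ?_) fun x hx => ?_
    · rw [superMap_inEv]
      refine Eq.trans ?_ (h₀ (evCls X.d x hx)).symm
      rw [← B.evCls_s₀ (φ₀ _)]
      refine inEv_eq (B.s₁ (φ₁ (A.z x))) ?_
      simp [f, hx, A.p₀_apply x hx]
    · rw [superMap_inOd]
      refine Eq.trans ?_ (h₁ (odCls X.d x hx)).symm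
      rw [← B.odCls_s₁ (φ₁ _)]
      refine inOd_eq 0 ?_
      simp [f, A.z_a x hx, B.a_s₀, B.a_a_s₁]

/-- A super vector space `A₀ ⊕ A₁` comes from `A₀ ⊗ J₁ ⊕ A₁ ⊗ J₂`, where `J₁` and `J₂` are the
Jordan blocks of sizes one and two; it is realized as `A × A₁` with `d (x, y) = (0, x₁)`. -/
instance : (toSuper (Φ := Φ)).EssSurj where
  mem_essImage A := by
    let d : Module.End Φ (A × LinearMap.range A.odd) :=
      .inr Φ _ _ ∘ₗ A.odd.rangeRestrict ∘ₗ .fst Φ _ _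
    have hd : ∀ x, d x = (0, A.odd.rangeRestrict x.1) := fun _ => rfl
    have hdd : ∀ x, d (d x) = 0 := fun x => by rw [hd, hd, map_zero]; rfl
    have hd0 : ∀ x, d x = 0 ↔ A.odd x.1 = 0 := fun x => by
      rw [hd, Prod.ext_iff, Subtype.ext_iff]
      simp
    have hoo : ∀ x, A.odd (A.odd x) = A.odd x := LinearMap.congr_fun A.odd_idem
    let X : RepAlpha Φ := ⟨A × LinearMap.range A.odd, d,
      LinearMap.ext fun x => hdd (d x)⟩
    let g : A →ₗ[Φ] Ev d × Od d := LinearMap.prod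
      (Subquot.lin (.inl Φ _ _ ∘ₗ (LinearMap.id - A.odd)) (fun x => (hd0 _).mpr (by simp [hoo])))
      (Subquot.lin (.inl Φ _ _) (fun x => hdd _))
    have hg : ∀ x, g x = (evCls d (x - A.odd x, 0) ((hd0 _).mpr (by simp [hoo])),
        odCls d (x, 0) (hdd _)) := fun _ => rfl
    have hbij : Function.Bijective g := by
      constructor
      · rw [injective_iff_map_eq_zero]
        intro x hx
        rw [hg, Prod.ext_iff] at hx
        obtain ⟨w, hw⟩ := evCls_eq_zero.mp hx.1
        obtain ⟨v, hv⟩ := odCls_eq_zero.mp hx.2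
        have h1 : x - A.odd x = 0 := (congrArg Prod.fst hw).symm
        rw [map_sub, hdd, sub_zero, hd0] at hv
        simpa [hv] using h1
      · intro t
        refine evOd_induction (p := fun t => ∃ x, g x = t) t ?_ ?_ ?_
        · rintro ⟨x, _, w, rfl⟩ hx
          have hx' : A.odd x = 0 := (hd0 _).mp hx
          refine ⟨x, Prod.ext (evCls_eq (-w, 0) ?_) (odCls_eq_zero.mpr ⟨0, ?_⟩)⟩
          · rw [hd]
            ext <;> simp [hx']
          · rw [map_zero, sub_zero, hd0]; exact hx'
        · rintro ⟨x, y⟩ hx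
          refine ⟨A.odd x, Prod.ext (evCls_eq_zero.mpr ⟨0, ?_⟩) (odCls_eq 0 ?_)⟩
          · simp [hoo, ← Prod.zero_eq_mk]
          · rw [map_zero, map_zero, hd0]
            simp [hoo]
        · rintro _ _ ⟨x, rfl⟩ ⟨y, rfl⟩
          exact ⟨x + y, map_add _ _ _⟩
    refine ⟨X, ⟨(SVec.isoMk (Y := toSuper.obj X) (LinearEquiv.ofBijective g hbij) ?_).symm⟩⟩
    ext x : 1
    refine Prod.ext (evCls_eq_zero.mpr ⟨0, ?_⟩) (odCls_eq 0 ?_)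
    · simp [hoo, ← Prod.zero_eq_mk]
    · rw [map_zero, map_zero, hd0]
      simp [hoo]

variable [CharP Φ 3]

/-- Two morphisms agree in the semisimplification if and only if they agree on the even and the odd
part. -/
theorem semisimplify_map_eq_iff {X Y : RepAlpha Φ} (f g : X ⟶ Y) :
    (semisimplify Φ).map f = (semisimplify Φ).map g ↔ toSuper.map f = toSuper.map g := by
  rw [CategoryTheory.Quotient.functor_map_eq_iff, ← sub_eq_zero (a := toSuper.map f),
    ← Functor.map_sub]
  exact (negligible_iff (f - g)).trans ⟨fun h => SVec.hom_ext h, fun h => congrArg SVec.Hom.lin h⟩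

theorem superMul_bijective (X Y : RepAlpha Φ) : Function.Bijective (superMul X.d Y.d) := by
  obtain ⟨A⟩ := Splitting.nonempty X.d
  obtain ⟨B⟩ := Splitting.nonempty Y.d
  refine ⟨Function.LeftInverse.injective (g := A.comul B) (LinearMap.congr_fun
    (A.comul_superMul B)), fun t => ?_⟩
  -- up to negligible morphisms, every representation is a sum of Jordan blocks of sizes one and two
  let p (Z : RepAlpha Φ) (C : Splitting Z.d) : Z ⟶ Z := ⟨C.proj, C.proj_comm⟩
  have hp : ∀ Z C, (semisimplify Φ).map (p Z C) = 𝟙 _ := fun Z C => by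
    rw [← CategoryTheory.Functor.map_id, semisimplify_map_eq_iff, CategoryTheory.Functor.map_id]
    exact SVec.hom_ext C.superMap_proj
  have h := Semisimplification.map_tensorHom (p X A) (p Y B)
  rw [hp, hp, id_tensorHom_id] at h
  have h' : (semisimplify Φ).map (p X A ⊗ₘ p Y B) = (semisimplify Φ).map (𝟙 _) := h
  rw [semisimplify_map_eq_iff, CategoryTheory.Functor.map_id] at h'
  have e := A.superMap_proj_mem_range B (p X A ⊗ₘ p Y B).comm t
  have e' : superMap (TensorProduct.map A.proj B.proj) (p X A ⊗ₘ p Y B).comm t = t :=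
    LinearMap.congr_fun (congrArg SVec.Hom.lin h') t
  rw [e'] at e
  exact e

variable (Φ) in
/-- The functor from the semisimplification to super vector spaces induced by `toSuper`. -/
def semiToSuper : Semisimplification Φ ⥤ SVec Φ :=
  CategoryTheory.Quotient.lift (negligibleRel Φ) toSuper fun _ _ f g h =>
    (semisimplify_map_eq_iff f g).mp (CategoryTheory.Quotient.sound _ h)

instance : (semiToSuper Φ).Additive where
  map_add := by
    rintro _ _ ⟨f⟩ ⟨g⟩
    exact toSuper_map_add f g

instance : (semiToSuper Φ).Linear Φ where
  map_smul := by
    rintro _ _ ⟨f⟩ r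
    exact toSuper_map_smul r f

instance : (semiToSuper Φ).Faithful where
  map_injective := by
    rintro _ _ ⟨f⟩ ⟨g⟩ h
    exact (semisimplify_map_eq_iff f g).mpr h

instance : (semiToSuper Φ).Full where
  map_surjective {X Y} φ := by
    obtain ⟨f, hf⟩ := (toSuper (Φ := Φ)).map_surjective (X := X.as) (Y := Y.as) φ
    exact ⟨(semisimplify Φ).map f, hf⟩

instance : (semiToSuper Φ).EssSurj where
  mem_essImage A := ⟨(semisimplify Φ).obj ((toSuper (Φ := Φ)).objPreimage A),
    ⟨(toSuper (Φ := Φ)).objObjPreimageIso A⟩⟩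

instance : (semiToSuper Φ).IsEquivalence where

variable (Φ) in
/-- The unit of the monoidal structure on `semiToSuper`. -/
def superUnitIso : 𝟙_ (SVec Φ) ≅ toSuper.obj (𝟙_ (RepAlpha Φ)) :=
  SVec.isoMk (X := 𝟙_ (SVec Φ)) (Y := toSuper.obj (𝟙_ (RepAlpha Φ)))
    (LinearEquiv.ofBijective (superUnit Φ) superUnit_bijective) (LinearMap.ext fun _ => rfl)

/-- The tensorator of `semiToSuper`. -/
def superMulIso (X Y : RepAlpha Φ) : toSuper.obj X ⊗ toSuper.obj Y ≅ toSuper.obj (X ⊗ Y) :=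
  SVec.isoMk (X := toSuper.obj X ⊗ toSuper.obj Y) (Y := toSuper.obj (X ⊗ Y))
    (LinearEquiv.ofBijective (superMul X.d Y.d) (superMul_bijective X Y)) superMul_tensorOdd

theorem superMulIso_natural {X Y X' Y' : RepAlpha Φ} (f : X ⟶ X') (g : Y ⟶ Y') :
    (toSuper.map f ⊗ₘ toSuper.map g) ≫ (superMulIso X' Y').hom =
      (superMulIso X Y).hom ≫ toSuper.map (f ⊗ₘ g) :=
  SVec.hom_ext (superMul_natural f.comm g.comm)

theorem superMulIso_associativity (X Y Z : RepAlpha Φ) :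
    (superMulIso X Y).hom ▷ toSuper.obj Z ≫ (superMulIso (X ⊗ Y) Z).hom ≫
        toSuper.map (α_ X Y Z).hom =
      (α_ (toSuper.obj X) (toSuper.obj Y) (toSuper.obj Z)).hom ≫
        toSuper.obj X ◁ (superMulIso Y Z).hom ≫ (superMulIso X (Y ⊗ Z)).hom :=
  SVec.hom_ext (superMul_assoc (a := X.d) (b := Y.d) (c := Z.d))

theorem superMulIso_left_unitality (X : RepAlpha Φ) : (λ_ (toSuper.obj X)).hom =
    (superUnitIso Φ).hom ▷ toSuper.obj X ≫ (superMulIso (𝟙_ (RepAlpha Φ)) X).hom ≫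
      toSuper.map (λ_ X).hom :=
  SVec.hom_ext (superMul_lid (b := X.d)).symm

theorem superMulIso_right_unitality (X : RepAlpha Φ) : (ρ_ (toSuper.obj X)).hom =
    toSuper.obj X ◁ (superUnitIso Φ).hom ≫ (superMulIso X (𝟙_ (RepAlpha Φ))).hom ≫
      toSuper.map (ρ_ X).hom :=
  SVec.hom_ext (superMul_rid (b := X.d)).symm

variable (Φ) in
/-- The monoidal structure on `semiToSuper` given by `superMul`. -/
def semiToSuperCore : (semiToSuper Φ).CoreMonoidal where
  εIso := superUnitIso Φ
  μIso X Y := superMulIso X.as Y.as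
  μIso_hom_natural_left := by
    rintro _ _ ⟨f⟩ X'
    have h := superMulIso_natural f (𝟙 X'.as)
    rw [CategoryTheory.Functor.map_id, tensorHom_id, tensorHom_id] at h
    exact h
  μIso_hom_natural_right := by
    rintro _ _ X' ⟨f⟩
    have h := superMulIso_natural (𝟙 X'.as) f
    rw [CategoryTheory.Functor.map_id, id_tensorHom, id_tensorHom] at h
    exact h
  associativity X Y Z := superMulIso_associativity X.as Y.as Z.as
  left_unitality X := superMulIso_left_unitality X.as
  right_unitality X := superMulIso_right_unitality X.as

instance : (semiToSuper Φ).Monoidal := (semiToSuperCore Φ).toMonoidal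

theorem semiToSuper_μ (X Y : Semisimplification Φ) :
    Functor.LaxMonoidal.μ (semiToSuper Φ) X Y = (superMulIso X.as Y.as).hom := rfl

/-- The tensorator is compatible with the flip of `Rep(α₃)` and the sign rule. -/
instance : (semiToSuper Φ).Braided where
  braided X Y := by
    rw [semiToSuper_μ, semiToSuper_μ]
    exact SVec.hom_ext superMul_comm

end Equivalence

/-! ### Isomorphisms of superalgebras -/

theorem AlgebraIn.Isomorphic.symm {C : Type*} [Category C] [MonoidalCategory C]
    {A B : AlgebraIn C} (h : A.Isomorphic B) : B.Isomorphic A := by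
  obtain ⟨φ, h⟩ := h
  refine ⟨φ.symm, ?_⟩
  rw [Iso.symm_hom, Iso.comp_inv_eq, Category.assoc, h, ← Category.assoc,
    tensorHom_comp_tensorHom, Iso.inv_hom_id, id_tensorHom_id, Category.id_comp]

theorem AlgebraIn.Isomorphic.trans {C : Type*} [Category C] [MonoidalCategory C]
    {A B D : AlgebraIn C} (h : A.Isomorphic B) (h' : B.Isomorphic D) : A.Isomorphic D := by
  obtain ⟨φ, h⟩ := h
  obtain ⟨ψ, h'⟩ := h'
  refine ⟨φ ≪≫ ψ, ?_⟩
  rw [Iso.trans_hom, ← Category.assoc, h, Category.assoc, h', ← Category.assoc,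
    tensorHom_comp_tensorHom]

section superalgebra

variable {Φ : Type u} [Field Φ] {A₀ A₁ B₀ B₁ : Type u} [AddCommGroup A₀] [Module Φ A₀]
  [AddCommGroup A₁] [Module Φ A₁] [AddCommGroup B₀] [Module Φ B₀] [AddCommGroup B₁] [Module Φ B₁]
  [Module.Finite Φ A₀] [Module.Finite Φ A₁] [Module.Finite Φ B₀] [Module.Finite Φ B₁]
  {a₀₀ : A₀ →ₗ[Φ] A₀ →ₗ[Φ] A₀} {a₀₁ : A₀ →ₗ[Φ] A₁ →ₗ[Φ] A₁} {a₁₁ : A₁ →ₗ[Φ] A₁ →ₗ[Φ] A₀}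
  {b₀₀ : B₀ →ₗ[Φ] B₀ →ₗ[Φ] B₀} {b₀₁ : B₀ →ₗ[Φ] B₁ →ₗ[Φ] B₁} {b₁₁ : B₁ →ₗ[Φ] B₁ →ₗ[Φ] B₀}

theorem superalgebra_isomorphic (e₀ : A₀ ≃ₗ[Φ] B₀) (e₁ : A₁ ≃ₗ[Φ] B₁)
    (h₀₀ : ∀ x y, e₀ (a₀₀ x y) = b₀₀ (e₀ x) (e₀ y))
    (h₀₁ : ∀ x y, e₁ (a₀₁ x y) = b₀₁ (e₀ x) (e₁ y))
    (h₁₁ : ∀ x y, e₀ (a₁₁ x y) = b₁₁ (e₁ x) (e₁ y)) :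
    (superalgebra a₀₀ a₀₁ a₁₁).Isomorphic (superalgebra b₀₀ b₀₁ b₁₁) := by
  refine ⟨SVec.isoMk (X := (superalgebra a₀₀ a₀₁ a₁₁).obj) (Y := (superalgebra b₀₀ b₀₁ b₁₁).obj)
    (e₀.prodCongr e₁) (LinearMap.ext fun x => Prod.ext (map_zero e₀) rfl), ?_⟩
  refine SVec.hom_ext (TensorProduct.ext' ?_)
  rintro ⟨x, y⟩ ⟨x', y'⟩
  change (e₀ (a₀₀ x x' + a₁₁ y y'), e₁ (a₀₁ x y' - a₀₁ x' y)) =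
    (b₀₀ (e₀ x) (e₀ x') + b₁₁ (e₁ y) (e₁ y'), b₀₁ (e₀ x) (e₁ y') - b₀₁ (e₀ x') (e₁ y))
  rw [map_add, map_sub, h₀₀, h₀₁, h₀₁, h₁₁]

end superalgebra

/-! ### The contact superalgebra -/

section Contact

variable {Φ : Type u} [Field Φ] [CharP Φ 3] {n : ℕ}

theorem contactEven_apply (f : DP Φ n) (F : DP Φ n × DP Φ n) : contactEven f F =
    (-(f * DP.partialD Φ n F.1), DP.partialD Φ n f * F.2 - f * DP.partialD Φ n F.2) := by
  have h3 := Frank.three_eq_zero (Φ := Φ) (n := n)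
  refine Prod.ext ?_ ?_
  · change 2 * f * DP.partialD Φ n F.1 + 0 * F.2 = -(f * DP.partialD Φ n F.1)
    linear_combination f * DP.partialD Φ n F.1 * h3
  · change 2 * f * DP.partialD Φ n F.2 + 0 * DP.partialD Φ n F.1 + DP.partialD Φ n f * F.2 =
      DP.partialD Φ n f * F.2 - f * DP.partialD Φ n F.2
    linear_combination f * DP.partialD Φ n F.2 * h3

theorem contactOdd_apply (g : DP Φ n) (F : DP Φ n × DP Φ n) :
    contactOdd g F = (g * F.2, g * DP.partialD Φ n F.1) := by
  simp [contactOdd, superDer]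

variable (Φ n) in
/-- `D_K` on the even elements, as a linear map. -/
def contactEvenLin : DP Φ n →ₗ[Φ] Module.End Φ (DP Φ n × DP Φ n) where
  toFun := contactEven
  map_add' f g := LinearMap.ext fun F => by
    ext1 <;> simp [contactEven_apply] <;> ring
  map_smul' c f := LinearMap.ext fun F => by
    ext1 <;> simp [contactEven_apply, smul_sub]

variable (Φ n) in
/-- `D_K` on the odd elements, as a linear map. -/
def contactOddLin : DP Φ n →ₗ[Φ] Module.End Φ (DP Φ n × DP Φ n) where
  toFun := contactOdd
  map_add' f g := LinearMap.ext fun F => by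
    ext1 <;> simp [contactOdd_apply] <;> ring
  map_smul' c f := LinearMap.ext fun F => by
    ext1 <;> simp [contactOdd_apply]

@[simp] theorem contactEvenLin_apply (f : DP Φ n) : contactEvenLin Φ n f = contactEven f := rfl
theorem contactEven_lie_contactEven (f g : DP Φ n) :
    contactEven f * contactEven g - contactEven g * contactEven f =
      contactEven (-wittBr Φ n f g) := by
  refine LinearMap.ext fun F => Prod.ext ?_ ?_ <;>
  · simp only [LinearMap.sub_apply, Module.End.mul_apply, contactEven_apply, Prod.fst_sub,
      Prod.snd_sub, wittBr_apply, map_neg, map_sub, Derivation.leibniz, smul_eq_mul]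
    ring

theorem contactEven_lie_contactOdd (f g : DP Φ n) :
    contactEven f * contactOdd g - contactOdd g * contactEven f =
      contactOdd (-divAct Φ n f g) := by
  have h3 := Frank.three_eq_zero (Φ := Φ) (n := n)
  refine LinearMap.ext fun F => Prod.ext ?_ ?_ <;>
    simp only [LinearMap.sub_apply, Module.End.mul_apply, contactEven_apply, contactOdd_apply,
      Prod.fst_sub, Prod.snd_sub, divAct_apply, map_neg, Derivation.leibniz, smul_eq_mul]
  · ring
  · linear_combination g * DP.partialD Φ n f * DP.partialD Φ n F.1 * h3

theorem contactOdd_lie_contactOdd (f g : DP Φ n) :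
    contactOdd f * contactOdd g + contactOdd g * contactOdd f = contactEven (f * g) := by
  have h3 := Frank.three_eq_zero (Φ := Φ) (n := n)
  refine LinearMap.ext fun F => Prod.ext ?_ ?_ <;>
    simp only [LinearMap.add_apply, Module.End.mul_apply, contactEven_apply, contactOdd_apply,
      Prod.fst_add, Prod.snd_add, Derivation.leibniz, smul_eq_mul]
  · linear_combination f * g * DP.partialD Φ n F.1 * h3
  · linear_combination f * g * DP.partialD Φ n F.2 * h3

theorem ContactMem.exists_eq {s : Bool} {A : Module.End Φ (DP Φ n × DP Φ n)}
    (hA : ContactMem Φ n s A) : ∃ f, A = if s then contactOdd f else contactEven f := by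
  induction hA with
  | even f => exact ⟨f, rfl⟩
  | odd g => exact ⟨g, rfl⟩
  | zero s => cases s
              · exact ⟨0, (map_zero (contactEvenLin Φ n)).symm⟩
              · exact ⟨0, (map_zero (contactOddLin Φ n)).symm⟩
  | @add s A B _ _ hA hB =>
    obtain ⟨f, rfl⟩ := hA
    obtain ⟨g, rfl⟩ := hB
    cases s
    · exact ⟨f + g, (map_add (contactEvenLin Φ n) f g).symm⟩
    · exact ⟨f + g, (map_add (contactOddLin Φ n) f g).symm⟩
  | @smul s c A _ hA =>
    obtain ⟨f, rfl⟩ := hA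
    cases s
    · exact ⟨c • f, (map_smul (contactEvenLin Φ n) c f).symm⟩
    · exact ⟨c • f, (map_smul (contactOddLin Φ n) c f).symm⟩
  | lie_even_even _ _ hA hB =>
    obtain ⟨f, rfl⟩ := hA
    obtain ⟨g, rfl⟩ := hB
    exact ⟨_, contactEven_lie_contactEven f g⟩
  | lie_even_odd _ _ hA hB =>
    obtain ⟨f, rfl⟩ := hA
    obtain ⟨g, rfl⟩ := hB
    exact ⟨_, contactEven_lie_contactOdd f g⟩
  | lie_odd_odd _ _ hA hB =>
    obtain ⟨f, rfl⟩ := hA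
    obtain ⟨g, rfl⟩ := hB
    exact ⟨_, contactOdd_lie_contactOdd f g⟩

theorem partialD_x_one (hn : 1 ≤ n) : DP.partialD Φ n (DP.x Φ n 1) = 1 :=
  DP.partialLin_x_succ (k := 0) (Nat.one_lt_pow (by omega) (by norm_num))

variable (Φ) in
/-- The element `f ∂` of `W(1; n)` corresponds to `D_K(-f)`, as `2 = -1`. -/
def contactEvenEquiv (hn : 1 ≤ n) : DP Φ n ≃ₗ[Φ] contactPart Φ n false :=
  LinearEquiv.ofBijective ((contactEvenLin Φ n ∘ₗ (-LinearMap.id)).codRestrict (contactPart Φ n false)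
      fun f => ContactMem.even (-f)) <| by
    constructor
    · rw [injective_iff_map_eq_zero]
      intro f hf
      have h1 : contactEven (-f) = 0 := congrArg Subtype.val hf
      have h2 := congrArg Prod.fst (LinearMap.congr_fun h1 (DP.x Φ n 1, 0))
      simpa [contactEven_apply, partialD_x_one hn] using h2
    · rintro ⟨A, hA⟩
      obtain ⟨f, rfl⟩ := hA.exists_eq
      exact ⟨-f, Subtype.ext (by simp)⟩

variable (Φ n) in
/-- The element `g` of `𝒪_(div)` corresponds to `D_K(g θ)`. -/
def contactOddEquiv : DP Φ n ≃ₗ[Φ] contactPart Φ n true :=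
  LinearEquiv.ofBijective ((contactOddLin Φ n).codRestrict (contactPart Φ n true) ContactMem.odd)
    <| by
    constructor
    · rw [injective_iff_map_eq_zero]
      intro f hf
      have h1 : contactOdd f = 0 := congrArg Subtype.val hf
      have h2 := congrArg Prod.fst (LinearMap.congr_fun h1 (0, 1))
      simpa [contactOdd_apply] using h2
    · rintro ⟨A, hA⟩
      obtain ⟨f, rfl⟩ := hA.exists_eq
      exact ⟨f, rfl⟩

theorem wittDivAlgebra_isomorphic_contactAlgebra (hn : 1 ≤ n) :
    (wittDivAlgebra Φ n).Isomorphic (contactAlgebra Φ n) := by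
  refine superalgebra_isomorphic (contactEvenEquiv Φ hn) (contactOddEquiv Φ n)
    (fun f g => Subtype.ext ?_) (fun f g => Subtype.ext ?_) fun f g => Subtype.ext ?_
  · change contactEven (-wittBr Φ n f g) = contactEven (-f) * contactEven (-g) -
      contactEven (-g) * contactEven (-f)
    rw [contactEven_lie_contactEven, map_neg (wittBr Φ n (-f)), map_neg, LinearMap.neg_apply,
      neg_neg]
  · change contactOdd (divAct Φ n f g) = contactEven (-f) * contactOdd g -
      contactOdd g * contactEven (-f)
    rw [contactEven_lie_contactOdd, map_neg, LinearMap.neg_apply, neg_neg]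
  · change contactEven (-(-(f * g))) = contactOdd f * contactOdd g + contactOdd g * contactOdd f
    rw [contactOdd_lie_contactOdd, neg_neg]

end Contact

/-! ### Rescaling the product of odd elements -/

section Scaling

variable {Φ : Type u} [Field Φ] {n : ℕ}

/-- The linear map `x⁽ⁱ⁾ ↦ cⁱ x⁽ⁱ⁾`. -/
def dpScale (c : Φ) : DP Φ n →ₗ[Φ] DP Φ n :=
  (DP.basis Φ n).constr Φ fun i => c ^ (i : ℕ) • DP.x Φ n i

theorem dpScale_x (c : Φ) (k : ℕ) : dpScale c (DP.x Φ n k) = c ^ k • DP.x Φ n k := by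
  by_cases hk : k < 3 ^ n
  · have h := DP.basis_eq (Φ := Φ) (n := n) ⟨k, hk⟩
    simp only at h
    conv_lhs => rw [← h, dpScale, Module.Basis.constr_basis]
  · rw [DP.x_of_le (by omega), map_zero, smul_zero]

theorem dpScale_mul (c : Φ) (f g : DP Φ n) : dpScale c (f * g) = dpScale c f * dpScale c g := by
  induction f using DP.induction with
  | hx i hi =>
    induction g using DP.induction with
    | hx j hj =>
      simp only [DP.x_mul_x, map_smul, dpScale_x, DP.smul_mul, DP.mul_smul, smul_smul]
      congr 1; ring
    | h0 => simp
    | hadd a b ha hb => rw [mul_add, map_add, map_add, mul_add, ha, hb]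
    | hsmul r a ha => rw [DP.mul_smul, map_smul, map_smul, DP.mul_smul, ha]
  | h0 => simp
  | hadd a b ha hb => rw [add_mul, map_add, map_add, add_mul, ha, hb]
  | hsmul r a ha => rw [DP.smul_mul, map_smul, map_smul, DP.smul_mul, ha]

theorem dpScale_dpScale_inv {c : Φ} (hc : c ≠ 0) (f : DP Φ n) : dpScale c (dpScale c⁻¹ f) = f := by
  induction f using DP.induction with
  | hx i hi => rw [dpScale_x, map_smul, dpScale_x, smul_smul, ← mul_pow, inv_mul_cancel₀ hc,
      one_pow, one_smul]
  | h0 => simp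
  | hadd a b ha hb => rw [map_add, map_add, ha, hb]
  | hsmul r a ha => rw [map_smul, map_smul, ha]

variable (n) in
/-- The linear automorphism `x⁽ⁱ⁾ ↦ cⁱ x⁽ⁱ⁾`. -/
def dpScaleEquiv {c : Φ} (hc : c ≠ 0) : DP Φ n ≃ₗ[Φ] DP Φ n :=
  LinearEquiv.ofLinearMap (dpScale c) (dpScale c⁻¹)
    (LinearMap.ext fun f => by
      rw [LinearMap.comp_apply, LinearMap.id_apply, dpScale_dpScale_inv hc])
    (LinearMap.ext fun f => by
      have h := dpScale_dpScale_inv (inv_ne_zero hc) f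
      rwa [inv_inv] at h)

theorem dpScaleEquiv_apply {c : Φ} (hc : c ≠ 0) (f : DP Φ n) :
    dpScaleEquiv n hc f = dpScale c f := rfl

variable [CharP Φ 3]

theorem dpScale_partialD (c : Φ) (f : DP Φ n) :
    c • dpScale c (DP.partialD Φ n f) = DP.partialD Φ n (dpScale c f) := by
  induction f using DP.induction with
  | hx i hi =>
    rw [dpScale_x, Derivation.map_smul]
    rcases i with _ | i
    · have h : DP.partialD Φ n (DP.x Φ n 0) = 0 := DP.partialLin_x_zero
      rw [h, map_zero, smul_zero, smul_zero]
    · have h : DP.partialD Φ n (DP.x Φ n (i + 1)) = DP.x Φ n i := DP.partialLin_x_succ hi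
      rw [h, dpScale_x, smul_smul, pow_succ']
  | h0 => simp
  | hadd a b ha hb => rw [map_add, map_add, map_add, map_add, smul_add, ha, hb]
  | hsmul r a ha => rw [Derivation.map_smul, map_smul, map_smul, Derivation.map_smul, smul_comm, ha]

/-- The automorphism `x⁽ⁱ⁾ ↦ cⁱ x⁽ⁱ⁾` of `𝒪(1; n)` carries `∂` to `c⁻¹ ∂`. Hence the superalgebras
with the product `[x, y] = κ x y ∂` of odd elements are isomorphic for all `κ ≠ 0`, although `κ`
need not be a square in `Φ`. -/
theorem superalgebra_isomorphic_wittDivAlgebra {κ : Φ} (hκ : κ ≠ 0) :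
    (superalgebra (wittBr Φ n) (divAct Φ n) (κ • LinearMap.mul Φ (DP Φ n))).Isomorphic
      (wittDivAlgebra Φ n) := by
  have hc : -κ ≠ 0 := neg_ne_zero.mpr hκ
  have hD : ∀ f : DP Φ n, DP.partialD Φ n (dpScale (-κ) f) =
      (-κ) • dpScale (-κ) (DP.partialD Φ n f) := fun f => (dpScale_partialD _ f).symm
  refine superalgebra_isomorphic
    ((dpScaleEquiv n hc).trans (LinearEquiv.smulOfNeZero Φ (DP Φ n) _ (inv_ne_zero hc)))
    (dpScaleEquiv n hc) (fun f g => ?_) (fun f g => ?_) fun f g => ?_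
  · simp only [LinearEquiv.trans_apply, LinearEquiv.smulOfNeZero_apply, dpScaleEquiv_apply,
      wittBr_apply, map_sub, dpScale_mul, Derivation.map_smul, hD, smul_smul, smul_mul_assoc,
      inv_mul_cancel₀ hc, one_smul]
  · simp only [LinearEquiv.trans_apply, LinearEquiv.smulOfNeZero_apply, dpScaleEquiv_apply,
      divAct_apply, smul_mul_assoc, Derivation.map_smul, ← dpScale_mul, hD, smul_smul,
      inv_mul_cancel₀ hc, one_smul]
  · change (-κ)⁻¹ • dpScale (-κ) (κ • (f * g)) = -(dpScale (-κ) f * dpScale (-κ) g)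
    rw [map_smul, smul_smul, dpScale_mul, inv_neg, neg_mul, inv_mul_cancel₀ hκ, neg_one_smul]

end Scaling

/-! ### The operator `ad (e ⊗ 1)` on the Frank algebra -/

section FrankOperator

attribute [local instance] LieRing.ofAssociativeRing

section tmul_one

variable {Φ U : Type u} [Field Φ] [AddCommGroup U] [Module Φ U] (n : ℕ) (e : sl Φ U)

/-- On `𝔰𝔩(U) ⊗ 𝒪` the operator `ad (e ⊗ 1)` is `ad e ⊗ 1`. -/
theorem slBr_tmul_one (t : sl Φ U ⊗[Φ] DP Φ n) :
    Frank.slBr n (e ⊗ₜ[Φ] 1) t = (LieModule.toEnd Φ (sl Φ U) (sl Φ U) e).rTensor (DP Φ n) t := by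
  induction t using TensorProduct.induction_on with
  | zero => simp
  | tmul b g => exact congrArg (⁅e, b⁆ ⊗ₜ[Φ] ·) (one_mul g)
  | add x y hx hy => rw [map_add, map_add, hx, hy]

/-- On `U ⊗ 𝒪_(div)` the operator `ad (e ⊗ 1)` is `e ⊗ 1`. -/
theorem slU_tmul_one (t : U ⊗[Φ] DP Φ n) :
    Frank.slU n (e ⊗ₜ[Φ] 1) t = (e : Module.End Φ U).rTensor (DP Φ n) t := by
  induction t using TensorProduct.induction_on with
  | zero => simp
  | tmul b g => exact congrArg ((e : Module.End Φ U) b ⊗ₜ[Φ] ·) (one_mul g)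
  | add x y hx hy => rw [map_add, map_add, hx, hy]

end tmul_one

variable {Φ U : Type u} [Field Φ] [CharP Φ 3] [AddCommGroup U] [Module Φ U]

/-- Vectors `w = e v ≠ 0` and `v`, and an element `f` of `𝔰𝔩(U)` with `f w = v` and `f v = 0`; thus
`e` and `f` are the nilpotent elements of an `𝔰𝔩₂`-triple. -/
structure SlFrame (S : SymplecticPlane Φ U) (e : sl Φ U) where
  v : U
  w : U
  f : sl Φ U
  e_v : (e : Module.End Φ U) v = w
  e_w : (e : Module.End Φ U) w = 0
  f_v : (f : Module.End Φ U) v = 0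
  f_w : (f : Module.End Φ U) w = v
  form_ne : S.form w v ≠ 0

theorem SlFrame.nonempty (S : SymplecticPlane Φ U) (e : sl Φ U)
    (he : IsNilpotent (e : Module.End Φ U)) (h0 : e ≠ 0) : Nonempty (SlFrame S e) := by
  have hfin := S.finite
  have hv : ∃ v, (e : Module.End Φ U) v ≠ 0 := by
    by_contra! h
    exact h0 (Subtype.ext (LinearMap.ext h))
  obtain ⟨v, hv⟩ := hv
  have hee : ∀ x, (e : Module.End Φ U) ((e : Module.End Φ U) x) = 0 :=
    LinearMap.congr_fun (sq_eq_zero S e he)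
  set w := (e : Module.End Φ U) v with hw
  have hκ : S.form w v ≠ 0 := by
    intro hκ
    refine hv (S.nondegenerate w fun u => ?_)
    have h := congrArg (e : Module.End Φ U) (Frank.form_cyc S w v u)
    rw [hκ, zero_smul, zero_add, map_add, map_smul, map_smul, hee v, smul_zero, zero_add, map_zero,
      ← hw] at h
    -- `w` is orthogonal to every `u`
    rw [S.skew, (smul_eq_zero.mp h).resolve_right hv, neg_zero]
  -- `f u = λ(u, v) / λ(w, v) • v`
  refine ⟨⟨v, w, ⟨((S.form w v)⁻¹ • S.form.flip v).smulRight v, ?_⟩, rfl, hee v, ?_, ?_, hκ⟩⟩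
  · change LinearMap.trace Φ U _ = 0
    rw [LinearMap.trace_smulRight]
    simp [S.form_self]
  · simp [S.form_self]
  · simp [hκ]

namespace SlFrame

variable {S : SymplecticPlane Φ U} {e : sl Φ U} (F : SlFrame S e)

/-- The coordinates of a vector with respect to `w` and `v`. -/
theorem smul_eq (u : U) : S.form F.w F.v • u = S.form u F.v • F.w + S.form F.w u • F.v := by
  have h := Frank.form_cyc S F.w F.v u
  rw [S.skew F.v u, S.skew u F.w] at h
  linear_combination (norm := module) h

theorem end_ext {M : Type*} [AddCommGroup M] [Module Φ M] {a b : U →ₗ[Φ] M} (hv : a F.v = b F.v)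
    (hw : a F.w = b F.w) : a = b := by
  ext u
  have h : S.form F.w F.v • a u = S.form F.w F.v • b u := by
    rw [← map_smul, ← map_smul, F.smul_eq, map_add, map_add, map_smul, map_smul, map_smul, map_smul,
      hv, hw]
  exact smul_right_injective M F.form_ne h

/-- As an `e`-module, `U` is a Jordan block of size two. -/
theorem e_f_add_f_e : (e : Module.End Φ U) ∘ₗ (F.f : Module.End Φ U) +
    (F.f : Module.End Φ U) ∘ₗ (e : Module.End Φ U) = LinearMap.id := by
  apply F.end_ext <;> simp [F.e_v, F.e_w, F.f_v, F.f_w]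

/-- As an `ad e`-module, `𝔰𝔩(U)` is a Jordan block of size three: with `h = (ad f)²` and `D = ad e`,
the map `D² h + D h D + h D²` is the identity. -/
theorem lie_sum_eq (a : sl Φ U) : ⁅e, ⁅e, ⁅F.f, ⁅F.f, a⁆⁆⁆⁆ + ⁅e, ⁅F.f, ⁅F.f, ⁅e, a⁆⁆⁆⁆ +
    ⁅F.f, ⁅F.f, ⁅e, ⁅e, a⁆⁆⁆⁆ = a := by
  have h3 : (3 : Φ) = 0 := CharP.cast_eq_zero Φ 3
  have lie_apply : ∀ (x y : sl Φ U) (u : U), ((⁅x, y⁆ : sl Φ U) : Module.End Φ U) u =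
      (x : Module.End Φ U) ((y : Module.End Φ U) u) -
        (y : Module.End Φ U) ((x : Module.End Φ U) u) := fun _ _ _ => rfl
  have coord : ∀ u, ∃ p q : Φ, u = p • F.w + q • F.v := fun u => by
    refine ⟨(S.form F.w F.v)⁻¹ * S.form u F.v, (S.form F.w F.v)⁻¹ * S.form F.w u, ?_⟩
    rw [mul_smul, mul_smul, ← smul_add, ← F.smul_eq, inv_smul_smul₀ F.form_ne]
  obtain ⟨p, q, hw⟩ := coord ((a : Module.End Φ U) F.w)
  obtain ⟨r, s, hv⟩ := coord ((a : Module.End Φ U) F.v)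
  have hps : s = -p := by
    have h := Frank.form_invariant S a F.w F.v
    rw [hw, hv] at h
    simp only [map_add, map_smul, LinearMap.add_apply, LinearMap.smul_apply, S.form_self,
      smul_eq_mul] at h
    have h' : (s + p) * S.form F.w F.v = 0 := by linear_combination h
    exact eq_neg_of_add_eq_zero_left ((mul_eq_zero.mp h').resolve_right F.form_ne)
  subst hps
  refine Subtype.ext (F.end_ext ?_ ?_)
  · change ((⁅e, ⁅e, ⁅F.f, ⁅F.f, a⁆⁆⁆⁆ : sl Φ U) : Module.End Φ U) F.v +
      ((⁅e, ⁅F.f, ⁅F.f, ⁅e, a⁆⁆⁆⁆ : sl Φ U) : Module.End Φ U) F.v +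
      ((⁅F.f, ⁅F.f, ⁅e, ⁅e, a⁆⁆⁆⁆ : sl Φ U) : Module.End Φ U) F.v = (a : Module.End Φ U) F.v
    simp only [lie_apply, F.e_v, F.e_w, F.f_v, F.f_w, hw, hv, map_sub, map_add, map_smul, map_zero,
      smul_zero]
    linear_combination (norm := module) h3 • (r • F.w - p • F.v)
  · change ((⁅e, ⁅e, ⁅F.f, ⁅F.f, a⁆⁆⁆⁆ : sl Φ U) : Module.End Φ U) F.w +
      ((⁅e, ⁅F.f, ⁅F.f, ⁅e, a⁆⁆⁆⁆ : sl Φ U) : Module.End Φ U) F.w +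
      ((⁅F.f, ⁅F.f, ⁅e, ⁅e, a⁆⁆⁆⁆ : sl Φ U) : Module.End Φ U) F.w = (a : Module.End Φ U) F.w
    simp only [lie_apply, F.e_v, F.e_w, F.f_v, F.f_w, hw, hv, map_sub, map_add, map_smul, map_zero,
      smul_zero]
    linear_combination (norm := module) h3 • (p • F.w + q • F.v)

theorem e_e (F : SlFrame S e) : (e : Module.End Φ U) ∘ₗ (e : Module.End Φ U) = 0 := by
  apply F.end_ext <;> simp [F.e_v, F.e_w]

end SlFrame

variable (S : SymplecticPlane Φ U) {n : ℕ} (e : sl Φ U)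

theorem frankD_fst (X : Frank S n) :
    (frankD S n e X).1 = (e : Module.End Φ U).rTensor (DP Φ n) X.1 := by
  simp [frankD_apply, slU_tmul_one]

theorem frankD_snd_fst (X : Frank S n) :
    (frankD S n e X).2.1 = (LieModule.toEnd Φ (sl Φ U) (sl Φ U) e).rTensor (DP Φ n) X.2.1 := by
  simp [frankD_apply, slBr_tmul_one]

theorem frankD_snd_snd (X : Frank S n) : (frankD S n e X).2.2 = 0 := by
  simp [frankD_apply]

theorem frankD_inW (f : DP Φ n) : frankD S n e (Frank.inW S n f) = 0 := by
  ext <;> simp [frankD_fst, frankD_snd_fst, frankD_snd_snd]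

theorem frankD_inU (u : U) (g : DP Φ n) : frankD S n e (Frank.inU S n (u ⊗ₜ g)) =
    Frank.inU S n ((e : Module.End Φ U) u ⊗ₜ g) := by
  ext <;> simp [frankD_fst, frankD_snd_fst, frankD_snd_snd]

namespace SlFrame

variable {S e} (F : SlFrame S e)

theorem rTensor_e_e (F : SlFrame S e) (t : U ⊗[Φ] DP Φ n) : (e : Module.End Φ U).rTensor (DP Φ n)
    ((e : Module.End Φ U).rTensor (DP Φ n) t) = 0 := by
  rw [← LinearMap.comp_apply, ← LinearMap.rTensor_comp, F.e_e, LinearMap.rTensor_zero,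
    LinearMap.zero_apply]

theorem rTensor_e_f (t : U ⊗[Φ] DP Φ n) :
    (e : Module.End Φ U).rTensor (DP Φ n) ((F.f : Module.End Φ U).rTensor (DP Φ n) t) +
      (F.f : Module.End Φ U).rTensor (DP Φ n) ((e : Module.End Φ U).rTensor (DP Φ n) t) = t := by
  have h := LinearMap.congr_fun (congrArg (LinearMap.rTensor (DP Φ n)) F.e_f_add_f_e) t
  rwa [LinearMap.rTensor_add, LinearMap.rTensor_comp, LinearMap.rTensor_comp,
    LinearMap.rTensor_id] at h

/-- The operator `(ad f)² ⊗ 1` on `𝔰𝔩(U) ⊗ 𝒪`. -/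
def adSq (n : ℕ) : Module.End Φ (sl Φ U ⊗[Φ] DP Φ n) :=
  (LieModule.toEnd Φ (sl Φ U) (sl Φ U) F.f ∘ₗ
    LieModule.toEnd Φ (sl Φ U) (sl Φ U) F.f).rTensor (DP Φ n)

theorem adSq_eq (t : sl Φ U ⊗[Φ] DP Φ n) :
    let D := (LieModule.toEnd Φ (sl Φ U) (sl Φ U) e).rTensor (DP Φ n)
    D (D (F.adSq n t)) + D (F.adSq n (D t)) + F.adSq n (D (D t)) = t := by
  intro D
  induction t using TensorProduct.induction_on with
  | zero => simp
  | tmul b g =>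
    simp only [D, adSq, LinearMap.rTensor_tmul, LinearMap.comp_apply, LieModule.toEnd_apply_apply,
      ← TensorProduct.add_tmul, F.lie_sum_eq]
  | add x y hx hy =>
    simp only [map_add]
    linear_combination (norm := abel) hx + hy

variable (n)

/-- The map from `W` to the even part of `ℱ(n)` that sends `f ∂` to its class. -/
def evLin : DP Φ n →ₗ[Φ] Ev (frankD S n e) :=
  Subquot.lin (Frank.inW S n) (frankD_inW S e)

/-- The map from `𝒪_(div)` to the odd part of `ℱ(n)` that sends `g` to the class of `v ⊗ g`. -/
def odLin : DP Φ n →ₗ[Φ] Od (frankD S n e) :=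
  Subquot.lin (Frank.inU S n ∘ₗ TensorProduct.mk Φ U (DP Φ n) F.v) fun g => by
    change frankD S n e (frankD S n e (Frank.inU S n (F.v ⊗ₜ g))) = 0
    rw [frankD_inU, frankD_inU, F.e_v, F.e_w, TensorProduct.zero_tmul, map_zero]

variable {n}

/-- The even part is `W`: the kernels of `d` on `U ⊗ 𝒪_(div)` and on `𝔰𝔩(U) ⊗ 𝒪` consist of values
of `d`, by `rTensor_e_f` and `adSq_eq`. -/
theorem evLin_bijective (F : SlFrame S e) :
    Function.Bijective (evLin n : DP Φ n →ₗ[Φ] Ev (frankD S n e)) := by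
  constructor
  · rw [injective_iff_map_eq_zero]
    intro f hf
    obtain ⟨z, hz⟩ := evCls_eq_zero.mp hf
    have h := congrArg (fun X : Frank S n => X.2.2) hz
    simpa [frankD_snd_snd] using h.symm
  · intro t
    induction t using Subquot.induction with
    | h X hX =>
      have h1 : (e : Module.End Φ U).rTensor (DP Φ n) X.1 = 0 := by
        rw [← frankD_fst, LinearMap.mem_ker.mp hX]; rfl
      have h2 : (LieModule.toEnd Φ (sl Φ U) (sl Φ U) e).rTensor (DP Φ n) X.2.1 = 0 := by
        rw [← frankD_snd_fst, LinearMap.mem_ker.mp hX]; rfl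
      refine ⟨X.2.2, (evCls_eq (hx := hX) (hy := frankD_inW S e _)
        (Frank.inU S n ((F.f : Module.End Φ U).rTensor (DP Φ n) X.1) + Frank.inSl S n
          ((LieModule.toEnd Φ (sl Φ U) (sl Φ U) e).rTensor (DP Φ n) (F.adSq n X.2.1))) ?_).symm⟩
      have h3 := F.rTensor_e_f X.1
      have h4 := F.adSq_eq X.2.1
      simp only [h1, h2, map_zero, add_zero] at h3 h4
      rw [sub_eq_add_neg]
      ext
      · simp [frankD_fst, h3]
      · simp [frankD_snd_fst, h4]
      · simp [frankD_snd_snd]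

/-- The odd part is `v ⊗ 𝒪_(div)`: an element `X = (x, a, h)` killed by `d²` differs by an element
of `ker d + im d` from `v ⊗ g`, where `(e ⊗ 1) x = w ⊗ g`. -/
theorem odLin_bijective : Function.Bijective (F.odLin n) := by
  have hdd : ∀ g, frankD S n e (frankD S n e (Frank.inU S n (F.v ⊗ₜ g))) = 0 := fun g => by
    rw [frankD_inU, frankD_inU, F.e_v, F.e_w, TensorProduct.zero_tmul, map_zero]
  constructor
  · rw [injective_iff_map_eq_zero]
    intro g hg
    obtain ⟨z, hz⟩ := odCls_eq_zero.mp hg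
    have h := congrArg (fun X : Frank S n => X.1) hz
    have h' : F.w ⊗ₜ[Φ] g = 0 := by
      simpa [sub_eq_add_neg, frankD_fst, F.rTensor_e_e, F.e_v] using h
    have h'' := congrArg (TensorProduct.lid Φ (DP Φ n))
      (congrArg ((S.form.flip F.v).rTensor (DP Φ n)) h')
    simpa [F.form_ne] using h''
  · intro t
    induction t using Subquot.induction with
    | h X hX =>
      rw [LinearMap.mem_ker, LinearMap.comp_apply] at hX
      have h1 : (LieModule.toEnd Φ (sl Φ U) (sl Φ U) e).rTensor (DP Φ n)
          ((LieModule.toEnd Φ (sl Φ U) (sl Φ U) e).rTensor (DP Φ n) X.2.1) = 0 := by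
        rw [← frankD_snd_fst, ← frankD_snd_fst, hX]; rfl
      have h2 := F.adSq_eq ((LieModule.toEnd Φ (sl Φ U) (sl Φ U) e).rTensor (DP Φ n) X.2.1)
      simp only [h1, map_zero, add_zero] at h2
      have h4 : ∃ g, (e : Module.End Φ U).rTensor (DP Φ n) X.1 = F.w ⊗ₜ g := by
        generalize X.1 = t
        induction t using TensorProduct.induction_on with
        | zero => exact ⟨0, by simp⟩
        | tmul u g =>
          refine ⟨((S.form F.w F.v)⁻¹ * S.form F.w u) • g, ?_⟩
          have h := congrArg (e : Module.End Φ U) (F.smul_eq u)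
          rw [map_smul, map_add, map_smul, map_smul, F.e_v, F.e_w, smul_zero, zero_add] at h
          rw [LinearMap.rTensor_tmul, TensorProduct.tmul_smul, TensorProduct.smul_tmul', mul_smul,
            ← h, inv_smul_smul₀ F.form_ne]
        | add x y hx hy =>
          obtain ⟨g, hg⟩ := hx
          obtain ⟨g', hg'⟩ := hy
          exact ⟨g + g', by rw [map_add, hg, hg', TensorProduct.tmul_add]⟩
      obtain ⟨g, hg⟩ := h4
      refine ⟨g, (odCls_eq (hx := hX) (hy := hdd g) (Frank.inSl S n (F.adSq n
        ((LieModule.toEnd Φ (sl Φ U) (sl Φ U) e).rTensor (DP Φ n) X.2.1))) ?_).symm⟩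
      rw [sub_eq_add_neg]
      ext
      · simp [frankD_fst, hg, F.e_v]
      · simp [frankD_snd_fst, h2]
      · simp [frankD_snd_snd]

end SlFrame

end FrankOperator

/-! ### The superalgebra of the Frank algebra -/

section FrankSuper

attribute [local instance] LieRing.ofAssociativeRing

variable {Φ U : Type u} [Field Φ] [CharP Φ 3] [AddCommGroup U] [Module Φ U]
  {S : SymplecticPlane Φ U} {n : ℕ} {e : sl Φ U} {he : IsNilpotent (e : Module.End Φ U)}
  (F : SlFrame S e)

variable (S n) in
/-- The bracket of `ℱ(n)` as a linear map on the tensor product. -/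
def frankMul : Frank S n ⊗[Φ] Frank S n →ₗ[Φ] Frank S n :=
  TensorProduct.lift (LieAlgebra.ad Φ (Frank S n)).toLinearMap

theorem frankMul_comm (he : IsNilpotent (e : Module.End Φ U)) :
    frankMul S n ∘ₗ tensorD (frankD S n e) (frankD S n e) = frankD S n e ∘ₗ frankMul S n :=
  (frankAlgebra S n e he).mul.comm

theorem frankMul_evEv (x x' : DP Φ n) :
    evMap (frankMul S n) (frankMul_comm he)
      (evEv (frankD S n e) (frankD S n e) (SlFrame.evLin n x) (SlFrame.evLin n x')) =
    SlFrame.evLin n (wittBr Φ n x x') :=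
  Subquot.cls_congr _ (Frank.lie_WW x x')

theorem frankMul_evOd (x y : DP Φ n) :
    odMap (frankMul S n) (frankMul_comm he)
      (evOd (frankD S n e) (frankD S n e) (SlFrame.evLin n x) (F.odLin n y)) =
    F.odLin n (divAct Φ n x y) :=
  Subquot.cls_congr _ (Frank.lie_WU F.v x y)

theorem frankMul_odEv (x y : DP Φ n) :
    odMap (frankMul S n) (frankMul_comm he)
      (odEv (frankD S n e) (frankD S n e) (F.odLin n y) (SlFrame.evLin n x)) =
    -F.odLin n (divAct Φ n x y) :=
  Subquot.cls_congr _ (Frank.lie_UW F.v x y)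

/-- In `[v ⊗ y, w ⊗ y'] - [w ⊗ y, v ⊗ y']` the components in `𝔰𝔩(U) ⊗ 𝒪` cancel, since `φ` is
symmetric; the components in `W` add up to `-2 λ(w, v) y y' ∂`. -/
theorem lie_sub_lie (v w : U) (y y' : DP Φ n) :
    ⁅Frank.inU S n (v ⊗ₜ y), Frank.inU S n (w ⊗ₜ y')⁆ -
      ⁅Frank.inU S n (w ⊗ₜ y), Frank.inU S n (v ⊗ₜ y')⁆ =
    Frank.inW S n (S.form w v • (y * y')) := by
  have h3 : (3 : Φ) = 0 := CharP.cast_eq_zero Φ 3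
  have h : S.form v w • (y * y') - S.form w v • (y * y') = S.form w v • (y * y') := by
    rw [S.skew v]
    linear_combination (norm := module) -h3 • S.form w v • (y * y')
  rw [Frank.lie_UU, Frank.lie_UU, Frank.phi_comm w, add_sub_add_left_eq_sub, ← map_sub, h]

theorem frankMul_odOd (y y' : DP Φ n) :
    evMap (frankMul S n) (frankMul_comm he)
      (odOd (frankD S n e) (frankD S n e) (F.odLin n y) (F.odLin n y')) =
    SlFrame.evLin n ((S.form F.w F.v • LinearMap.mul Φ (DP Φ n)) y y') := by
  have h := lie_sub_lie (S := S) F.v F.w y y'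
  have hD : ∀ g, Frank.inU S n (F.w ⊗ₜ g) = frankD S n e (Frank.inU S n (F.v ⊗ₜ g)) := fun g => by
    rw [frankD_inU, F.e_v]
  rw [hD, hD] at h
  have h' : frankMul S n (wronskian (frankD S n e) (frankD S n e) (Frank.inU S n (F.v ⊗ₜ y))
      (Frank.inU S n (F.v ⊗ₜ y'))) = Frank.inW S n (S.form F.w F.v • (y * y')) := by
    rw [wronskian_apply, map_sub]
    exact h
  exact Subquot.cls_congr _ h'

/-- The even and the odd part of `ℱ(n)`, with the products induced by the bracket. -/
theorem SlFrame.superalgebra_isomorphic_frank :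
    (superalgebra (wittBr Φ n) (divAct Φ n)
      (S.form F.w F.v • LinearMap.mul Φ (DP Φ n))).Isomorphic
    (((frankAlgebra S n e he).map (semisimplify Φ)).map (semiToSuper Φ)) := by
  let e₀ : DP Φ n ≃ₗ[Φ] Ev (frankD S n e) := .ofBijective _ F.evLin_bijective
  let e₁ : DP Φ n ≃ₗ[Φ] Od (frankD S n e) := .ofBijective _ F.odLin_bijective
  refine ⟨SVec.isoMk (X := (superalgebra (wittBr Φ n) (divAct Φ n)
      (S.form F.w F.v • LinearMap.mul Φ (DP Φ n))).obj)
    (Y := toSuper.obj (frankRep S n e he)) (e₀.prodCongr e₁)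
    (LinearMap.ext fun x => Prod.ext (map_zero e₀) rfl), ?_⟩
  -- the tensorator of the quotient functor is the identity
  have hmul : (((frankAlgebra S n e he).map (semisimplify Φ)).map (semiToSuper Φ)).mul =
      (superMulIso (frankRep S n e he) (frankRep S n e he)).hom ≫
        toSuper.map (frankAlgebra S n e he).mul := by
    change Functor.LaxMonoidal.μ (semiToSuper Φ) _ _ ≫ (semiToSuper Φ).map
      (Functor.LaxMonoidal.μ (semisimplify Φ) _ _ ≫ (semisimplify Φ).map _) = _
    have hμ : Functor.LaxMonoidal.μ (semisimplify Φ) (frankRep S n e he) (frankRep S n e he) =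
      𝟙 _ := rfl
    erw [hμ, Category.id_comp]
    rfl
  rw [hmul]
  refine SVec.hom_ext (TensorProduct.ext' ?_)
  rintro ⟨x, y⟩ ⟨x', y'⟩
  change (e₀ (wittBr Φ n x x' + (S.form F.w F.v • LinearMap.mul Φ (DP Φ n)) y y'),
      e₁ (divAct Φ n x y' - divAct Φ n x' y)) =
    (evMap (frankMul S n) (frankMul_comm he) (evEv (frankD S n e) (frankD S n e) (evLin n x)
        (evLin n x') + odOd (frankD S n e) (frankD S n e) (F.odLin n y) (F.odLin n y')),
      odMap (frankMul S n) (frankMul_comm he) (evOd (frankD S n e) (frankD S n e) (evLin n x)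
        (F.odLin n y') + odEv (frankD S n e) (frankD S n e) (F.odLin n y) (evLin n x')))
  rw [map_add, map_add, map_sub, map_add (odMap _ _), frankMul_evEv (he := he), frankMul_evOd F (he := he),
    frankMul_odEv F (he := he), frankMul_odOd F (he := he), sub_eq_add_neg]
  rfl

end FrankSuper

end

end FrankSemisimplification

theorem mainTheorem1 (Φ : Type u) [Field Φ] [CharP Φ 3] :
    ∃ (E : Semisimplification Φ ≌ SVec Φ) (_ : E.functor.Braided),
      E.functor.Additive ∧ E.functor.Linear Φ ∧
      ∀ n : ℕ, 1 ≤ n →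
        (∀ (U : Type u) [AddCommGroup U] [Module Φ U] (S : SymplecticPlane Φ U) (e : sl Φ U)
            (he : IsNilpotent (e : Module.End Φ U)), e ≠ 0 →
          AlgebraIn.Isomorphic
            (((frankAlgebra S n e he).map (semisimplify Φ)).map E.functor)
            (contactAlgebra Φ n)) ∧
        AlgebraIn.Isomorphic (contactAlgebra Φ n) (wittDivAlgebra Φ n) := by
  refine ⟨(semiToSuper Φ).asEquivalence, (inferInstance : (semiToSuper Φ).Braided),
    (inferInstance : (semiToSuper Φ).Additive), (inferInstance : (semiToSuper Φ).Linear Φ),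
    fun n hn => ?_⟩
  have hcontact := (wittDivAlgebra_isomorphic_contactAlgebra (Φ := Φ) hn).symm
  refine ⟨fun U _ _ S e he h0 => ?_, hcontact⟩
  obtain ⟨F⟩ := SlFrame.nonempty S e he h0
  have hfrank := F.superalgebra_isomorphic_frank (n := n) (he := he)
  exact (hfrank.symm.trans (superalgebra_isomorphic_wittDivAlgebra F.form_ne)).trans hcontact.symm
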